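/- Consider the class of nonlinear wave equations $u_{tt}=f(x,u_x)u_{xx}+g(x,u_x)$ for an unknown function $u=u(t,x)$, parameterized by the pair $\theta=(f,g)$ of arbitrary elements. All considerations are local and smooth ($C^\infty$): $f$ and $g$ are smooth functions on an open subset of the space of $(t,x,u,u_t,u_x,u_{tt},u_{tx},u_{xx})$ that is not restricted in the second-order derivatives; they depend only on $x$ and $u_x$ in the sense that $f_t=f_u=f_{u_t}=f_{u_{tt}}=f_{u_{tx}}=f_{u_{xx}}=0$, and similarly for $g$; $f$ vanishes nowhere; and $(f_{u_x},g_{u_xu_x})\neq(0,0)$, meaning that $f_{u_x}$ and $g_{u_xu_x}$ do not both vanish identically on any nonempty open part of the domain. The equation $\mathcal L_\theta$ is regarded as the submanifold $u_{tt}=fu_{xx}+g$ of the second-order jet space over the domain of $\theta$. A point transformation is a smooth diffeomorphism between open subsets of a space. An admissible transformation of a class of such equations is a triple $(\theta,\tilde\theta,\varphi)$, where $\theta,\tilde\theta$ belong to the class and $\varphi$ is a point transformation of the variables $(t,x,u)$, defined over the domain of $\mathcal L_\theta$, whose second prolongation maps $\mathcal L_\theta$ onto $\mathcal L_{\tilde\theta}$.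 The equivalence (pseudo)group of a class consists of the point transformations $\Phi$ of the space of $(t,x,u,u_t,u_x,u_{tt},u_{tx},u_{xx},f,g)$, with domain not restricted in $u_{tt},u_{tx},u_{xx}$, such that $\Phi$ is projectable to a point transformation $\Phi|_{(t,x,u)}$ of $(t,x,u)$, its projection to the jet space is the second prolongation of $\Phi|_{(t,x,u)}$, and, for each $\theta$ of the class whose graph lies in the domain of $\Phi$, $\Phi$ maps the graph of $\theta$ onto the graph of an element $\Phi\theta$ of the class and $\Phi|_{(t,x,u)}$ maps $\mathcal L_\theta$ to $\mathcal L_{\Phi\theta}$. The class is normalized if for each of its admissible transformations $(\theta,\tilde\theta,\varphi)$ there is a $\Phi$ in its equivalence group such that $\tilde\theta=\Phi\theta$ and $\varphi=\Phi|_{(t,x,u)}$ over the domain of $\mathcal L_\theta$. Theorem. Consider the subclass singled out by the constraints $f_{u_x}=0$ and $g_{u_xu_x}\neq0$, where the latter means that $g_{u_xu_x}$ does not vanish identically on any nonempty open part of the domain. (i) The subclass is preserved by the admissible transformations of the entire class: if $(\theta,\tilde\theta,\varphi)$ is an admissible transformation of the class and $\theta$ belongs to the subclass, then so does $\tilde\theta$.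 (ii) The subclass is normalized. (iii) The equivalence group of the subclass coincides with the equivalence group $G^\sim$ of the entire class. -/

import Mathlib

open scoped ContDiff

namespace WaveClass

/-!
Coordinates.
* Space of variables `Fin 3 → ℝ`: `0 ↦ t`, `1 ↦ x`, `2 ↦ u`.
* Second-order jet space `Fin 8 → ℝ`: `0 ↦ t`, `1 ↦ x`, `2 ↦ u`, `3 ↦ u_t`, `4 ↦ u_x`,
  `5 ↦ u_tt`, `6 ↦ u_tx`, `7 ↦ u_xx`.
* Space of jets and arbitrary elements `Fin 10 → ℝ`: the eight jet coordinates,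
  followed by `8 ↦ f`, `9 ↦ g`.
-/

/-- The space of the variables `(t, x, u)`. -/
abbrev Base := Fin 3 → ℝ

/-- The second-order jet space, with coordinates `(t, x, u, u_t, u_x, u_tt, u_tx, u_xx)`. -/
abbrev Jet := Fin 8 → ℝ

/-- The space with coordinates `(t, x, u, u_t, u_x, u_tt, u_tx, u_xx, f, g)`. -/
abbrev Ext := Fin 10 → ℝ

/-- The projection of a jet to the space of variables `(t, x, u)`. -/
def Jet.base (j : Jet) : Base := fun i => j (Fin.castLE (by norm_num) i)

/-- The projection `(t, x, u_(2), f, g) ↦ (t, x, u_(2))`. -/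
def Ext.jet (w : Ext) : Jet := fun i => w (Fin.castLE (by norm_num) i)

/-- The partial derivative with respect to the `i`-th coordinate. -/
noncomputable def pd {n : ℕ} (i : Fin n) (F : (Fin n → ℝ) → ℝ) (z : Fin n → ℝ) : ℝ :=
  fderiv ℝ F z (Pi.single i 1)

/-- `A` is a full cylinder in the directions of the second-order derivatives
`u_tt`, `u_tx`, `u_xx`. -/
def FreeInSecondDerivatives {n : ℕ} (A : Set (Fin n → ℝ)) : Prop :=
  ∀ w ∈ A, ∀ w' : Fin n → ℝ,
    (∀ i : Fin n, (i : ℕ) ∉ ({5, 6, 7} : Finset ℕ) → w' i = w i) → w' ∈ A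

/-- A value `θ = (f, g)` of the tuple of arbitrary elements: two smooth functions on an open
subset of the jet space, which is not restricted in the second-order derivatives.
The auxiliary conditions on `f` and `g` are imposed by the classes below.
The values of `f` and `g` outside `dom` play no role. -/
structure ArbitraryElements where
  dom : Set Jet
  isOpen_dom : IsOpen dom
  free_dom : FreeInSecondDerivatives dom
  f : Jet → ℝ
  g : Jet → ℝ
  smooth_f : ContDiffOn ℝ ∞ f dom
  smooth_g : ContDiffOn ℝ ∞ g dom

namespace ArbitraryElements

/-- The equation `u_tt = f u_xx + g` as a submanifold of the second-order jet space. -/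
def equation (θ : ArbitraryElements) : Set Jet :=
  {j | j ∈ θ.dom ∧ j 5 = θ.f j * j 7 + θ.g j}

/-- The graph of `θ = (f, g)` in the space of `(t, x, u_(2), f, g)`. -/
def graph (θ : ArbitraryElements) : Set Ext :=
  {w | Ext.jet w ∈ θ.dom ∧ w 8 = θ.f (Ext.jet w) ∧ w 9 = θ.g (Ext.jet w)}

end ArbitraryElements

/-- `F` depends at most on `x` and `u_x` in the sense of the auxiliary system
`F_t = F_u = F_{u_t} = F_{u_tt} = F_{u_tx} = F_{u_xx} = 0`. -/
def DependsOnXUx (A : Set Jet) (F : Jet → ℝ) : Prop :=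
  ∀ j ∈ A, pd 0 F j = 0 ∧ pd 2 F j = 0 ∧ pd 3 F j = 0 ∧
    pd 5 F j = 0 ∧ pd 6 F j = 0 ∧ pd 7 F j = 0

/-- The class of the nonlinear equations `u_tt = f(x, u_x) u_xx + g(x, u_x)`: `f` vanishes
nowhere, and `(f_{u_x}, g_{u_x u_x}) ≠ (0, 0)`, i.e. these two functions do not both vanish
identically on any nonempty open part of the domain. -/
def waveClass : Set ArbitraryElements :=
  {θ | DependsOnXUx θ.dom θ.f ∧ DependsOnXUx θ.dom θ.g ∧
    (∀ j ∈ θ.dom, θ.f j ≠ 0) ∧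
    ∀ V : Set Jet, IsOpen V → V ⊆ θ.dom → V.Nonempty →
      ∃ j ∈ V, (pd 4 θ.f j, pd 4 (pd 4 θ.g) j) ≠ (0, 0)}

/-- The subclass singled out by `f_{u_x} = 0` and `g_{u_x u_x} ≠ 0`, where the latter means, as
in the definition of the class, that `g_{u_x u_x}` does not vanish identically on any nonempty
open part of the domain. -/
def waveSubclass : Set ArbitraryElements :=
  {θ | θ ∈ waveClass ∧ (∀ j ∈ θ.dom, pd 4 θ.f j = 0) ∧
    ∀ V : Set Jet, IsOpen V → V ⊆ θ.dom → V.Nonempty → ∃ j ∈ V, pd 4 (pd 4 θ.g) j ≠ 0}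

/-- A (local) point transformation: a diffeomorphism between open subsets. -/
structure PointTransformation (n : ℕ) where
  toMap : OpenPartialHomeomorph (Fin n → ℝ) (Fin n → ℝ)
  smooth : ContDiffOn ℝ ∞ toMap toMap.source
  smooth_symm : ContDiffOn ℝ ∞ toMap.symm toMap.target

/-- The total derivative `D_t F` of a function `F` of `(t, x, u)`. -/
noncomputable def Dt (F : Base → ℝ) (j : Jet) : ℝ :=
  pd 0 F j.base + j 3 * pd 2 F j.base

/-- The total derivative `D_x F` of a function `F` of `(t, x, u)`. -/
noncomputable def Dx (F : Base → ℝ) (j : Jet) : ℝ :=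
  pd 1 F j.base + j 4 * pd 2 F j.base

/-- The total derivative `D_t D_t F` of a function `F` of `(t, x, u)`. -/
noncomputable def Dtt (F : Base → ℝ) (j : Jet) : ℝ :=
  pd 0 (pd 0 F) j.base + 2 * j 3 * pd 0 (pd 2 F) j.base
    + j 3 ^ 2 * pd 2 (pd 2 F) j.base + j 5 * pd 2 F j.base

/-- The total derivative `D_t D_x F` of a function `F` of `(t, x, u)`. -/
noncomputable def Dtx (F : Base → ℝ) (j : Jet) : ℝ :=
  pd 0 (pd 1 F) j.base + j 4 * pd 0 (pd 2 F) j.base + j 3 * pd 1 (pd 2 F) j.base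
    + j 3 * j 4 * pd 2 (pd 2 F) j.base + j 6 * pd 2 F j.base

/-- The total derivative `D_x D_x F` of a function `F` of `(t, x, u)`. -/
noncomputable def Dxx (F : Base → ℝ) (j : Jet) : ℝ :=
  pd 1 (pd 1 F) j.base + 2 * j 4 * pd 1 (pd 2 F) j.base
    + j 4 ^ 2 * pd 2 (pd 2 F) j.base + j 7 * pd 2 F j.base

/-- `j'` is the image of the jet `j` under the second prolongation of the transformation
`φ = (T, X, U)`. The prolongation is defined at `j` if `D_tT D_xX - D_tX D_xT ≠ 0`, and then the
derivatives of `ũ` are the unique solution of the linear equations obtained by applying `D_t`,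
`D_x`, `D_t²`, `D_t D_x` and `D_x²` to `ũ(T, X) = U`. -/
def Prolongs (φ : Base → Base) (j j' : Jet) : Prop :=
  let T : Base → ℝ := fun z => φ z 0
  let X : Base → ℝ := fun z => φ z 1
  let U : Base → ℝ := fun z => φ z 2
  Dt T j * Dx X j - Dt X j * Dx T j ≠ 0 ∧
  j'.base = φ j.base ∧
  Dt U j = j' 3 * Dt T j + j' 4 * Dt X j ∧
  Dx U j = j' 3 * Dx T j + j' 4 * Dx X j ∧
  Dtt U j = j' 5 * Dt T j ^ 2 + 2 * j' 6 * (Dt T j * Dt X j) + j' 7 * Dt X j ^ 2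
    + j' 3 * Dtt T j + j' 4 * Dtt X j ∧
  Dtx U j = j' 5 * (Dt T j * Dx T j) + j' 6 * (Dt T j * Dx X j + Dx T j * Dt X j)
    + j' 7 * (Dt X j * Dx X j) + j' 3 * Dtx T j + j' 4 * Dtx X j ∧
  Dxx U j = j' 5 * Dx T j ^ 2 + 2 * j' 6 * (Dx T j * Dx X j) + j' 7 * Dx X j ^ 2
    + j' 3 * Dxx T j + j' 4 * Dxx X j

/-- `φ` maps the equation with arbitrary elements `θ` to the one with arbitrary elements `θ'`:
`φ` is defined over the domain of `θ`, and its second prolongation maps the submanifold of the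
first equation onto the submanifold of the second one. (Jets of the first equation at which the
prolongation is undefined are disregarded, so that this is the weakest form of the notion.) -/
def MapsEquation (φ : PointTransformation 3) (θ θ' : ArbitraryElements) : Prop :=
  (∀ j ∈ θ.dom, j.base ∈ φ.toMap.source) ∧
  {j' | ∃ j ∈ θ.equation, Prolongs φ.toMap j j'} = θ'.equation

/-- The set of admissible transformations `(θ, θ', φ)` of a class of equations. -/
def admissibleTransformations (S : Set ArbitraryElements) :
    Set (ArbitraryElements × ArbitraryElements × PointTransformation 3) :=
  {τ | τ.1 ∈ S ∧ τ.2.1 ∈ S ∧ MapsEquation τ.2.2 τ.1 τ.2.1}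

/-- `Φ θ = θ'`: `Φ` is defined on the graph of `θ` and maps it onto the graph of `θ'`. -/
def ActsTo (Φ : PointTransformation 10) (θ θ' : ArbitraryElements) : Prop :=
  θ.graph ⊆ Φ.toMap.source ∧ Φ.toMap '' θ.graph = θ'.graph

/-- `Φ` is projectable to the space of `(t, x, u)` with projection `φ = Φ|_(t,x,u)`, and its
projection to the jet space is the second prolongation of `φ`. (As the first-order components of
the prolongation depend only on first-order jets, `Φ` is then also projectable to the spaces of
first- and second-order jets.) -/
def IsContactLiftOf (Φ : PointTransformation 10) (φ : PointTransformation 3) : Prop :=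
  φ.toMap.source = (fun w : Ext => (Ext.jet w).base) '' Φ.toMap.source ∧
  ∀ w ∈ Φ.toMap.source, Prolongs φ.toMap (Ext.jet w) (Ext.jet (Φ.toMap w))

/-- `Φ` is a (usual) equivalence transformation of the class `S`, and `φ = Φ|_(t,x,u)`:
`Φ` is consistent with the contact structure, and whenever it is defined on the graph of an
element `θ` of `S`, it maps `θ` to an element `θ'` of `S`, and its projection `φ` maps the
equation with arbitrary elements `θ` to the one with arbitrary elements `θ'`. -/
def IsEquivalenceTransformation (S : Set ArbitraryElements)
    (Φ : PointTransformation 10) (φ : PointTransformation 3) : Prop :=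
  FreeInSecondDerivatives Φ.toMap.source ∧
  IsContactLiftOf Φ φ ∧
  ∀ θ ∈ S, θ.graph ⊆ Φ.toMap.source →
    ∃ θ' ∈ S, ActsTo Φ θ θ' ∧ MapsEquation φ θ θ'

/-- The (usual) equivalence (pseudo)group of the class `S`. -/
def equivalenceGroup (S : Set ArbitraryElements) : Set (PointTransformation 10) :=
  {Φ | ∃ φ, IsEquivalenceTransformation S Φ φ}

/-- The class `S` is normalized: each admissible transformation `(θ, θ', φ)` is induced by an
equivalence transformation `Φ` of the class, i.e. `Φ θ = θ'`, and `Φ|_(t,x,u)` is `φ` on the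
domain of the variables `(t, x, u)` of the equation. -/
def Normalized (S : Set ArbitraryElements) : Prop :=
  ∀ θ θ' : ArbitraryElements, ∀ φ : PointTransformation 3,
    (θ, θ', φ) ∈ admissibleTransformations S →
    ∃ Φ ∈ equivalenceGroup S, ∃ ψ : PointTransformation 3,
      IsContactLiftOf Φ ψ ∧ ActsTo Φ θ θ' ∧
      Set.EqOn ψ.toMap φ.toMap (Jet.base '' θ.dom)

end WaveClass

namespace WaveClass

/-! Write `φ = (T, X, U)`, `q` for the argument `u_x`, and tildes for the data of the target
equation. On an equation of the class `u_tx` and `u_xx` are free, so the condition that the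
prolonged jet satisfies the target equation is affine in them, and its coefficients split off
(`MapsEquation.determining`): two relations linking `f`, `f̃` and the total derivatives of `T` and
`X`, and one linking `g` and `g̃`. Everything else comes from differentiating these relations along
single coordinates.

Eliminating `f̃` from the first two gives `f D_xT D_xX = D_tT D_tX`. If `f_q = 0`, its derivatives
in `u_t` and `u_x` form a linear system for `(T_u, X_u)` with determinant the total Jacobian up to
sign and the factor `f`, so `T_u = X_u = 0`. Then `ũ_x̃` is affine in `(u_t, u_x)` and not constant,
while the first two relations no longer involve these variables except through `f̃`; hence `f̃_q =
0`. As the target lies in the class, `g̃_qq` cannot vanish on an open set, which is claim (i).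

Inside the subclass, differentiating the third relation in `u_t` and then `u_x` leaves `T_t T_x
g̃_qq = 0`, so `T_t T_x = 0` by density of the points with `g̃_qq ≠ 0`. If `T_t = 0` somewhere, `φ`
exchanges the roles of `t` and `x` nearby. Then `g_qq` and `g̃_qq` are both governed by `U_uu`: one
of the resulting identities makes `U_uu / U_u` independent of `u`, the other makes `U_uu / U_u ^ 2`
independent of `u`. Together they force `U_uu = 0`, so `g_qq = 0`, a contradiction
(`SubclassMap.T_t_ne_zero`). Hence `T_x = X_t = 0`, and further differentiation gives all conditions
of `IsSpecialAt` together with explicit formulas for `f̃` and `g̃`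
(`SubclassMap.isSpecialAt_and_g_transform`).

Conversely, a special `φ` lifts by those formulas to an invertible map of the space with coordinates
`f`, `g`, and the lift sends every element of the whole class to an element of the class, since all
coefficients involved depend on `x` only. This yields normalization. For claim (iii), through each
point with `f ≠ 0` of the domain of an equivalence transformation of the subclass passes the graph
of a subclass element with constant `f` and quadratic `g`. So the transformation is the lift of a
special `φ` wherever `f ≠ 0`, and therefore acts on the whole class. The opposite inclusion follows
from (i). -/

/-- `D` is the derivative of `F` at `z` along the `i`-th coordinate direction. -/
def HasPd {n : ℕ} (i : Fin n) (F : (Fin n → ℝ) → ℝ) (z : Fin n → ℝ) (D : ℝ) : Prop :=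
  HasDerivAt (fun s : ℝ => F (z + s • Pi.single i 1)) D 0

/-! ### Differentiation along coordinate lines -/

section Calculus

variable {n : ℕ} {i : Fin n} {F G : (Fin n → ℝ) → ℝ} {z : Fin n → ℝ} {D E : ℝ}

theorem hasPd_const (c : ℝ) : HasPd i (fun _ => c) z 0 := hasDerivAt_const _ _

theorem HasPd.congr_deriv (h : HasPd i F z D) (e : D = E) : HasPd i F z E := e ▸ h

theorem HasPd.add (hF : HasPd i F z D) (hG : HasPd i G z E) :
    HasPd i (fun y => F y + G y) z (D + E) := HasDerivAt.fun_add hF hG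

theorem HasPd.sub (hF : HasPd i F z D) (hG : HasPd i G z E) :
    HasPd i (fun y => F y - G y) z (D - E) := HasDerivAt.fun_sub hF hG

theorem HasPd.mul (hF : HasPd i F z D) (hG : HasPd i G z E) :
    HasPd i (fun y => F y * G y) z (D * G z + F z * E) := by
  have := HasDerivAt.fun_mul hF hG
  simpa [HasPd] using this

theorem HasPd.const_mul (c : ℝ) (hF : HasPd i F z D) :
    HasPd i (fun y => c * F y) z (c * D) := HasDerivAt.const_mul c hF

theorem HasPd.neg (hF : HasPd i F z D) : HasPd i (fun y => - F y) z (-D) := HasDerivAt.fun_neg hF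

theorem HasPd.sq (hF : HasPd i F z D) : HasPd i (fun y => F y ^ 2) z (2 * F z * D) := by
  have := hF.mul hF
  simp only [← pow_two] at this
  exact this.congr_deriv (by ring)

theorem HasPd.div (hF : HasPd i F z D) (hG : HasPd i G z E) (h : G z ≠ 0) :
    HasPd i (fun y => F y / G y) z ((D * G z - F z * E) / G z ^ 2) := by
  have := HasDerivAt.fun_div hF hG (by simpa using h)
  simpa [HasPd] using this

theorem hasPd_coord_self : HasPd i (fun y => y i) z 1 := by
  have : HasDerivAt (fun s : ℝ => z i + s) 1 0 := (hasDerivAt_id 0).const_add _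
  simpa [HasPd] using this

theorem hasPd_coord_of_ne {k : Fin n} (h : k ≠ i) : HasPd i (fun y => y k) z 0 := by
  simpa [HasPd, h] using hasDerivAt_const (0 : ℝ) (z k)

theorem hasDerivAt_line (i : Fin n) (z : Fin n → ℝ) :
    HasDerivAt (fun s : ℝ => z + s • (Pi.single i 1 : Fin n → ℝ)) (Pi.single i 1) 0 := by
  simpa using ((hasDerivAt_id (0 : ℝ)).smul_const (Pi.single i 1 : Fin n → ℝ)).const_add z

theorem hasPd_of_differentiableAt (h : DifferentiableAt ℝ F z) : HasPd i F z (pd i F z) := by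
  have h1 : HasFDerivAt F (fderiv ℝ F z) (z + (0 : ℝ) • Pi.single i 1) := by
    simpa using h.hasFDerivAt
  exact h1.comp_hasDerivAt (0 : ℝ) (hasDerivAt_line i z)

theorem HasPd.unique (hF : HasPd i F z D) (hG : HasPd i F z E) : D = E :=
  HasDerivAt.unique hF hG

theorem HasPd.pd_eq (hF : HasPd i F z D) (h : DifferentiableAt ℝ F z) : pd i F z = D :=
  (hasPd_of_differentiableAt h).unique hF

theorem HasPd.congr_of_eqOn {A : Set (Fin n → ℝ)} (hA : IsOpen A) (hz : z ∈ A)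
    (hF : HasPd i F z D) (h : ∀ y ∈ A, G y = F y) : HasPd i G z D := by
  refine HasDerivAt.congr_of_eventuallyEq hF ?_
  have hc : ContinuousAt (fun s : ℝ => z + s • (Pi.single i 1 : Fin n → ℝ)) 0 := by fun_prop
  have : ∀ᶠ s in nhds (0 : ℝ), z + s • (Pi.single i 1 : Fin n → ℝ) ∈ A :=
    hc.eventually_mem (hA.mem_nhds (by simpa using hz))
  filter_upwards [this] with s hs using h _ hs

/-- The tool for differentiating a determining equation: both sides agree on an open set, so their
derivatives along a coordinate agree. The derivatives of the two sides are built term by term from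
the `HasPd` rules, which need no differentiability side goals. -/
theorem HasPd.eq_of_eqOn {A : Set (Fin n → ℝ)} (hA : IsOpen A) (hz : z ∈ A)
    (hF : HasPd i F z D) (hG : HasPd i G z E) (h : ∀ y ∈ A, F y = G y) : D = E :=
  hF.unique (hG.congr_of_eqOn hA hz h)

theorem exists_line_mem {A : Set (Fin n → ℝ)} (hA : IsOpen A) (hz : z ∈ A) (i : Fin n) :
    ∃ s : ℝ, s ≠ 0 ∧ z + s • (Pi.single i 1 : Fin n → ℝ) ∈ A := by
  have hc : ContinuousAt (fun s : ℝ => z + s • (Pi.single i 1 : Fin n → ℝ)) 0 := by fun_prop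
  have h1 : ∀ᶠ s in nhds (0 : ℝ), z + s • (Pi.single i 1 : Fin n → ℝ) ∈ A :=
    hc.eventually_mem (hA.mem_nhds (by simpa using hz))
  have h2 : ∀ᶠ s in nhdsWithin (0 : ℝ) {0}ᶜ, s ≠ 0 := eventually_mem_nhdsWithin
  exact (h2.and (h1.filter_mono nhdsWithin_le_nhds)).exists

theorem fderiv_eq_sum (F : (Fin n → ℝ) → ℝ) (z v : Fin n → ℝ) :
    fderiv ℝ F z v = ∑ k, v k * pd k F z := by
  conv_lhs => rw [pi_eq_sum_univ' v, map_sum]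
  refine Finset.sum_congr rfl fun k _ => ?_
  rw [map_smul, smul_eq_mul, pd]

theorem _root_.ContDiffOn.pd {A : Set (Fin n → ℝ)} (hF : ContDiffOn ℝ ∞ F A) (hA : IsOpen A)
    (i : Fin n) : ContDiffOn ℝ ∞ (pd i F) A :=
  (hF.fderiv_of_isOpen hA (by simp)).clm_apply contDiffOn_const

theorem pd_comm {A : Set (Fin n → ℝ)} (hF : ContDiffOn ℝ ∞ F A) (hA : IsOpen A) (hz : z ∈ A)
    (i k : Fin n) : pd i (pd k F) z = pd k (pd i F) z := by
  have hc : ContDiffAt ℝ ∞ F z := hF.contDiffAt (hA.mem_nhds hz)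
  have hsym := hc.isSymmSndFDerivAt
    (by simp only [minSmoothness_of_isRCLikeNormedField]; exact WithTop.coe_le_coe.2 (le_top : (2 : ℕ∞) ≤ ⊤))
  have hd : DifferentiableAt ℝ (fderiv ℝ F) z :=
    (hc.fderiv_right (m := ∞) (by simp)).differentiableAt (by simp)
  have key : ∀ a b : Fin n, pd a (pd b F) z
      = fderiv ℝ (fderiv ℝ F) z (Pi.single a 1) (Pi.single b 1) := by
    intro a b
    unfold pd
    rw [fderiv_clm_apply hd (differentiableAt_const _)]
    simp
  rw [key, key, hsym]

theorem pd_congr {A : Set (Fin n → ℝ)} (hA : IsOpen A) (hz : z ∈ A) (h : ∀ y ∈ A, F y = G y)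
    (i : Fin n) : pd i F z = pd i G z := by
  unfold WaveClass.pd
  rw [Filter.EventuallyEq.fderiv_eq (Filter.eventually_of_mem (hA.mem_nhds hz) h)]

theorem pd_eq_zero_of_eqOn {A : Set (Fin n → ℝ)} (hA : IsOpen A) (hz : z ∈ A)
    (h : ∀ y ∈ A, F y = 0) (i : Fin n) : pd i F z = 0 := by
  rw [pd_congr hA hz (G := fun _ => 0) h i]
  simp [WaveClass.pd]

theorem _root_.ContDiffOn.hasPd {A : Set (Fin n → ℝ)} (hF : ContDiffOn ℝ ∞ F A) (hA : IsOpen A)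
    (hz : z ∈ A) (i : Fin n) : HasPd i F z (WaveClass.pd i F z) :=
  hasPd_of_differentiableAt ((hF.contDiffAt (hA.mem_nhds hz)).differentiableAt (by simp))

end Calculus

/-! ### Functions of `(t, x, u)` on the jet space -/

section Jets

variable {h : Base → ℝ} {j : Jet} {D : ℝ}

theorem base_line_zero (j : Jet) (s : ℝ) :
    Jet.base (j + s • Pi.single 0 1) = j.base + s • Pi.single 0 1 := by
  ext k; fin_cases k <;> simp [Jet.base]

theorem base_line_two (j : Jet) (s : ℝ) :
    Jet.base (j + s • Pi.single 2 1) = j.base + s • Pi.single 2 1 := by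
  ext k; fin_cases k <;> simp [Jet.base, Fin.ext_iff]

theorem base_line_fiber (j : Jet) (s : ℝ) {i : Fin 8} (hi : 3 ≤ (i : ℕ)) :
    Jet.base (j + s • Pi.single i 1) = j.base := by
  ext k
  have : Fin.castLE (by norm_num) k ≠ i := by
    intro e
    have := congrArg Fin.val e
    simp at this
    omega
  simp [Jet.base, this]

theorem HasPd.base_zero (H : HasPd 0 h j.base D) : HasPd 0 (fun j : Jet => h j.base) j D := by
  simpa only [HasPd, base_line_zero] using H

theorem HasPd.base_two (H : HasPd 2 h j.base D) : HasPd 2 (fun j : Jet => h j.base) j D := by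
  simpa only [HasPd, base_line_two] using H

theorem hasPd_base_fiber (h : Base → ℝ) (j : Jet) {i : Fin 8} (hi : 3 ≤ (i : ℕ)) :
    HasPd i (fun j : Jet => h j.base) j 0 := by
  simpa only [HasPd, base_line_fiber j _ hi] using hasDerivAt_const (0 : ℝ) (h j.base)

theorem contDiff_base : ContDiff ℝ ∞ Jet.base := by
  rw [contDiff_pi]; intro k; unfold Jet.base; fun_prop

theorem continuous_base : Continuous Jet.base := contDiff_base.continuous

theorem isOpen_image_base {A : Set Jet} (hA : IsOpen A) : IsOpen (Jet.base '' A) := by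
  let L : Jet →L[ℝ] Base :=
    ContinuousLinearMap.pi fun k => ContinuousLinearMap.proj (Fin.castLE (by norm_num) k)
  have hL : Function.Surjective L := by
    intro z
    refine ⟨fun k => if hk : (k : ℕ) < 3 then z ⟨k, hk⟩ else 0, ?_⟩
    ext k
    simp [L]
  exact L.isOpenMap hL A hA

end Jets
-- Functions of `x` and `u_x`
/-- `F` is a smooth function on `A` depending at most on `x` and `u_x`. -/
structure IsXUx (A : Set Jet) (F : Jet → ℝ) : Prop where
  smooth : ContDiffOn ℝ ∞ F A
  dep : DependsOnXUx A F

section XUx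

variable {A : Set Jet} {F : Jet → ℝ} {j : Jet}

theorem IsXUx.fderiv_apply (hF : IsXUx A F) (hj : j ∈ A) (v : Jet) :
    fderiv ℝ F j v = v 1 * pd 1 F j + v 4 * pd 4 F j := by
  obtain ⟨h0, h2, h3, h5, h6, h7⟩ := hF.dep j hj
  rw [fderiv_eq_sum, Fin.sum_univ_eight]
  simp [h0, h2, h3, h5, h6, h7]

theorem IsXUx.pd_four (hF : IsXUx A F) (hA : IsOpen A) : IsXUx A (pd 4 F) := by
  refine ⟨hF.smooth.pd hA 4, fun j hj => ?_⟩
  simp only [fun i => pd_comm hF.smooth hA hj i 4]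
  exact ⟨pd_eq_zero_of_eqOn hA hj (fun y hy => (hF.dep y hy).1) 4,
    pd_eq_zero_of_eqOn hA hj (fun y hy => (hF.dep y hy).2.1) 4,
    pd_eq_zero_of_eqOn hA hj (fun y hy => (hF.dep y hy).2.2.1) 4,
    pd_eq_zero_of_eqOn hA hj (fun y hy => (hF.dep y hy).2.2.2.1) 4,
    pd_eq_zero_of_eqOn hA hj (fun y hy => (hF.dep y hy).2.2.2.2.1) 4,
    pd_eq_zero_of_eqOn hA hj (fun y hy => (hF.dep y hy).2.2.2.2.2) 4⟩

/-- Chain rule in which only the `x̃` and `ũ_x̃` components of `Ψ` contribute; the derivatives of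
the others need not be computed. -/
theorem IsXUx.hasPd_comp (hF : IsXUx A F) (hA : IsOpen A) {Ψ : Jet → Jet} {i : Fin 8} {V W : ℝ}
    (hj : Ψ j ∈ A) (hΨ : DifferentiableAt ℝ Ψ j) (h1 : HasPd i (fun j => Ψ j 1) j V)
    (h4 : HasPd i (fun j => Ψ j 4) j W) :
    HasPd i (fun j => F (Ψ j)) j (V * pd 1 F (Ψ j) + W * pd 4 F (Ψ j)) := by
  have hΨ' : HasFDerivAt Ψ (fderiv ℝ Ψ j) (j + (0 : ℝ) • Pi.single i 1) := by
    simpa using hΨ.hasFDerivAt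
  have hc := hΨ'.comp_hasDerivAt (0 : ℝ) (hasDerivAt_line i j)
  have hcomp := hasDerivAt_pi.1 hc
  have e1 := h1.unique (hcomp 1)
  have e4 := h4.unique (hcomp 4)
  have hFd : HasFDerivAt F (fderiv ℝ F (Ψ j)) ((Ψ ∘ fun s : ℝ => j + s • Pi.single i 1) 0) := by
    simpa using ((hF.smooth.contDiffAt (hA.mem_nhds hj)).differentiableAt (by simp)).hasFDerivAt
  have := hFd.comp_hasDerivAt (0 : ℝ) hc
  rw [hF.fderiv_apply hj, ← e1, ← e4] at this
  exact this

/-- The domain is a full cylinder in the second-order directions, so the whole line through `j` and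
`k` stays in it and `F` has zero derivative along it. In the directions `t`, `u`, `u_t` the domain
may be disconnected, and independence of these holds only locally. -/
theorem IsXUx.eq_of_fiber (hF : IsXUx A F) (hA : IsOpen A) (hfree : FreeInSecondDerivatives A)
    (hj : j ∈ A) {k : Jet} (h : ∀ i : Fin 8, (i : ℕ) ∉ ({5, 6, 7} : Finset ℕ) → k i = j i) :
    F k = F j := by
  have hmem : ∀ s : ℝ, j + s • (k - j) ∈ A := fun s =>
    hfree j hj _ fun i hi => by simp [h i hi]
  have hd : ∀ s : ℝ, HasDerivAt (fun s : ℝ => F (j + s • (k - j))) 0 s := by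
    intro s
    have h1 : HasDerivAt (fun s : ℝ => j + s • (k - j)) (k - j) s := by
      simpa using ((hasDerivAt_id s).smul_const (k - j)).const_add j
    have h2 := ((hF.smooth.contDiffAt (hA.mem_nhds (hmem s))).differentiableAt
      (by simp)).hasFDerivAt.comp_hasDerivAt s h1
    rw [hF.fderiv_apply (hmem s)] at h2
    simpa [h 1 (by simp), h 4 (by simp), Function.comp_def] using h2
  have := is_const_of_deriv_eq_zero (fun s => (hd s).differentiableAt) (fun s => (hd s).deriv) 1 0
  simpa using this

end XUx

/-- The jet `j` with its second-order derivatives replaced by `r`, `s`, `t`. -/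
def setTop (j : Jet) (r s t : ℝ) : Jet := ![j 0, j 1, j 2, j 3, j 4, r, s, t]

theorem base_setTop (j : Jet) (r s t : ℝ) : (setTop j r s t).base = j.base := by
  ext k; fin_cases k <;> rfl

theorem setTop_agree (j : Jet) (r s t : ℝ) (i : Fin 8)
    (hi : (i : ℕ) ∉ ({5, 6, 7} : Finset ℕ)) : setTop j r s t i = j i := by
  fin_cases i <;> first | rfl | simp at hi

theorem FreeInSecondDerivatives.setTop_mem {A : Set Jet} (hA : FreeInSecondDerivatives A)
    {j : Jet} (hj : j ∈ A) (r s t : ℝ) : setTop j r s t ∈ A :=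
  hA j hj _ (setTop_agree j r s t)

/-! ### Explicit formulas for the second prolongation -/

section Prolongation

variable (φ : Base → Base) (j : Jet)

/-- The `k`-th component of `φ`. -/
def comp (k : Fin 3) : Base → ℝ := fun z => φ z k

/-- The total Jacobian `D_tT D_xX - D_tX D_xT`. -/
noncomputable def totalJac : ℝ :=
  Dt (comp φ 0) j * Dx (comp φ 1) j - Dt (comp φ 1) j * Dx (comp φ 0) j

/-- The derivative `ũ_t̃` of the prolongation. -/
noncomputable def prT : ℝ :=
  (Dt (comp φ 2) j * Dx (comp φ 1) j - Dx (comp φ 2) j * Dt (comp φ 1) j) / totalJac φ j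

/-- The derivative `ũ_x̃` of the prolongation. -/
noncomputable def prX : ℝ :=
  (Dx (comp φ 2) j * Dt (comp φ 0) j - Dt (comp φ 2) j * Dx (comp φ 0) j) / totalJac φ j

/-- The first prolongation, with zero second-order derivatives. -/
noncomputable def pr1 : Jet :=
  ![comp φ 0 j.base, comp φ 1 j.base, comp φ 2 j.base, prT φ j, prX φ j, 0, 0, 0]

/-- This and the next two are the right-hand sides of the linear system for `ũ_tt`, `ũ_tx`, `ũ_xx`
once the first-order terms have been moved over. -/
noncomputable def remTT : ℝ :=
  Dtt (comp φ 2) j - prT φ j * Dtt (comp φ 0) j - prX φ j * Dtt (comp φ 1) j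

noncomputable def remTX : ℝ :=
  Dtx (comp φ 2) j - prT φ j * Dtx (comp φ 0) j - prX φ j * Dtx (comp φ 1) j

noncomputable def remXX : ℝ :=
  Dxx (comp φ 2) j - prT φ j * Dxx (comp φ 0) j - prX φ j * Dxx (comp φ 1) j

/-- The second prolongation. -/
noncomputable def pr2 : Jet :=
  setTop (pr1 φ j)
    ((Dx (comp φ 1) j ^ 2 * remTT φ j - 2 * (Dt (comp φ 1) j * Dx (comp φ 1) j) * remTX φ j
      + Dt (comp φ 1) j ^ 2 * remXX φ j) / totalJac φ j ^ 2)
    ((-(Dx (comp φ 0) j * Dx (comp φ 1) j) * remTT φ j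
      + (Dt (comp φ 0) j * Dx (comp φ 1) j + Dt (comp φ 1) j * Dx (comp φ 0) j) * remTX φ j
      - Dt (comp φ 0) j * Dt (comp φ 1) j * remXX φ j) / totalJac φ j ^ 2)
    ((Dx (comp φ 0) j ^ 2 * remTT φ j - 2 * (Dt (comp φ 0) j * Dx (comp φ 0) j) * remTX φ j
      + Dt (comp φ 0) j ^ 2 * remXX φ j) / totalJac φ j ^ 2)

variable {φ j}

/-- Cramer's rule, twice: the first-order equations have the total Jacobian matrix as their matrix,
and the second-order ones its symmetric square, whose inverse has the squared Jacobian as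
denominator. -/
theorem prolongs_iff {j' : Jet} : Prolongs φ j j' ↔ totalJac φ j ≠ 0 ∧ j' = pr2 φ j := by
  have solve1 : ∀ a b c d u v P Q : ℝ, a * d - b * c ≠ 0 →
      (u = P * a + Q * b ∧ v = P * c + Q * d ↔
        P = (u * d - v * b) / (a * d - b * c) ∧ Q = (v * a - u * c) / (a * d - b * c)) := by
    intro a b c d u v P Q h
    rw [eq_div_iff h, eq_div_iff h]
    constructor
    · rintro ⟨rfl, rfl⟩; constructor <;> ring
    · rintro ⟨h1, h2⟩
      constructor <;> refine mul_right_cancel₀ h ?_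
      · linear_combination (-a) * h1 - b * h2
      · linear_combination (-c) * h1 - d * h2
  have solve2 : ∀ a b c d m n l r s t : ℝ, a * d - b * c ≠ 0 →
      (m = r * a ^ 2 + 2 * s * (a * b) + t * b ^ 2 ∧
        n = r * (a * c) + s * (a * d + c * b) + t * (b * d) ∧
        l = r * c ^ 2 + 2 * s * (c * d) + t * d ^ 2 ↔
        r = (d ^ 2 * m - 2 * (b * d) * n + b ^ 2 * l) / (a * d - b * c) ^ 2 ∧
        s = (-(c * d) * m + (a * d + b * c) * n - a * b * l) / (a * d - b * c) ^ 2 ∧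
        t = (c ^ 2 * m - 2 * (a * c) * n + a ^ 2 * l) / (a * d - b * c) ^ 2) := by
    intro a b c d m n l r s t h
    have h' := pow_ne_zero 2 h
    rw [eq_div_iff h', eq_div_iff h', eq_div_iff h']
    constructor
    · rintro ⟨rfl, rfl, rfl⟩; refine ⟨?_, ?_, ?_⟩ <;> ring
    · rintro ⟨h1, h2, h3⟩
      refine ⟨?_, ?_, ?_⟩ <;> refine mul_right_cancel₀ h' ?_
      · linear_combination (-a ^ 2) * h1 - 2 * a * b * h2 - b ^ 2 * h3
      · linear_combination (-a * c) * h1 - (a * d + c * b) * h2 - b * d * h3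
      · linear_combination (-c ^ 2) * h1 - 2 * c * d * h2 - d ^ 2 * h3
  have ext8 : j' = pr2 φ j ↔ j'.base = φ j.base ∧ (j' 3 = pr2 φ j 3 ∧ j' 4 = pr2 φ j 4) ∧
      j' 5 = pr2 φ j 5 ∧ j' 6 = pr2 φ j 6 ∧ j' 7 = pr2 φ j 7 := by
    constructor
    · rintro rfl
      refine ⟨?_, ⟨rfl, rfl⟩, rfl, rfl, rfl⟩
      ext k; fin_cases k <;> rfl
    · rintro ⟨h, ⟨h3, h4⟩, h5, h6, h7⟩
      ext k
      fin_cases k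
      · exact congrFun h 0
      · exact congrFun h 1
      · exact congrFun h 2
      all_goals assumption
  rw [ext8]
  refine and_congr_right fun hΔ => and_congr_right fun _ => ?_
  rw [← and_assoc (a := Dt _ j = _)]
  refine (and_congr_left' (solve1 _ _ _ _ _ _ _ _ hΔ)).trans (and_congr_right fun h => ?_)
  have hP : j' 3 = prT φ j := h.1
  have hQ : j' 4 = prX φ j := h.2
  rw [hP, hQ]
  refine Iff.trans ?_ (solve2 _ _ _ _ (remTT φ j) (remTX φ j) (remXX φ j) _ _ _ hΔ)
  unfold remTT remTX remXX comp
  refine and_congr ?_ (and_congr ?_ ?_) <;> constructor <;> intro h <;> linear_combination h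

theorem pr2_agree (i : Fin 8) (hi : (i : ℕ) ∉ ({5, 6, 7} : Finset ℕ)) : pr2 φ j i = pr1 φ j i :=
  setTop_agree _ _ _ _ i hi

theorem Dt_setTop (F : Base → ℝ) (j : Jet) (r s t : ℝ) : Dt F (setTop j r s t) = Dt F j := by
  simp only [Dt, base_setTop]; rfl

theorem Dx_setTop (F : Base → ℝ) (j : Jet) (r s t : ℝ) : Dx F (setTop j r s t) = Dx F j := by
  simp only [Dx, base_setTop]; rfl

theorem totalJac_setTop (r s t : ℝ) : totalJac φ (setTop j r s t) = totalJac φ j := by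
  simp only [totalJac, Dt_setTop, Dx_setTop]

theorem prT_setTop (r s t : ℝ) : prT φ (setTop j r s t) = prT φ j := by
  simp only [prT, Dt_setTop, Dx_setTop, totalJac_setTop]

theorem prX_setTop (r s t : ℝ) : prX φ (setTop j r s t) = prX φ j := by
  simp only [prX, Dt_setTop, Dx_setTop, totalJac_setTop]

theorem pr1_setTop (r s t : ℝ) : pr1 φ (setTop j r s t) = pr1 φ j := by
  simp only [pr1, base_setTop, prT_setTop, prX_setTop]

/-- The common coefficient of the second-order derivatives in `remTT`, `remTX`, `remXX`. -/
noncomputable def kappa (φ : Base → Base) (j : Jet) : ℝ :=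
  pd 2 (comp φ 2) j.base - prT φ j * pd 2 (comp φ 0) j.base - prX φ j * pd 2 (comp φ 1) j.base

theorem remTT_setTop (r s t : ℝ) :
    remTT φ (setTop j r s t) = remTT φ (setTop j 0 0 0) + kappa φ j * r := by
  simp only [remTT, prT_setTop, prX_setTop, Dtt, base_setTop, kappa]
  simp [setTop]; ring

theorem remTX_setTop (r s t : ℝ) :
    remTX φ (setTop j r s t) = remTX φ (setTop j 0 0 0) + kappa φ j * s := by
  simp only [remTX, prT_setTop, prX_setTop, Dtx, base_setTop, kappa]
  simp [setTop]; ring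

theorem remXX_setTop (r s t : ℝ) :
    remXX φ (setTop j r s t) = remXX φ (setTop j 0 0 0) + kappa φ j * t := by
  simp only [remXX, prT_setTop, prX_setTop, Dxx, base_setTop, kappa]
  simp [setTop]; ring

end Prolongation

/-! ### The Jacobian of a point transformation -/

namespace PointTransformation

variable (φ : PointTransformation 3) {z : Base}

theorem smooth_comp (k : Fin 3) : ContDiffOn ℝ ∞ (comp φ.toMap k) φ.toMap.source :=
  (contDiffOn_pi.1 φ.smooth) k

/-- The derivatives of `φ` and of its inverse compose to the identity, so the Jacobian matrix is
invertible; its determinant is written out for use in polynomial identities. -/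
theorem jac_ne_zero (hz : z ∈ φ.toMap.source) :
    pd 0 (comp φ.toMap 0) z * (pd 1 (comp φ.toMap 1) z * pd 2 (comp φ.toMap 2) z
        - pd 2 (comp φ.toMap 1) z * pd 1 (comp φ.toMap 2) z)
      - pd 1 (comp φ.toMap 0) z * (pd 0 (comp φ.toMap 1) z * pd 2 (comp φ.toMap 2) z
        - pd 2 (comp φ.toMap 1) z * pd 0 (comp φ.toMap 2) z)
      + pd 2 (comp φ.toMap 0) z * (pd 0 (comp φ.toMap 1) z * pd 1 (comp φ.toMap 2) z
        - pd 1 (comp φ.toMap 1) z * pd 0 (comp φ.toMap 2) z) ≠ 0 := by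
  have hd : DifferentiableAt ℝ φ.toMap z :=
    (φ.smooth.contDiffAt (φ.toMap.open_source.mem_nhds hz)).differentiableAt (by simp)
  have hd' : DifferentiableAt ℝ φ.toMap.symm (φ.toMap z) :=
    (φ.smooth_symm.contDiffAt (φ.toMap.open_target.mem_nhds
      (φ.toMap.map_source hz))).differentiableAt (by simp)
  have hid : (fderiv ℝ φ.toMap.symm (φ.toMap z)).comp (fderiv ℝ φ.toMap z)
      = ContinuousLinearMap.id ℝ Base := by
    rw [← fderiv_comp z hd' hd, ← fderiv_id (𝕜 := ℝ) (x := z)]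
    refine Filter.EventuallyEq.fderiv_eq ?_
    filter_upwards [φ.toMap.open_source.mem_nhds hz] with y hy using φ.toMap.left_inv hy
  have hpd : ∀ i k : Fin 3, pd i (comp φ.toMap k) z = fderiv ℝ φ.toMap z (Pi.single i 1) k := by
    intro i k
    have := hasFDerivAt_pi'.1 hd.hasFDerivAt k
    unfold pd comp
    rw [this.fderiv]
    rfl
  let M := LinearMap.toMatrix' (fderiv ℝ φ.toMap z : Base →ₗ[ℝ] Base)
  let M' := LinearMap.toMatrix' (fderiv ℝ φ.toMap.symm (φ.toMap z) : Base →ₗ[ℝ] Base)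
  have hM : M' * M = 1 := by
    rw [← LinearMap.toMatrix'_comp, ← LinearMap.toMatrix'_id]
    exact congrArg (fun L : Base →L[ℝ] Base => LinearMap.toMatrix' (L : Base →ₗ[ℝ] Base)) hid
  have hdet : M.det ≠ 0 := by
    intro h
    have := congrArg Matrix.det hM
    simp [h] at this
  have hMij : ∀ k i, M k i = pd i (comp φ.toMap k) z := by
    intro k i
    rw [hpd]
    simp [M, LinearMap.toMatrix'_apply]
  rw [Matrix.det_fin_three] at hdet
  simp only [hMij] at hdet
  intro h
  exact hdet (by linear_combination h)

end PointTransformation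
-- The determining equations
section Determining

variable {θ θ' : ArbitraryElements} {φ : PointTransformation 3} {j : Jet}

theorem isXUx_f (h : θ ∈ waveClass) : IsXUx θ.dom θ.f := ⟨θ.smooth_f, h.1⟩

theorem isXUx_g (h : θ ∈ waveClass) : IsXUx θ.dom θ.g := ⟨θ.smooth_g, h.2.1⟩

theorem IsXUx.setTop_eq {F : Jet → ℝ} (hF : IsXUx θ.dom F) (hj : j ∈ θ.dom) (r s t : ℝ) :
    F (setTop j r s t) = F j :=
  hF.eq_of_fiber θ.isOpen_dom θ.free_dom hj (setTop_agree j r s t)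

theorem setTop_mem_equation (h : θ ∈ waveClass) (hj : j ∈ θ.dom) (s t : ℝ) :
    setTop j (θ.f j * t + θ.g j) s t ∈ θ.equation := by
  refine ⟨θ.free_dom.setTop_mem hj _ _ _, ?_⟩
  rw [(isXUx_f h).setTop_eq hj, (isXUx_g h).setTop_eq hj]
  rfl

/-- The right-hand side is the full Jacobian of `φ`, so the coefficient of the second-order
derivatives never vanishes where the prolongation is defined. This permits dividing by it when
coefficients are compared. -/
theorem kappa_mul_totalJac (hΔ : totalJac φ.toMap j ≠ 0) :
    kappa φ.toMap j * totalJac φ.toMap j =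
      pd 0 (comp φ.toMap 0) j.base * (pd 1 (comp φ.toMap 1) j.base * pd 2 (comp φ.toMap 2) j.base
        - pd 2 (comp φ.toMap 1) j.base * pd 1 (comp φ.toMap 2) j.base)
      - pd 1 (comp φ.toMap 0) j.base * (pd 0 (comp φ.toMap 1) j.base
          * pd 2 (comp φ.toMap 2) j.base
        - pd 2 (comp φ.toMap 1) j.base * pd 0 (comp φ.toMap 2) j.base)
      + pd 2 (comp φ.toMap 0) j.base * (pd 0 (comp φ.toMap 1) j.base
          * pd 1 (comp φ.toMap 2) j.base
        - pd 1 (comp φ.toMap 1) j.base * pd 0 (comp φ.toMap 2) j.base) := by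
  have h1 : prT φ.toMap j * totalJac φ.toMap j = _ := div_mul_cancel₀ _ hΔ
  have h2 : prX φ.toMap j * totalJac φ.toMap j = _ := div_mul_cancel₀ _ hΔ
  unfold kappa
  rw [sub_mul, sub_mul, mul_right_comm, mul_right_comm _ _ (totalJac _ _), h1, h2]
  unfold totalJac Dt Dx
  ring

theorem kappa_ne_zero (hz : j.base ∈ φ.toMap.source) (hΔ : totalJac φ.toMap j ≠ 0) :
    kappa φ.toMap j ≠ 0 := by
  intro h
  have := kappa_mul_totalJac hΔ
  rw [h, zero_mul] at this
  exact φ.jac_ne_zero hz this.symm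

theorem MapsEquation.pr1_mem (hm : MapsEquation φ θ θ') (hθ : θ ∈ waveClass) (hj : j ∈ θ.dom)
    (hΔ : totalJac φ.toMap j ≠ 0) : pr1 φ.toMap j ∈ θ'.dom := by
  have h1 : pr2 φ.toMap (setTop j (θ.f j * 0 + θ.g j) 0 0) ∈ θ'.equation := by
    rw [← hm.2]
    exact ⟨_, setTop_mem_equation hθ hj 0 0, prolongs_iff.2 ⟨by rwa [totalJac_setTop], rfl⟩⟩
  refine θ'.free_dom _ h1.1 _ fun i hi => ?_
  rw [pr2_agree i hi, pr1_setTop]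

/-- This is where surjectivity onto the target equation enters. Only the coordinates of order at
most one are recovered, which suffices for functions of `x` and `u_x`. -/
theorem MapsEquation.exists_preimage (hm : MapsEquation φ θ θ') (hθ' : θ' ∈ waveClass)
    {j' : Jet} (hj' : j' ∈ θ'.dom) :
    ∃ j ∈ θ.dom, totalJac φ.toMap j ≠ 0 ∧
      ∀ i : Fin 8, (i : ℕ) ∉ ({5, 6, 7} : Finset ℕ) → j' i = pr1 φ.toMap j i := by
  have h1 := setTop_mem_equation hθ' hj' 0 0
  rw [← hm.2] at h1
  obtain ⟨j, hj, hp⟩ := h1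
  obtain ⟨hΔ, e⟩ := prolongs_iff.1 hp
  refine ⟨j, hj.1, hΔ, fun i hi => ?_⟩
  rw [← pr2_agree i hi, ← e, setTop_agree _ _ _ _ i hi]

/-- The determining equations of the admissible transformations. -/
theorem MapsEquation.determining (hm : MapsEquation φ θ θ') (hθ : θ ∈ waveClass)
    (hθ' : θ' ∈ waveClass) (hj : j ∈ θ.dom) (hΔ : totalJac φ.toMap j ≠ 0) :
    Dt (comp φ.toMap 1) j * Dx (comp φ.toMap 1) j
      = θ'.f (pr1 φ.toMap j) * (Dt (comp φ.toMap 0) j * Dx (comp φ.toMap 0) j) ∧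
    Dx (comp φ.toMap 1) j ^ 2 * θ.f j + Dt (comp φ.toMap 1) j ^ 2
      = θ'.f (pr1 φ.toMap j)
        * (Dx (comp φ.toMap 0) j ^ 2 * θ.f j + Dt (comp φ.toMap 0) j ^ 2) ∧
    (Dx (comp φ.toMap 1) j ^ 2 - θ'.f (pr1 φ.toMap j) * Dx (comp φ.toMap 0) j ^ 2)
        * (kappa φ.toMap j * θ.g j + remTT φ.toMap (setTop j 0 0 0))
      + (Dt (comp φ.toMap 1) j ^ 2 - θ'.f (pr1 φ.toMap j) * Dt (comp φ.toMap 0) j ^ 2)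
        * remXX φ.toMap (setTop j 0 0 0)
      = totalJac φ.toMap j ^ 2 * θ'.g (pr1 φ.toMap j) := by
  have hmem := hm.pr1_mem hθ hj hΔ
  have hκ := kappa_ne_zero (hm.1 j hj) hΔ
  set a := Dt (comp φ.toMap 0) j
  set b := Dt (comp φ.toMap 1) j
  set c := Dx (comp φ.toMap 0) j
  set d := Dx (comp φ.toMap 1) j
  set L11 := remTT φ.toMap (setTop j 0 0 0)
  set L12 := remTX φ.toMap (setTop j 0 0 0)
  set L22 := remXX φ.toMap (setTop j 0 0 0)
  set κ := kappa φ.toMap j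
  set f' := θ'.f (pr1 φ.toMap j)
  set g' := θ'.g (pr1 φ.toMap j)
  -- On the equation `u_tx = s` and `u_xx = t` are arbitrary and `u_tt` is determined by them; the
  -- target equation, cleared of denominators, becomes an identity affine in `s` and `t`.
  have key : ∀ s t : ℝ,
      d ^ 2 * (L11 + κ * (θ.f j * t + θ.g j)) - 2 * (b * d) * (L12 + κ * s)
          + b ^ 2 * (L22 + κ * t)
        = f' * (c ^ 2 * (L11 + κ * (θ.f j * t + θ.g j)) - 2 * (a * c) * (L12 + κ * s)
          + a ^ 2 * (L22 + κ * t)) + g' * totalJac φ.toMap j ^ 2 := by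
    intro s t
    have h1 : pr2 φ.toMap (setTop j (θ.f j * t + θ.g j) s t) ∈ θ'.equation := by
      rw [← hm.2]
      exact ⟨_, setTop_mem_equation hθ hj s t, prolongs_iff.2 ⟨by rwa [totalJac_setTop], rfl⟩⟩
    have h2 := h1.2
    have hΔ' := pow_ne_zero 2 hΔ
    rw [pr2, (isXUx_f hθ').setTop_eq (by rwa [pr1_setTop]),
      (isXUx_g hθ').setTop_eq (by rwa [pr1_setTop]), pr1_setTop] at h2
    simp only [remTT_setTop (r := θ.f j * t + θ.g j), remTX_setTop (s := s),
      remXX_setTop (t := t), Dt_setTop, Dx_setTop, totalJac_setTop] at h2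
    change _ / _ = f' * (_ / _) + g' at h2
    rw [div_eq_iff hΔ', add_mul, mul_assoc f', div_mul_cancel₀ _ hΔ'] at h2
    exact h2
  -- The coefficient of `s`; the coefficient of `t` and the constant term give the other two
  -- relations.
  have h1 : b * d = f' * (a * c) := by
    refine mul_left_cancel₀ hκ ?_
    linear_combination (key 0 0 - key 1 0) / 2
  refine ⟨h1, ?_, ?_⟩
  · refine mul_left_cancel₀ hκ ?_
    linear_combination key 0 1 - key 0 0
  · linear_combination key 0 0 + 2 * L12 * h1

end Determining
-- Smoothness of the first prolongation
section Smoothness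

theorem _root_.ContDiffOn.comp_base {h : Base → ℝ} {Ω : Set Base} (hh : ContDiffOn ℝ ∞ h Ω) :
    ContDiffOn ℝ ∞ (fun j : Jet => h j.base) (Jet.base ⁻¹' Ω) :=
  hh.comp contDiff_base.contDiffOn fun _ hj => hj

theorem contDiffOn_Dt {F : Base → ℝ} {Ω : Set Base} (hΩ : IsOpen Ω) (hF : ContDiffOn ℝ ∞ F Ω) :
    ContDiffOn ℝ ∞ (Dt F) (Jet.base ⁻¹' Ω) :=
  (hF.pd hΩ 0).comp_base.add ((contDiff_apply ℝ ℝ 3).contDiffOn.mul (hF.pd hΩ 2).comp_base)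

theorem contDiffOn_Dx {F : Base → ℝ} {Ω : Set Base} (hΩ : IsOpen Ω) (hF : ContDiffOn ℝ ∞ F Ω) :
    ContDiffOn ℝ ∞ (Dx F) (Jet.base ⁻¹' Ω) :=
  (hF.pd hΩ 1).comp_base.add ((contDiff_apply ℝ ℝ 4).contDiffOn.mul (hF.pd hΩ 2).comp_base)

variable (φ : PointTransformation 3)

theorem contDiffOn_totalJac :
    ContDiffOn ℝ ∞ (totalJac φ.toMap) (Jet.base ⁻¹' φ.toMap.source) := by
  have hs := φ.toMap.open_source
  exact ((contDiffOn_Dt hs (φ.smooth_comp 0)).mul (contDiffOn_Dx hs (φ.smooth_comp 1))).sub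
    ((contDiffOn_Dt hs (φ.smooth_comp 1)).mul (contDiffOn_Dx hs (φ.smooth_comp 0)))

/-- The domain of the first prolongation. -/
def prDomain : Set Jet := {j | j.base ∈ φ.toMap.source ∧ totalJac φ.toMap j ≠ 0}

theorem isOpen_prDomain : IsOpen (prDomain φ) :=
  (contDiffOn_totalJac φ).continuousOn.isOpen_inter_preimage
    (φ.toMap.open_source.preimage continuous_base) isOpen_ne

theorem contDiffOn_pr1 : ContDiffOn ℝ ∞ (pr1 φ.toMap) (prDomain φ) := by
  have hs := φ.toMap.open_source
  have hsub : prDomain φ ⊆ Jet.base ⁻¹' φ.toMap.source := fun j hj => hj.1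
  have hc : ∀ k, ContDiffOn ℝ ∞ (fun j : Jet => comp φ.toMap k j.base) (prDomain φ) :=
    fun k => (φ.smooth_comp k).comp_base.mono hsub
  have ht : ∀ k, ContDiffOn ℝ ∞ (Dt (comp φ.toMap k)) (prDomain φ) :=
    fun k => (contDiffOn_Dt hs (φ.smooth_comp k)).mono hsub
  have hx : ∀ k, ContDiffOn ℝ ∞ (Dx (comp φ.toMap k)) (prDomain φ) :=
    fun k => (contDiffOn_Dx hs (φ.smooth_comp k)).mono hsub
  have hJ := (contDiffOn_totalJac φ).mono hsub
  rw [contDiffOn_pi]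
  intro k
  fin_cases k
  · exact hc 0
  · exact hc 1
  · exact hc 2
  · exact (((ht 2).mul (hx 1)).sub ((hx 2).mul (ht 1))).div hJ fun j hj => hj.2
  · exact (((hx 2).mul (ht 0)).sub ((ht 2).mul (hx 0))).div hJ fun j hj => hj.2
  all_goals exact contDiffOn_const

theorem differentiableAt_pr1 {j : Jet} (hj : j ∈ prDomain φ) :
    DifferentiableAt ℝ (pr1 φ.toMap) j :=
  ((contDiffOn_pr1 φ).contDiffAt ((isOpen_prDomain φ).mem_nhds hj)).differentiableAt (by simp)

end Smoothness

/-! ### Derivatives of total derivatives along `u_t` and `u_x` -/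

section FiberDerivatives

variable (F : Base → ℝ) (j : Jet)

theorem hasPd_three_Dt : HasPd 3 (Dt F) j (pd 2 F j.base) :=
  ((hasPd_base_fiber (pd 0 F) j (by simp)).add
    (hasPd_coord_self.mul (hasPd_base_fiber (pd 2 F) j (by simp)))).congr_deriv (by ring)

theorem hasPd_three_Dx : HasPd 3 (Dx F) j 0 :=
  ((hasPd_base_fiber (pd 1 F) j (by simp)).add
    ((hasPd_coord_of_ne (by decide)).mul
      (hasPd_base_fiber (pd 2 F) j (by simp)))).congr_deriv (by ring)

theorem hasPd_four_Dx : HasPd 4 (Dx F) j (pd 2 F j.base) :=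
  ((hasPd_base_fiber (pd 1 F) j (by simp)).add
    (hasPd_coord_self.mul (hasPd_base_fiber (pd 2 F) j (by simp)))).congr_deriv (by ring)

theorem hasPd_four_Dt : HasPd 4 (Dt F) j 0 :=
  ((hasPd_base_fiber (pd 0 F) j (by simp)).add
    ((hasPd_coord_of_ne (by decide)).mul
      (hasPd_base_fiber (pd 2 F) j (by simp)))).congr_deriv (by ring)

end FiberDerivatives

/-! ### Independence of `T` and `X` from `u`, and preservation of the subclass -/

section Fibered

variable {θ θ' : ArbitraryElements} {φ : PointTransformation 3} {j : Jet}

theorem isOpen_dom_inter_prDomain : IsOpen (θ.dom ∩ prDomain φ) :=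
  θ.isOpen_dom.inter (isOpen_prDomain φ)

theorem IsXUx.hasPd {F : Jet → ℝ} (hF : IsXUx θ.dom F) (hj : j ∈ θ.dom) (i : Fin 8) :
    HasPd i F j (pd i F j) := hF.smooth.hasPd θ.isOpen_dom hj i

theorem IsXUx.hasPd_three {F : Jet → ℝ} (hF : IsXUx θ.dom F) (hj : j ∈ θ.dom) :
    HasPd 3 F j 0 := (hF.hasPd hj 3).congr_deriv (hF.dep j hj).2.2.1

theorem IsXUx.hasPd_two {F : Jet → ℝ} (hF : IsXUx θ.dom F) (hj : j ∈ θ.dom) :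
    HasPd 2 F j 0 := (hF.hasPd hj 2).congr_deriv (hF.dep j hj).2.1

theorem IsXUx.hasPd_zero {F : Jet → ℝ} (hF : IsXUx θ.dom F) (hj : j ∈ θ.dom) :
    HasPd 0 F j 0 := (hF.hasPd hj 0).congr_deriv (hF.dep j hj).1

/-- Elimination of `f̃` from the first two determining equations; the total Jacobian factors out. -/
theorem MapsEquation.cross_relation (hm : MapsEquation φ θ θ') (hθ : θ ∈ waveClass)
    (hθ' : θ' ∈ waveClass) (hj : j ∈ θ.dom) (hΔ : totalJac φ.toMap j ≠ 0) :
    θ.f j * (Dx (comp φ.toMap 0) j * Dx (comp φ.toMap 1) j)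
      = Dt (comp φ.toMap 0) j * Dt (comp φ.toMap 1) j := by
  obtain ⟨h1, h2, -⟩ := hm.determining hθ hθ' hj hΔ
  refine mul_left_cancel₀ hΔ ?_
  unfold totalJac
  linear_combination (Dt (comp φ.toMap 0) j * Dx (comp φ.toMap 0) j) * h2
    - (Dx (comp φ.toMap 0) j ^ 2 * θ.f j + Dt (comp φ.toMap 0) j ^ 2) * h1

/-- As `f_{u_x} = 0`, the `u_t`- and `u_x`-derivatives of the cross relation are homogeneous linear
equations in `(T_u, X_u)`, and after cancelling `f` their determinant is the total Jacobian up to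
sign. -/
theorem MapsEquation.pd_two_eq_zero_of_totalJac (hm : MapsEquation φ θ θ') (hθ : θ ∈ waveClass)
    (hθ' : θ' ∈ waveClass) (hq : ∀ j ∈ θ.dom, pd 4 θ.f j = 0) (hj : j ∈ θ.dom)
    (hΔ : totalJac φ.toMap j ≠ 0) :
    pd 2 (comp φ.toMap 0) j.base = 0 ∧ pd 2 (comp φ.toMap 1) j.base = 0 := by
  have hO := isOpen_dom_inter_prDomain (θ := θ) (φ := φ)
  have hjO : j ∈ θ.dom ∩ prDomain φ := ⟨hj, hm.1 j hj, hΔ⟩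
  have hrel : ∀ j ∈ θ.dom ∩ prDomain φ, _ := fun j hj => hm.cross_relation hθ hθ' hj.1 hj.2.2
  have h3 := HasPd.eq_of_eqOn hO hjO
    (((isXUx_f hθ).hasPd_three hj).mul ((hasPd_three_Dx (comp φ.toMap 0) j).mul
      (hasPd_three_Dx (comp φ.toMap 1) j)))
    ((hasPd_three_Dt (comp φ.toMap 0) j).mul (hasPd_three_Dt (comp φ.toMap 1) j)) hrel
  have h4 := HasPd.eq_of_eqOn hO hjO
    ((((isXUx_f hθ).hasPd hj 4).congr_deriv (hq j hj)).mul ((hasPd_four_Dx (comp φ.toMap 0) j).mul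
      (hasPd_four_Dx (comp φ.toMap 1) j)))
    ((hasPd_four_Dt (comp φ.toMap 0) j).mul (hasPd_four_Dt (comp φ.toMap 1) j)) hrel
  have h4' : pd 2 (comp φ.toMap 0) j.base * Dx (comp φ.toMap 1) j
      + Dx (comp φ.toMap 0) j * pd 2 (comp φ.toMap 1) j.base = 0 :=
    mul_left_cancel₀ (hθ.2.2.1 j hj) (by linear_combination h4)
  constructor
  · refine mul_left_cancel₀ hΔ ?_
    unfold totalJac
    linear_combination Dt (comp φ.toMap 0) j * h4' + Dx (comp φ.toMap 0) j * h3
  · refine mul_left_cancel₀ hΔ ?_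
    unfold totalJac
    linear_combination (-Dx (comp φ.toMap 1) j) * h3 - Dt (comp φ.toMap 1) j * h4'

/-- Jets where the prolongation is undefined carry no information, but the claim concerns only the
base point. Over a fixed base point the total Jacobian is affine in `(u_t, u_x)`; if it vanished at
all jets of the domain there, its three coefficients would vanish, and these are the minors of the
`T` and `X` rows of the nonsingular Jacobian matrix. -/
theorem MapsEquation.pd_two_eq_zero (hm : MapsEquation φ θ θ') (hθ : θ ∈ waveClass)
    (hθ' : θ' ∈ waveClass) (hq : ∀ j ∈ θ.dom, pd 4 θ.f j = 0) (hj : j ∈ θ.dom) :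
    pd 2 (comp φ.toMap 0) j.base = 0 ∧ pd 2 (comp φ.toMap 1) j.base = 0 := by
  by_contra hne
  have hzero : ∀ k ∈ θ.dom, k.base = j.base → totalJac φ.toMap k = 0 := by
    intro k hk hkj
    by_contra hΔ
    exact hne (hkj ▸ hm.pd_two_eq_zero_of_totalJac hθ hθ' hq hk hΔ)
  have h0 := hzero j hj rfl
  obtain ⟨s, hs, hs'⟩ := exists_line_mem θ.isOpen_dom hj 3
  obtain ⟨t, ht, ht'⟩ := exists_line_mem θ.isOpen_dom hj 4
  have h1 := hzero _ hs' (base_line_fiber j s (by simp))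
  have h2 := hzero _ ht' (base_line_fiber j t (by simp))
  simp only [totalJac, Dt, Dx] at h0 h1 h2
  rw [base_line_fiber j s (by simp)] at h1
  rw [base_line_fiber j t (by simp)] at h2
  simp at h1 h2
  -- Moving in the `u_t` direction, respectively the `u_x` direction, isolates the linear
  -- coefficients of the total Jacobian.
  have m1 : pd 2 (comp φ.toMap 0) j.base * pd 1 (comp φ.toMap 1) j.base
      - pd 2 (comp φ.toMap 1) j.base * pd 1 (comp φ.toMap 0) j.base = 0 :=
    mul_left_cancel₀ hs (by linear_combination h1 - h0)
  have m2 : pd 0 (comp φ.toMap 0) j.base * pd 2 (comp φ.toMap 1) j.base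
      - pd 0 (comp φ.toMap 1) j.base * pd 2 (comp φ.toMap 0) j.base = 0 :=
    mul_left_cancel₀ ht (by linear_combination h2 - h0)
  refine φ.jac_ne_zero (hm.1 j hj) ?_
  linear_combination pd 2 (comp φ.toMap 2) j.base * (h0 - j 3 * m1 - j 4 * m2)
    - pd 1 (comp φ.toMap 2) j.base * m2 - pd 0 (comp φ.toMap 2) j.base * m1

theorem Dt_of_pd_two {F : Base → ℝ} (h : pd 2 F j.base = 0) : Dt F j = pd 0 F j.base := by
  rw [Dt, h, mul_zero, add_zero]

theorem Dx_of_pd_two {F : Base → ℝ} (h : pd 2 F j.base = 0) : Dx F j = pd 1 F j.base := by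
  rw [Dx, h, mul_zero, add_zero]

/-- With `T_u = X_u = 0` the Jacobian of `φ` is the total Jacobian times `U_u`, so both factors are
nonzero and the prolongation is defined at every jet over the point. -/
theorem mem_prDomain (hj : j.base ∈ φ.toMap.source) (hT : pd 2 (comp φ.toMap 0) j.base = 0)
    (hX : pd 2 (comp φ.toMap 1) j.base = 0) :
    j ∈ prDomain φ ∧ pd 2 (comp φ.toMap 2) j.base ≠ 0 := by
  have := φ.jac_ne_zero hj
  rw [hT, hX] at this
  have h2 : totalJac φ.toMap j * pd 2 (comp φ.toMap 2) j.base ≠ 0 := by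
    intro h
    rw [totalJac, Dt_of_pd_two hT, Dt_of_pd_two hX, Dx_of_pd_two hT, Dx_of_pd_two hX] at h
    exact this (by linear_combination h)
  exact ⟨⟨hj, left_ne_zero_of_mul h2⟩, right_ne_zero_of_mul h2⟩

theorem hasPd_three_totalJac (hT : pd 2 (comp φ.toMap 0) j.base = 0)
    (hX : pd 2 (comp φ.toMap 1) j.base = 0) : HasPd 3 (totalJac φ.toMap) j 0 :=
  (((hasPd_three_Dt (comp φ.toMap 0) j).mul (hasPd_three_Dx (comp φ.toMap 1) j)).sub
    ((hasPd_three_Dt (comp φ.toMap 1) j).mul (hasPd_three_Dx (comp φ.toMap 0) j))).congr_deriv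
    (by rw [hT, hX]; ring)

theorem hasPd_four_totalJac (hT : pd 2 (comp φ.toMap 0) j.base = 0)
    (hX : pd 2 (comp φ.toMap 1) j.base = 0) : HasPd 4 (totalJac φ.toMap) j 0 :=
  (((hasPd_four_Dt (comp φ.toMap 0) j).mul (hasPd_four_Dx (comp φ.toMap 1) j)).sub
    ((hasPd_four_Dt (comp φ.toMap 1) j).mul (hasPd_four_Dx (comp φ.toMap 0) j))).congr_deriv
    (by rw [hT, hX]; ring)

theorem hasPd_three_prX (hΔ : totalJac φ.toMap j ≠ 0) (hT : pd 2 (comp φ.toMap 0) j.base = 0)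
    (hX : pd 2 (comp φ.toMap 1) j.base = 0) : HasPd 3 (prX φ.toMap) j
      (-(pd 2 (comp φ.toMap 2) j.base * pd 1 (comp φ.toMap 0) j.base) / totalJac φ.toMap j) := by
  refine ((((hasPd_three_Dx (comp φ.toMap 2) j).mul (hasPd_three_Dt (comp φ.toMap 0) j)).sub
    ((hasPd_three_Dt (comp φ.toMap 2) j).mul (hasPd_three_Dx (comp φ.toMap 0) j))).div
    (hasPd_three_totalJac hT hX) hΔ).congr_deriv ?_
  rw [hT, Dx_of_pd_two hT]; field_simp; ring

theorem hasPd_four_prX (hΔ : totalJac φ.toMap j ≠ 0) (hT : pd 2 (comp φ.toMap 0) j.base = 0)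
    (hX : pd 2 (comp φ.toMap 1) j.base = 0) : HasPd 4 (prX φ.toMap) j
      (pd 2 (comp φ.toMap 2) j.base * pd 0 (comp φ.toMap 0) j.base / totalJac φ.toMap j) := by
  refine ((((hasPd_four_Dx (comp φ.toMap 2) j).mul (hasPd_four_Dt (comp φ.toMap 0) j)).sub
    ((hasPd_four_Dt (comp φ.toMap 2) j).mul (hasPd_four_Dx (comp φ.toMap 0) j))).div
    (hasPd_four_totalJac hT hX) hΔ).congr_deriv ?_
  rw [hT, Dt_of_pd_two hT]; field_simp; ring

theorem hasPd_three_prT (hΔ : totalJac φ.toMap j ≠ 0) (hT : pd 2 (comp φ.toMap 0) j.base = 0)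
    (hX : pd 2 (comp φ.toMap 1) j.base = 0) : HasPd 3 (prT φ.toMap) j
      (pd 2 (comp φ.toMap 2) j.base * pd 1 (comp φ.toMap 1) j.base / totalJac φ.toMap j) := by
  refine ((((hasPd_three_Dt (comp φ.toMap 2) j).mul (hasPd_three_Dx (comp φ.toMap 1) j)).sub
    ((hasPd_three_Dx (comp φ.toMap 2) j).mul (hasPd_three_Dt (comp φ.toMap 1) j))).div
    (hasPd_three_totalJac hT hX) hΔ).congr_deriv ?_
  rw [hX, Dx_of_pd_two hX]; field_simp; ring

theorem hasPd_four_prT (hΔ : totalJac φ.toMap j ≠ 0) (hT : pd 2 (comp φ.toMap 0) j.base = 0)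
    (hX : pd 2 (comp φ.toMap 1) j.base = 0) : HasPd 4 (prT φ.toMap) j
      (-(pd 2 (comp φ.toMap 2) j.base * pd 0 (comp φ.toMap 1) j.base) / totalJac φ.toMap j) := by
  refine ((((hasPd_four_Dt (comp φ.toMap 2) j).mul (hasPd_four_Dx (comp φ.toMap 1) j)).sub
    ((hasPd_four_Dx (comp φ.toMap 2) j).mul (hasPd_four_Dt (comp φ.toMap 1) j))).div
    (hasPd_four_totalJac hT hX) hΔ).congr_deriv ?_
  rw [hX, Dt_of_pd_two hX]; field_simp; ring

/-- The derivative of a function of `(x̃, ũ_x̃)` along the fibers of the jet space. -/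
theorem hasPd_comp_pr1_fiber {F : Jet → ℝ} (hF : IsXUx θ'.dom F) (hj : j ∈ prDomain φ)
    (hj' : pr1 φ.toMap j ∈ θ'.dom) {i : Fin 8} (hi : 3 ≤ (i : ℕ)) {W : ℝ}
    (hW : HasPd i (prX φ.toMap) j W) :
    HasPd i (fun j => F (pr1 φ.toMap j)) j (W * pd 4 F (pr1 φ.toMap j)) :=
  (hF.hasPd_comp θ'.isOpen_dom hj' (differentiableAt_pr1 φ hj)
    (hasPd_base_fiber (comp φ.toMap 1) j hi) hW).congr_deriv (by ring)

/-- In the first two determining equations only `f̃` can still vary with `u_t` or `u_x`. If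
`f̃_{ũ_x̃} ≠ 0`, then `ũ_x̃` must be stationary in both directions, so `U_u T_x = U_u T_t = 0`,
contradicting the nonzero total Jacobian. -/
theorem MapsEquation.pd_four_f_eq_zero (hm : MapsEquation φ θ θ') (hθ : θ ∈ waveClass)
    (hθ' : θ' ∈ waveClass) (hq : ∀ j ∈ θ.dom, pd 4 θ.f j = 0) (hj : j ∈ θ.dom) :
    pd 4 θ'.f (pr1 φ.toMap j) = 0 := by
  have hz : ∀ j ∈ θ.dom, _ := fun j hj => hm.pd_two_eq_zero hθ hθ' hq (j := j) hj
  have hpr : ∀ j ∈ θ.dom, j ∈ prDomain φ ∧ _ := fun j hj =>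
    mem_prDomain (hm.1 j hj) (hz j hj).1 (hz j hj).2
  obtain ⟨hT, hX⟩ := hz j hj
  obtain ⟨hjp, hU⟩ := hpr j hj
  have hΔ := hjp.2
  have hmem := hm.pr1_mem hθ hj hΔ
  have hf' := isXUx_f hθ'
  by_contra hne
  have key : ∀ {i : Fin 8} (_ : HasPd i θ.f j 0) (_ : HasPd i (Dt (comp φ.toMap 0)) j 0)
      (_ : HasPd i (Dt (comp φ.toMap 1)) j 0) (_ : HasPd i (Dx (comp φ.toMap 0)) j 0)
      (_ : HasPd i (Dx (comp φ.toMap 1)) j 0) (_ : 3 ≤ (i : ℕ)) {W : ℝ}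
      (_ : HasPd i (prX φ.toMap) j W), W = 0 := by
    intro i hf ha hb hc hd hi W hW
    have hc' := hasPd_comp_pr1_fiber hf' hjp hmem hi hW
    have e1 := HasPd.eq_of_eqOn θ.isOpen_dom hj (hb.mul hd) (hc'.mul (ha.mul hc))
      fun k hk => (hm.determining hθ hθ' hk (hpr k hk).1.2).1
    have e2 := HasPd.eq_of_eqOn θ.isOpen_dom hj ((hd.sq.mul hf).add hb.sq)
      (hc'.mul ((hc.sq.mul hf).add ha.sq))
      fun k hk => (hm.determining hθ hθ' hk (hpr k hk).1.2).2.1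
    by_contra hW0
    have hWp : W * pd 4 θ'.f (pr1 φ.toMap j) ≠ 0 := mul_ne_zero hW0 hne
    -- If `ũ_x̃` varied, both coefficients of `f̃` would vanish; as `f ≠ 0` this forces `D_tT = D_xT
    -- = 0`.
    have z1 : Dt (comp φ.toMap 0) j * Dx (comp φ.toMap 0) j = 0 :=
      mul_left_cancel₀ hWp (by linear_combination -e1)
    have z2 : Dx (comp φ.toMap 0) j ^ 2 * θ.f j + Dt (comp φ.toMap 0) j ^ 2 = 0 :=
      mul_left_cancel₀ hWp (by linear_combination -e2)
    refine hΔ ?_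
    rw [totalJac]
    rcases mul_eq_zero.1 z1 with h | h
    · have : Dx (comp φ.toMap 0) j = 0 := by
        simpa [h, hθ.2.2.1 j hj] using z2
      rw [h, this]; ring
    · have : Dt (comp φ.toMap 0) j = 0 := by simpa [h] using z2
      rw [h, this]; ring
  have h3 := key ((isXUx_f hθ).hasPd_three hj) ((hasPd_three_Dt _ j).congr_deriv hT)
    ((hasPd_three_Dt _ j).congr_deriv hX) (hasPd_three_Dx _ j) (hasPd_three_Dx _ j) (by simp)
    (hasPd_three_prX hΔ hT hX)
  have h4 := key (((isXUx_f hθ).hasPd hj 4).congr_deriv (hq j hj)) (hasPd_four_Dt _ j)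
    (hasPd_four_Dt _ j) ((hasPd_four_Dx _ j).congr_deriv hT) ((hasPd_four_Dx _ j).congr_deriv hX)
    (by simp) (hasPd_four_prX hΔ hT hX)
  simp only [div_eq_zero_iff, neg_eq_zero, mul_eq_zero, hU, hΔ, false_or, or_false] at h3 h4
  refine hΔ ?_
  rw [totalJac, Dt_of_pd_two hT, Dx_of_pd_two hT, h3, h4]
  ring

/-- Surjectivity transports the vanishing of `f̃_{ũ_x̃}` to the whole target domain, and then the
nondegeneracy condition of the class can only be met by `g̃`. -/
theorem mem_waveSubclass_of_admissible
    (h : (θ, θ', φ) ∈ admissibleTransformations waveClass) (hθ : θ ∈ waveSubclass) :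
    θ' ∈ waveSubclass := by
  obtain ⟨-, hθ', hm⟩ := h
  change θ' ∈ waveClass at hθ'
  change MapsEquation φ θ θ' at hm
  have hf : ∀ j' ∈ θ'.dom, pd 4 θ'.f j' = 0 := by
    intro j' hj'
    obtain ⟨j, hj, hΔ, e⟩ := hm.exists_preimage hθ' hj'
    rw [((isXUx_f hθ').pd_four θ'.isOpen_dom).eq_of_fiber θ'.isOpen_dom θ'.free_dom
      (hm.pr1_mem hθ.1 hj hΔ) e]
    exact hm.pd_four_f_eq_zero hθ.1 hθ' hθ.2.1 hj
  refine ⟨hθ', hf, fun V hV hVd hVn => ?_⟩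
  obtain ⟨j, hj, hne⟩ := hθ'.2.2.2 V hV hVd hVn
  refine ⟨j, hj, fun h0 => hne ?_⟩
  rw [hf j (hVd hj), h0]

end Fibered
-- Transformations between subclass equations: `T_t T_x = 0`
namespace PointTransformation

/-- The `t`-component of a point transformation. -/
abbrev T (φ : PointTransformation 3) : Base → ℝ := comp φ.toMap 0

/-- The `x`-component of a point transformation. -/
abbrev X (φ : PointTransformation 3) : Base → ℝ := comp φ.toMap 1

/-- The `u`-component of a point transformation. -/
abbrev U (φ : PointTransformation 3) : Base → ℝ := comp φ.toMap 2

end PointTransformation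

theorem pd_pd_eq_zero {Ω : Set Base} (hΩ : IsOpen Ω) {F : Base → ℝ} (hF : ContDiffOn ℝ ∞ F Ω)
    {i : Fin 3} (h : ∀ z ∈ Ω, pd i F z = 0) (k : Fin 3) {z : Base} (hz : z ∈ Ω) :
    pd k (pd i F) z = 0 ∧ pd i (pd k F) z = 0 := by
  have h1 := pd_eq_zero_of_eqOn hΩ hz h k
  exact ⟨h1, (pd_comm hF hΩ hz i k).trans h1⟩

/-- Admissible transformations between equations from the subclass. -/
structure SubclassMap (φ : PointTransformation 3) (θ θ' : ArbitraryElements) : Prop where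
  mem : θ ∈ waveSubclass
  mem' : θ' ∈ waveSubclass
  maps : MapsEquation φ θ θ'

namespace SubclassMap

variable {θ θ' : ArbitraryElements} {φ : PointTransformation 3} {j : Jet}

section

variable (H : SubclassMap φ θ θ')
include H

theorem isXUx_f : IsXUx θ.dom θ.f := WaveClass.isXUx_f H.mem.1
theorem isXUx_g : IsXUx θ.dom θ.g := WaveClass.isXUx_g H.mem.1
theorem isXUx_f' : IsXUx θ'.dom θ'.f := WaveClass.isXUx_f H.mem'.1
theorem isXUx_g' : IsXUx θ'.dom θ'.g := WaveClass.isXUx_g H.mem'.1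

theorem smooth_comp (k : Fin 3) : ContDiffOn ℝ ∞ (comp φ.toMap k) (Jet.base '' θ.dom) := by
  refine (φ.smooth_comp k).mono ?_
  rintro _ ⟨j, hj, rfl⟩
  exact H.maps.1 j hj

theorem T_u {z : Base} (hz : z ∈ Jet.base '' θ.dom) : pd 2 φ.T z = 0 := by
  obtain ⟨j, hj, rfl⟩ := hz
  exact (H.maps.pd_two_eq_zero H.mem.1 H.mem'.1 H.mem.2.1 hj).1

theorem X_u {z : Base} (hz : z ∈ Jet.base '' θ.dom) : pd 2 φ.X z = 0 := by
  obtain ⟨j, hj, rfl⟩ := hz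
  exact (H.maps.pd_two_eq_zero H.mem.1 H.mem'.1 H.mem.2.1 hj).2

theorem mem_prDomain (hj : j ∈ θ.dom) : j ∈ prDomain φ :=
  (WaveClass.mem_prDomain (H.maps.1 j hj) (H.T_u ⟨j, hj, rfl⟩) (H.X_u ⟨j, hj, rfl⟩)).1

theorem U_u_ne_zero (hj : j ∈ θ.dom) : pd 2 φ.U j.base ≠ 0 :=
  (WaveClass.mem_prDomain (H.maps.1 j hj) (H.T_u ⟨j, hj, rfl⟩) (H.X_u ⟨j, hj, rfl⟩)).2

theorem pr1_mem (hj : j ∈ θ.dom) : pr1 φ.toMap j ∈ θ'.dom :=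
  H.maps.pr1_mem H.mem.1 hj (H.mem_prDomain hj).2

theorem totalJac_eq (hj : j ∈ θ.dom) : totalJac φ.toMap j =
    pd 0 φ.T j.base * pd 1 φ.X j.base - pd 0 φ.X j.base * pd 1 φ.T j.base := by
  have hT := H.T_u ⟨j, hj, rfl⟩
  have hX := H.X_u ⟨j, hj, rfl⟩
  rw [totalJac, Dt_of_pd_two hT, Dt_of_pd_two hX, Dx_of_pd_two hT, Dx_of_pd_two hX]

theorem jac_ne_zero (hj : j ∈ θ.dom) :
    pd 0 φ.T j.base * pd 1 φ.X j.base - pd 0 φ.X j.base * pd 1 φ.T j.base ≠ 0 :=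
  H.totalJac_eq hj ▸ (H.mem_prDomain hj).2

theorem determining_one (hj : j ∈ θ.dom) : pd 0 φ.X j.base * pd 1 φ.X j.base
    = θ'.f (pr1 φ.toMap j) * (pd 0 φ.T j.base * pd 1 φ.T j.base) := by
  have h := (H.maps.determining H.mem.1 H.mem'.1 hj (H.mem_prDomain hj).2).1
  have hT := H.T_u ⟨j, hj, rfl⟩
  have hX := H.X_u ⟨j, hj, rfl⟩
  rwa [Dt_of_pd_two hT, Dt_of_pd_two hX, Dx_of_pd_two hT, Dx_of_pd_two hX] at h

theorem determining_two (hj : j ∈ θ.dom) :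
    pd 1 φ.X j.base ^ 2 * θ.f j + pd 0 φ.X j.base ^ 2
    = θ'.f (pr1 φ.toMap j) * (pd 1 φ.T j.base ^ 2 * θ.f j + pd 0 φ.T j.base ^ 2) := by
  have h := (H.maps.determining H.mem.1 H.mem'.1 hj (H.mem_prDomain hj).2).2.1
  have hT := H.T_u ⟨j, hj, rfl⟩
  have hX := H.X_u ⟨j, hj, rfl⟩
  rwa [Dt_of_pd_two hT, Dt_of_pd_two hX, Dx_of_pd_two hT, Dx_of_pd_two hX] at h

/-- The second determining equation replaces `X_t² - f̃ T_t²` by `-f (X_x² - f̃ T_x²)`, so that one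
common factor comes out on the left. -/
theorem determining_three (hj : j ∈ θ.dom) :
    (pd 1 φ.X j.base ^ 2 - θ'.f (pr1 φ.toMap j) * pd 1 φ.T j.base ^ 2) *
      (pd 2 φ.U j.base * θ.g j
        + (pd 0 (pd 0 φ.U) j.base + 2 * (j 3 * pd 0 (pd 2 φ.U) j.base)
          + j 3 ^ 2 * pd 2 (pd 2 φ.U) j.base
          - prT φ.toMap j * pd 0 (pd 0 φ.T) j.base - prX φ.toMap j * pd 0 (pd 0 φ.X) j.base)
        - θ.f j * (pd 1 (pd 1 φ.U) j.base + 2 * (j 4 * pd 1 (pd 2 φ.U) j.base)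
          + j 4 ^ 2 * pd 2 (pd 2 φ.U) j.base
          - prT φ.toMap j * pd 1 (pd 1 φ.T) j.base - prX φ.toMap j * pd 1 (pd 1 φ.X) j.base))
    = (pd 0 φ.T j.base * pd 1 φ.X j.base - pd 0 φ.X j.base * pd 1 φ.T j.base) ^ 2
      * θ'.g (pr1 φ.toMap j) := by
  have h := (H.maps.determining H.mem.1 H.mem'.1 hj (H.mem_prDomain hj).2).2.2
  have h2 := H.determining_two hj
  have hz : j.base ∈ Jet.base '' θ.dom := ⟨j, hj, rfl⟩
  have hT := H.T_u hz
  have hX := H.X_u hz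
  have hΩ := isOpen_image_base θ.isOpen_dom
  have hTi := fun k => (pd_pd_eq_zero hΩ (H.smooth_comp 0) (fun z hz => H.T_u hz) k hz).1
  have hXi := fun k => (pd_pd_eq_zero hΩ (H.smooth_comp 1) (fun z hz => H.X_u hz) k hz).1
  rw [H.totalJac_eq hj, Dt_of_pd_two hT, Dt_of_pd_two hX, Dx_of_pd_two hT, Dx_of_pd_two hX] at h
  simp only [remTT, remXX, Dtt, Dxx, prT_setTop, prX_setTop, base_setTop, kappa, hT, hX, hTi, hXi]
    at h
  simp only [setTop, Matrix.cons_val] at h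
  linear_combination h - (pd 1 (pd 1 φ.U) j.base + 2 * (j 4 * pd 1 (pd 2 φ.U) j.base)
          + j 4 ^ 2 * pd 2 (pd 2 φ.U) j.base
          - prT φ.toMap j * pd 1 (pd 1 φ.T) j.base - prX φ.toMap j * pd 1 (pd 1 φ.X) j.base) * h2

theorem hasPd_f_fiber (hj : j ∈ θ.dom) :
    HasPd 3 θ.f j 0 ∧ HasPd 4 θ.f j 0 ∧
    HasPd 3 (fun j => θ'.f (pr1 φ.toMap j)) j 0 ∧ HasPd 4 (fun j => θ'.f (pr1 φ.toMap j)) j 0 := by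
  have h0 := H.maps.pd_four_f_eq_zero H.mem.1 H.mem'.1 H.mem.2.1 hj
  have hp := H.mem_prDomain hj
  have hT := H.T_u ⟨j, hj, rfl⟩
  have hX := H.X_u ⟨j, hj, rfl⟩
  refine ⟨H.isXUx_f.hasPd_three hj, (H.isXUx_f.hasPd hj 4).congr_deriv (H.mem.2.1 j hj), ?_, ?_⟩
  · exact (hasPd_comp_pr1_fiber H.isXUx_f' hp (H.pr1_mem hj) (by simp)
      (hasPd_three_prX hp.2 hT hX)).congr_deriv (by rw [h0, mul_zero])
  · exact (hasPd_comp_pr1_fiber H.isXUx_f' hp (H.pr1_mem hj) (by simp)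
      (hasPd_four_prX hp.2 hT hX)).congr_deriv (by rw [h0, mul_zero])

/-- The points at which `g̃` is nonlinear with respect to `ũ_x̃` are dense. -/
theorem exists_pd_g'_ne_zero {W : Set Base} (hW : IsOpen W) (hj : j ∈ θ.dom) (hjW : j.base ∈ W) :
    ∃ k ∈ θ.dom, k.base ∈ W ∧ pd 4 (pd 4 θ'.g) (pr1 φ.toMap k) ≠ 0 := by
  have hpr : ∀ k, (pr1 φ.toMap k).base = φ.toMap k.base := by
    intro k; ext i; fin_cases i <;> rfl
  have hopen : IsOpen (θ'.dom ∩ Jet.base ⁻¹' (φ.toMap.target ∩ φ.toMap.symm ⁻¹' W)) :=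
    θ'.isOpen_dom.inter ((φ.toMap.isOpen_inter_preimage_symm hW).preimage continuous_base)
  obtain ⟨j', ⟨hj', hj't, hj'W⟩, hne⟩ := H.mem'.2.2 _ hopen Set.inter_subset_left
    ⟨pr1 φ.toMap j, H.pr1_mem hj, by
      rw [Set.mem_preimage, hpr]
      refine ⟨φ.toMap.map_source (H.maps.1 j hj), ?_⟩
      rwa [Set.mem_preimage, φ.toMap.left_inv (H.maps.1 j hj)]⟩
  obtain ⟨k, hk, -, hag⟩ := H.maps.exists_preimage H.mem'.1 hj'
  refine ⟨k, hk, ?_, ?_⟩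
  · have : j'.base = φ.toMap k.base := by
      rw [← hpr]
      ext i
      refine hag _ ?_
      fin_cases i <;> simp
    rwa [Set.mem_preimage, this, φ.toMap.left_inv (H.maps.1 k hk)] at hj'W
  · rwa [((H.isXUx_g'.pd_four θ'.isOpen_dom).pd_four θ'.isOpen_dom).eq_of_fiber θ'.isOpen_dom
      θ'.free_dom (H.pr1_mem hk) hag] at hne

theorem exists_pd_g_ne_zero {W : Set Base} (hW : IsOpen W) (hj : j ∈ θ.dom) (hjW : j.base ∈ W) :
    ∃ k ∈ θ.dom, k.base ∈ W ∧ pd 4 (pd 4 θ.g) k ≠ 0 := by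
  obtain ⟨k, hk, hne⟩ := H.mem.2.2 _ (θ.isOpen_dom.inter (hW.preimage continuous_base))
    Set.inter_subset_left ⟨j, hj, hjW⟩
  exact ⟨k, hk.1, hk.2, hne⟩

/-- The derivative of the third determining equation in `u_t` has a left side free of `u_x`. A
further derivative in `u_x` therefore sees only `g̃`, and `ũ_x̃` varies with `u_t` through `T_x` and
with `u_x` through `T_t`. -/
theorem mixed_relation (hj : j ∈ θ.dom) :
    pd 0 φ.T j.base * pd 1 φ.T j.base * pd 4 (pd 4 θ'.g) (pr1 φ.toMap j) = 0 := by
  have hfib : ∀ {k : Jet} (F : Base → ℝ), HasPd 3 (fun j : Jet => F j.base) k 0 :=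
    fun F => hasPd_base_fiber F _ (by simp)
  have hfib4 : ∀ {k : Jet} (F : Base → ℝ), HasPd 4 (fun j : Jet => F j.base) k 0 :=
    fun F => hasPd_base_fiber F _ (by simp)
  -- The `u_t`-derivative of the third determining equation, multiplied by the total Jacobian to
  -- clear the denominators of the derivatives of `ũ_t̃` and `ũ_x̃`.
  have h3 : ∀ j ∈ θ.dom,
      (pd 1 φ.X j.base ^ 2 - θ'.f (pr1 φ.toMap j) * pd 1 φ.T j.base ^ 2) *
      (2 * (pd 0 (pd 2 φ.U) j.base + j 3 * pd 2 (pd 2 φ.U) j.base) *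
        (pd 0 φ.T j.base * pd 1 φ.X j.base - pd 0 φ.X j.base * pd 1 φ.T j.base)
        - pd 2 φ.U j.base * (pd 1 φ.X j.base * pd 0 (pd 0 φ.T) j.base
            - pd 1 φ.T j.base * pd 0 (pd 0 φ.X) j.base)
        + θ.f j * (pd 2 φ.U j.base * (pd 1 φ.X j.base * pd 1 (pd 1 φ.T) j.base
            - pd 1 φ.T j.base * pd 1 (pd 1 φ.X) j.base)))
      = -((pd 0 φ.T j.base * pd 1 φ.X j.base - pd 0 φ.X j.base * pd 1 φ.T j.base) ^ 2
        * (pd 2 φ.U j.base * pd 1 φ.T j.base) * pd 4 θ'.g (pr1 φ.toMap j)) := by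
    intro j hj
    have hp := H.mem_prDomain hj
    have hT := H.T_u ⟨j, hj, rfl⟩
    have hX := H.X_u ⟨j, hj, rfl⟩
    obtain ⟨hf3, hf4, hf3', hf4'⟩ := H.hasPd_f_fiber hj
    obtain ⟨P₃, hP, hPe⟩ : ∃ D, HasPd 3 (prT φ.toMap) j D ∧ D * totalJac φ.toMap j = _ :=
      ⟨_, hasPd_three_prT hp.2 hT hX, div_mul_cancel₀ _ hp.2⟩
    obtain ⟨Q₃, hQ, hQe⟩ : ∃ D, HasPd 3 (prX φ.toMap) j D ∧ D * totalJac φ.toMap j = _ :=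
      ⟨_, hasPd_three_prX hp.2 hT hX, div_mul_cancel₀ _ hp.2⟩
    have hg := hasPd_comp_pr1_fiber H.isXUx_g' hp (H.pr1_mem hj) (by simp) hQ
    have e := HasPd.eq_of_eqOn θ.isOpen_dom hj
      (((hfib _).sq.sub (hf3'.mul (hfib _).sq)).mul
        (((((hfib _).mul (H.isXUx_g.hasPd_three hj)).add
          (((((hfib _).add ((hasPd_coord_self.mul (hfib _)).const_mul 2)).add
            (hasPd_coord_self.sq.mul (hfib _))).sub (hP.mul (hfib _))).sub (hQ.mul (hfib _)))).sub
          (hf3.mul (((((hfib _).add (((hasPd_coord_of_ne (by decide)).mul (hfib _)).const_mul 2)).add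
            ((hasPd_coord_of_ne (by decide)).sq.mul (hfib _))).sub (hP.mul (hfib _))).sub
              (hQ.mul (hfib _)))))))
      ((((hfib _).mul (hfib _)).sub ((hfib _).mul (hfib _))).sq.mul hg)
      (fun k hk => H.determining_three hk)
    rw [H.totalJac_eq hj] at hPe hQe
    linear_combination
      (pd 0 φ.T j.base * pd 1 φ.X j.base - pd 0 φ.X j.base * pd 1 φ.T j.base) * e
      + (pd 1 φ.X j.base ^ 2 - θ'.f (pr1 φ.toMap j) * pd 1 φ.T j.base ^ 2)
        * ((pd 0 (pd 0 φ.T) j.base - θ.f j * pd 1 (pd 1 φ.T) j.base) * hPe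
          + (pd 0 (pd 0 φ.X) j.base - θ.f j * pd 1 (pd 1 φ.X) j.base) * hQe)
      + (pd 0 φ.T j.base * pd 1 φ.X j.base - pd 0 φ.X j.base * pd 1 φ.T j.base) ^ 2
        * pd 4 θ'.g (pr1 φ.toMap j) * hQe
  have hp := H.mem_prDomain hj
  have hT := H.T_u ⟨j, hj, rfl⟩
  have hX := H.X_u ⟨j, hj, rfl⟩
  obtain ⟨-, hf4, -, hf4'⟩ := H.hasPd_f_fiber hj
  obtain ⟨Q₄, hQ, hQe⟩ : ∃ D, HasPd 4 (prX φ.toMap) j D ∧ D * totalJac φ.toMap j = _ :=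
    ⟨_, hasPd_four_prX hp.2 hT hX, div_mul_cancel₀ _ hp.2⟩
  have hg := hasPd_comp_pr1_fiber (H.isXUx_g'.pd_four θ'.isOpen_dom) hp (H.pr1_mem hj) (by simp) hQ
  have e := HasPd.eq_of_eqOn θ.isOpen_dom hj
    (((hfib4 _).sq.sub (hf4'.mul (hfib4 _).sq)).mul
      ((((((hfib4 _).add ((hasPd_coord_of_ne (by decide)).mul (hfib4 _))).const_mul 2).mul
        (((hfib4 _).mul (hfib4 _)).sub ((hfib4 _).mul (hfib4 _)))).sub
        ((hfib4 _).mul (((hfib4 _).mul (hfib4 _)).sub ((hfib4 _).mul (hfib4 _))))).add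
        (hf4.mul ((hfib4 _).mul (((hfib4 _).mul (hfib4 _)).sub ((hfib4 _).mul (hfib4 _)))))))
    (((((hfib4 _).mul (hfib4 _)).sub ((hfib4 _).mul (hfib4 _))).sq.mul
      ((hfib4 _).mul (hfib4 _))).mul hg).neg h3
  have hΔ := H.jac_ne_zero hj
  have hU := H.U_u_ne_zero hj
  rw [H.totalJac_eq hj] at hQe
  refine mul_left_cancel₀ (mul_ne_zero hΔ (pow_ne_zero 2 hU)) ?_
  linear_combination e
    - (pd 0 φ.T j.base * pd 1 φ.X j.base - pd 0 φ.X j.base * pd 1 φ.T j.base)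
      * (pd 2 φ.U j.base * pd 1 φ.T j.base) * pd 4 (pd 4 θ'.g) (pr1 φ.toMap j) * hQe

theorem T_t_mul_T_x {z : Base} (hz : z ∈ Jet.base '' θ.dom) : pd 0 φ.T z * pd 1 φ.T z = 0 := by
  have hΩ := isOpen_image_base θ.isOpen_dom
  by_contra hne
  have hW : IsOpen (Jet.base '' θ.dom ∩ (fun z => pd 0 φ.T z * pd 1 φ.T z) ⁻¹' {0}ᶜ) :=
    (((H.smooth_comp 0).pd hΩ 0).mul ((H.smooth_comp 0).pd hΩ 1)).continuousOn.isOpen_inter_preimage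
      hΩ isOpen_ne
  obtain ⟨j, hj, rfl⟩ := hz
  obtain ⟨k, hk, hkW, hg⟩ := H.exists_pd_g'_ne_zero hW hj ⟨⟨j, hj, rfl⟩, hne⟩
  exact mul_ne_zero hkW.2 hg (H.mixed_relation hk)

end
end SubclassMap
end WaveClass

/-! ### Excluding the interchange of `t` and `x` -/

namespace WaveClass
namespace SubclassMap

variable {θ θ' : ArbitraryElements} {φ : PointTransformation 3} {j : Jet}

section

variable (H : SubclassMap φ θ θ')
include H

/-- The transformations that interchange the roles of `t` and `x` are not admissible. -/
theorem T_t_ne_zero {z : Base} (hz : z ∈ Jet.base '' θ.dom) : pd 0 φ.T z ≠ 0 := by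
  have hΩ := isOpen_image_base θ.isOpen_dom
  obtain ⟨j₀, hj₀, rfl⟩ := hz
  intro ha₀
  -- Near the point `T_x ≠ 0`, so `T_t T_x = 0` turns the vanishing of `T_t` at one point into its
  -- vanishing on an open set, where derivatives may be taken.
  set W := Jet.base '' θ.dom ∩ (fun z => pd 1 φ.T z) ⁻¹' {0}ᶜ with hWdef
  have hW : IsOpen W :=
    ((H.smooth_comp 0).pd hΩ 1).continuousOn.isOpen_inter_preimage hΩ isOpen_ne
  have hj₀W : j₀.base ∈ W := by
    refine ⟨⟨j₀, hj₀, rfl⟩, fun hc => ?_⟩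
    have hc' : pd 1 φ.T j₀.base = 0 := hc
    exact H.jac_ne_zero hj₀ (by rw [ha₀, hc']; ring)
  have hWΩ : W ⊆ Jet.base '' θ.dom := Set.inter_subset_left
  have hsm : ∀ k, ContDiffOn ℝ ∞ (comp φ.toMap k) W := fun k => (H.smooth_comp k).mono hWΩ
  have hc : ∀ z ∈ W, pd 1 φ.T z ≠ 0 := fun z hz => hz.2
  have ha : ∀ z ∈ W, pd 0 φ.T z = 0 := fun z hz =>
    (mul_eq_zero.1 (H.T_t_mul_T_x (hWΩ hz))).resolve_right (hc z hz)
  have hb : ∀ z ∈ W, pd 0 φ.X z ≠ 0 := by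
    rintro z hz hb
    obtain ⟨j, hj, rfl⟩ := hWΩ hz
    exact H.jac_ne_zero hj (by rw [ha _ hz, hb]; ring)
  have hd : ∀ z ∈ W, pd 1 φ.X z = 0 := by
    rintro z hz
    obtain ⟨j, hj, rfl⟩ := hWΩ hz
    have := H.determining_one hj
    rw [ha _ hz, zero_mul, mul_zero] at this
    exact (mul_eq_zero.1 this).resolve_left (hb _ hz)
  have hT11 : ∀ z ∈ W, pd 0 (pd 0 φ.T) z = 0 := fun z hz =>
    (pd_pd_eq_zero hW (hsm 0) ha 0 hz).1
  have hX22 : ∀ z ∈ W, pd 1 (pd 1 φ.X) z = 0 := fun z hz =>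
    (pd_pd_eq_zero hW (hsm 1) hd 1 hz).1
  set A := θ.dom ∩ Jet.base ⁻¹' W with hAdef
  have hA : IsOpen A := θ.isOpen_dom.inter (hW.preimage continuous_base)
  have hfib3 : ∀ {k : Jet} (F : Base → ℝ), HasPd 3 (fun j : Jet => F j.base) k 0 :=
    fun F => hasPd_base_fiber F _ (by simp)
  have hfib4 : ∀ {k : Jet} (F : Base → ℝ), HasPd 4 (fun j : Jet => F j.base) k 0 :=
    fun F => hasPd_base_fiber F _ (by simp)
  -- Fiber derivatives of the first-order components of the prolongation.
  have hP : ∀ j ∈ A, HasPd 3 (prT φ.toMap) j 0 ∧ ∃ D, HasPd 4 (prT φ.toMap) j D ∧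
      D * pd 1 φ.T j.base = pd 2 φ.U j.base := by
    rintro j ⟨hj, hjW⟩
    have hp := H.mem_prDomain hj
    have hT := H.T_u ⟨j, hj, rfl⟩
    have hX := H.X_u ⟨j, hj, rfl⟩
    refine ⟨(hasPd_three_prT hp.2 hT hX).congr_deriv ?_, _, hasPd_four_prT hp.2 hT hX, ?_⟩
    · have : pd 1 (comp φ.toMap 1) j.base = 0 := hd _ hjW
      rw [this, mul_zero, zero_div]
    · rw [H.totalJac_eq hj, ha _ hjW, div_mul_eq_mul_div, div_eq_iff]
      · ring
      · simpa using ⟨hb _ hjW, hc _ hjW⟩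
  have hQ : ∀ j ∈ A, HasPd 4 (prX φ.toMap) j 0 ∧ ∃ D, HasPd 3 (prX φ.toMap) j D ∧
      D * pd 0 φ.X j.base = pd 2 φ.U j.base := by
    rintro j ⟨hj, hjW⟩
    have hp := H.mem_prDomain hj
    have hT := H.T_u ⟨j, hj, rfl⟩
    have hX := H.X_u ⟨j, hj, rfl⟩
    refine ⟨(hasPd_four_prX hp.2 hT hX).congr_deriv ?_, _, hasPd_three_prX hp.2 hT hX, ?_⟩
    · have : pd 0 (comp φ.toMap 0) j.base = 0 := ha _ hjW
      rw [this, mul_zero, zero_div]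
    · rw [H.totalJac_eq hj, ha _ hjW, div_mul_eq_mul_div, div_eq_iff]
      · ring
      · simpa using ⟨hb _ hjW, hc _ hjW⟩
  -- Here `T_t = X_x = 0`, so among the first-order derivatives `ũ_t̃` involves only `u_x` and
  -- `ũ_x̃` only `u_t`: derivatives in `u_x` see `g` but not `g̃`, and derivatives in `u_t` see `g̃`
  -- but not `g`.
  have heq : ∀ j ∈ A, -(θ'.f (pr1 φ.toMap j) *
      (pd 2 φ.U j.base * θ.g j
        + (pd 0 (pd 0 φ.U) j.base + 2 * (j 3 * pd 0 (pd 2 φ.U) j.base)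
          + j 3 ^ 2 * pd 2 (pd 2 φ.U) j.base - prX φ.toMap j * pd 0 (pd 0 φ.X) j.base)
        - θ.f j * (pd 1 (pd 1 φ.U) j.base + 2 * (j 4 * pd 1 (pd 2 φ.U) j.base)
          + j 4 ^ 2 * pd 2 (pd 2 φ.U) j.base - prT φ.toMap j * pd 1 (pd 1 φ.T) j.base)))
      = pd 0 φ.X j.base ^ 2 * θ'.g (pr1 φ.toMap j) := by
    rintro j ⟨hj, hjW⟩
    refine mul_left_cancel₀ (pow_ne_zero 2 (hc _ hjW)) ?_
    have := H.determining_three hj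
    rw [ha _ hjW, hd _ hjW, hT11 _ hjW, hX22 _ hjW] at this
    linear_combination this
  have h4 : ∀ j ∈ A, pd 1 φ.T j.base * (pd 2 φ.U j.base * pd 4 θ.g j)
      = θ.f j * (2 * (pd 1 φ.T j.base * (pd 1 (pd 2 φ.U) j.base + j 4 * pd 2 (pd 2 φ.U) j.base))
        - pd 2 φ.U j.base * pd 1 (pd 1 φ.T) j.base) := by
    rintro j hjA
    obtain ⟨-, P₄, hP4, hPe⟩ := hP j hjA
    obtain ⟨-, hf4, -, hf4'⟩ := H.hasPd_f_fiber hjA.1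
    have hg' := hasPd_comp_pr1_fiber H.isXUx_g' (H.mem_prDomain hjA.1) (H.pr1_mem hjA.1) (by simp)
      (hQ j hjA).1
    have e := HasPd.eq_of_eqOn hA hjA
      ((hf4'.mul ((((hfib4 _).mul (H.isXUx_g.hasPd hjA.1 4)).add
        ((((hfib4 _).add (((hasPd_coord_of_ne (by decide)).mul (hfib4 _)).const_mul 2)).add
          ((hasPd_coord_of_ne (by decide)).sq.mul (hfib4 _))).sub ((hQ j hjA).1.mul (hfib4 _)))).sub
        (hf4.mul ((((hfib4 _).add ((hasPd_coord_self.mul (hfib4 _)).const_mul 2)).add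
          (hasPd_coord_self.sq.mul (hfib4 _))).sub (hP4.mul (hfib4 _)))))).neg)
      ((hfib4 _).sq.mul hg') heq
    refine mul_left_cancel₀ (H.mem'.1.2.2.1 _ (H.pr1_mem hjA.1)) ?_
    linear_combination (-pd 1 φ.T j.base) * e
      - θ'.f (pr1 φ.toMap j) * θ.f j * pd 1 (pd 1 φ.T) j.base * hPe
  -- The second `u_x`-derivative; together with `h33` below it expresses both `g_qq` and `g̃_qq`
  -- through `U_uu`.
  have h44 : ∀ j ∈ A, pd 2 φ.U j.base * pd 4 (pd 4 θ.g) j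
      = 2 * (θ.f j * pd 2 (pd 2 φ.U) j.base) := by
    rintro j hjA
    obtain ⟨-, hf4, -, -⟩ := H.hasPd_f_fiber hjA.1
    have e := HasPd.eq_of_eqOn hA hjA
      ((hfib4 _).mul ((hfib4 _).mul ((H.isXUx_g.pd_four θ.isOpen_dom).hasPd hjA.1 4)))
      (hf4.mul ((((hfib4 _).mul ((hfib4 _).add (hasPd_coord_self.mul (hfib4 _)))).const_mul 2).sub
        ((hfib4 _).mul (hfib4 _)))) h4
    refine mul_left_cancel₀ (hc _ hjA.2) ?_
    linear_combination e
  have h3 : ∀ j ∈ A, -(θ'.f (pr1 φ.toMap j) *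
      (2 * (pd 0 φ.X j.base * (pd 0 (pd 2 φ.U) j.base + j 3 * pd 2 (pd 2 φ.U) j.base))
        - pd 2 φ.U j.base * pd 0 (pd 0 φ.X) j.base))
      = pd 0 φ.X j.base ^ 2 * (pd 2 φ.U j.base * pd 4 θ'.g (pr1 φ.toMap j)) := by
    rintro j hjA
    obtain ⟨-, Q₃, hQ3, hQe⟩ := hQ j hjA
    obtain ⟨hf3, -, hf3', -⟩ := H.hasPd_f_fiber hjA.1
    have hg' := hasPd_comp_pr1_fiber H.isXUx_g' (H.mem_prDomain hjA.1) (H.pr1_mem hjA.1) (by simp)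
      hQ3
    have e := HasPd.eq_of_eqOn hA hjA
      ((hf3'.mul ((((hfib3 _).mul (H.isXUx_g.hasPd_three hjA.1)).add
        ((((hfib3 _).add ((hasPd_coord_self.mul (hfib3 _)).const_mul 2)).add
          (hasPd_coord_self.sq.mul (hfib3 _))).sub (hQ3.mul (hfib3 _)))).sub
        (hf3.mul ((((hfib3 _).add (((hasPd_coord_of_ne (by decide)).mul (hfib3 _)).const_mul 2)).add
          ((hasPd_coord_of_ne (by decide)).sq.mul (hfib3 _))).sub
            ((hP j hjA).1.mul (hfib3 _)))))).neg)
      ((hfib3 _).sq.mul hg') heq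
    linear_combination pd 0 φ.X j.base * e
      - θ'.f (pr1 φ.toMap j) * pd 0 (pd 0 φ.X) j.base * hQe
      + pd 0 φ.X j.base ^ 2 * pd 4 θ'.g (pr1 φ.toMap j) * hQe
  have h33 : ∀ j ∈ A, -2 * (θ'.f (pr1 φ.toMap j) * pd 2 (pd 2 φ.U) j.base)
      = pd 2 φ.U j.base ^ 2 * pd 4 (pd 4 θ'.g) (pr1 φ.toMap j) := by
    rintro j hjA
    obtain ⟨-, Q₃, hQ3, hQe⟩ := hQ j hjA
    obtain ⟨-, -, hf3', -⟩ := H.hasPd_f_fiber hjA.1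
    have hg' := hasPd_comp_pr1_fiber (H.isXUx_g'.pd_four θ'.isOpen_dom) (H.mem_prDomain hjA.1)
      (H.pr1_mem hjA.1) (by simp) hQ3
    have e := HasPd.eq_of_eqOn hA hjA
      (hf3'.mul ((((hfib3 _).mul ((hfib3 _).add (hasPd_coord_self.mul (hfib3 _)))).const_mul 2).sub
        ((hfib3 _).mul (hfib3 _)))).neg
      ((hfib3 _).sq.mul ((hfib3 _).mul hg')) h3
    refine mul_left_cancel₀ (hb _ hjA.2) ?_
    linear_combination e + pd 0 φ.X j.base * pd 2 φ.U j.base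
      * pd 4 (pd 4 θ'.g) (pr1 φ.toMap j) * hQe
  -- A third `u_t`-derivative. It ensures that `g̃_qq` does not change through `ũ_x̃` when `u`
  -- varies.
  have h333 : ∀ j ∈ A, pd 4 (pd 4 (pd 4 θ'.g)) (pr1 φ.toMap j) = 0 := by
    rintro j hjA
    obtain ⟨-, Q₃, hQ3, hQe⟩ := hQ j hjA
    obtain ⟨-, -, hf3', -⟩ := H.hasPd_f_fiber hjA.1
    have hg' := hasPd_comp_pr1_fiber ((H.isXUx_g'.pd_four θ'.isOpen_dom).pd_four θ'.isOpen_dom)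
      (H.mem_prDomain hjA.1) (H.pr1_mem hjA.1) (by simp) hQ3
    have e := HasPd.eq_of_eqOn hA hjA ((hf3'.mul (hfib3 _)).const_mul (-2))
      ((hfib3 _).sq.mul hg') h33
    refine mul_left_cancel₀ (pow_ne_zero 3 (H.U_u_ne_zero hjA.1)) ?_
    linear_combination -pd 0 φ.X j.base * e - pd 2 φ.U j.base ^ 2
      * pd 4 (pd 4 (pd 4 θ'.g)) (pr1 φ.toMap j) * hQe
  obtain ⟨j, hj, hjW, hne⟩ := H.exists_pd_g_ne_zero hW hj₀ hj₀W
  have hjA : j ∈ A := ⟨hj, hjW⟩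
  have hsU := hsm 2
  have hp := H.mem_prDomain hj
  have hQd : HasPd 2 (prX φ.toMap) j (pd 2 (prX φ.toMap) j) :=
    hasPd_of_differentiableAt (differentiableAt_pi.1 (differentiableAt_pr1 φ hp) 4)
  have hXd : HasPd 2 (fun j : Jet => φ.X j.base) j 0 :=
    (((hsm 1).hasPd hW hjW 2).base_two).congr_deriv (H.X_u (hWΩ hjW))
  have hf' := H.isXUx_f'.hasPd_comp θ'.isOpen_dom (H.pr1_mem hj) (differentiableAt_pr1 φ hp) hXd hQd
  have hG := ((H.isXUx_g'.pd_four θ'.isOpen_dom).pd_four θ'.isOpen_dom).hasPd_comp θ'.isOpen_dom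
    (H.pr1_mem hj) (differentiableAt_pr1 φ hp) hXd hQd
  rw [H.maps.pd_four_f_eq_zero H.mem.1 H.mem'.1 H.mem.2.1 hj] at hf'
  rw [h333 j hjA] at hG
  have hU := ((hsU.pd hW 2).hasPd hW hjW 2).base_two
  have hUU := (((hsU.pd hW 2).pd hW 2).hasPd hW hjW 2).base_two
  have e1 := HasPd.eq_of_eqOn hA hjA
    (hU.mul (((H.isXUx_g.pd_four θ.isOpen_dom).pd_four θ.isOpen_dom).hasPd_two hj))
    (((H.isXUx_f.hasPd_two hj).mul hUU).const_mul 2) h44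
  have e2 := HasPd.eq_of_eqOn hA hjA ((hf'.mul hUU).const_mul (-2)) (hU.sq.mul hG) h33
  have r1 := h44 j hjA
  have r2 := h33 j hjA
  have hUne := H.U_u_ne_zero hj
  have hfne := H.mem.1.2.2.1 j hj
  have hfne' := H.mem'.1.2.2.1 _ (H.pr1_mem hj)
  -- The `u`-derivatives of `h44` and `h33` say that `U_uu / U_u`, respectively `U_uu / U_u ^ 2`,
  -- does not depend on `u`. The two results for `U_u U_uuu`, namely `U_uu ^ 2` and `2 U_uu ^ 2`,
  -- are compatible only if `U_uu = 0`.
  have s1 : pd 2 (pd 2 φ.U) j.base ^ 2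
      = pd 2 φ.U j.base * pd 2 (pd 2 (pd 2 φ.U)) j.base := by
    refine mul_left_cancel₀ (mul_ne_zero two_ne_zero hfne) ?_
    linear_combination pd 2 φ.U j.base * e1 - pd 2 (pd 2 φ.U) j.base * r1
  have s2 : pd 2 φ.U j.base * pd 2 (pd 2 (pd 2 φ.U)) j.base
      = 2 * pd 2 (pd 2 φ.U) j.base ^ 2 := by
    refine mul_left_cancel₀ (mul_ne_zero two_ne_zero hfne') ?_
    linear_combination -pd 2 φ.U j.base * e2 + 2 * pd 2 (pd 2 φ.U) j.base * r2
  have s3 : pd 2 (pd 2 φ.U) j.base = 0 := by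
    have : pd 2 (pd 2 φ.U) j.base ^ 2 = 0 := by linear_combination -s1 - s2
    simpa using this
  rw [s3, mul_zero, mul_zero] at r1
  exact mul_ne_zero hUne hne r1

end
end SubclassMap
-- The special form of `φ` and the transformation rule for `g`
/-- The determining equations of the equivalence transformations, whose general solution is locally
`t̃ = c₁ t + c₀`, `x̃ = X(x)`, `ũ = c₂ u + c₄ t² + c₃ t + ψ(x)`. -/
structure IsSpecialAt (φ : PointTransformation 3) (z : Base) : Prop where
  T_x : pd 1 φ.T z = 0
  T_u : pd 2 φ.T z = 0
  X_t : pd 0 φ.X z = 0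
  X_u : pd 2 φ.X z = 0
  T_tt : pd 0 (pd 0 φ.T) z = 0
  U_uu : pd 2 (pd 2 φ.U) z = 0
  U_tu : pd 0 (pd 2 φ.U) z = 0
  U_xu : pd 1 (pd 2 φ.U) z = 0
  U_tx : pd 0 (pd 1 φ.U) z = 0
  U_ttt : pd 0 (pd 0 (pd 0 φ.U)) z = 0

namespace SubclassMap

variable {θ θ' : ArbitraryElements} {φ : PointTransformation 3} {j : Jet}

section

variable (H : SubclassMap φ θ θ')
include H

theorem T_x {z : Base} (hz : z ∈ Jet.base '' θ.dom) : pd 1 φ.T z = 0 :=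
  (mul_eq_zero.1 (H.T_t_mul_T_x hz)).resolve_left (H.T_t_ne_zero hz)

theorem X_x_ne_zero {z : Base} (hz : z ∈ Jet.base '' θ.dom) : pd 1 φ.X z ≠ 0 := by
  obtain ⟨j, hj, rfl⟩ := hz
  intro h
  exact H.jac_ne_zero hj (by rw [h, H.T_x ⟨j, hj, rfl⟩]; ring)

theorem X_t {z : Base} (hz : z ∈ Jet.base '' θ.dom) : pd 0 φ.X z = 0 := by
  have hx := H.X_x_ne_zero hz
  obtain ⟨j, hj, rfl⟩ := hz
  have h := H.determining_one hj
  rw [H.T_x ⟨j, hj, rfl⟩, mul_zero, mul_zero] at h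
  exact (mul_eq_zero.1 h).resolve_right hx

theorem f_transform (hj : j ∈ θ.dom) :
    θ'.f (pr1 φ.toMap j) * pd 0 φ.T j.base ^ 2 = θ.f j * pd 1 φ.X j.base ^ 2 := by
  have h := H.determining_two hj
  rw [H.T_x ⟨j, hj, rfl⟩, H.X_t ⟨j, hj, rfl⟩] at h
  linear_combination -h

theorem prX_mul (hj : j ∈ θ.dom) : prX φ.toMap j = Dx φ.U j / pd 1 φ.X j.base := by
  have hz : j.base ∈ Jet.base '' θ.dom := ⟨j, hj, rfl⟩
  have ha := H.T_t_ne_zero hz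
  have hd := H.X_x_ne_zero hz
  rw [prX, H.totalJac_eq hj, Dt_of_pd_two (H.T_u hz), Dx_of_pd_two (H.T_u hz), H.T_x hz,
    div_eq_div_iff (by simpa using ⟨ha, hd⟩) hd]
  ring

theorem hasPd_f'_comp {i : Fin 8} {D : ℝ} (hj : j ∈ θ.dom)
    (hX : HasPd i (fun j : Jet => φ.X j.base) j 0) (hQ : HasPd i (prX φ.toMap) j D) :
    HasPd i (fun j => θ'.f (pr1 φ.toMap j)) j 0 :=
  (H.isXUx_f'.hasPd_comp θ'.isOpen_dom (H.pr1_mem hj) (differentiableAt_pr1 φ (H.mem_prDomain hj))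
    hX hQ).congr_deriv
    (by rw [H.maps.pd_four_f_eq_zero H.mem.1 H.mem'.1 H.mem.2.1 hj]; ring)

/-- With `T_x = X_t = 0`, each remaining condition is a derivative of the `f`- or `g`-relation in a
variable on which few terms still depend. Nonlinearity of `g̃` in `ũ_x̃` is what makes `ũ_x̃`
independent of `t` and `u`. -/
theorem isSpecialAt_and_g_transform :
    (∀ z ∈ Jet.base '' θ.dom, IsSpecialAt φ z) ∧
    ∀ j ∈ θ.dom, θ'.g (pr1 φ.toMap j) * pd 0 φ.T j.base ^ 2 =
      pd 2 φ.U j.base * θ.g j + pd 0 (pd 0 φ.U) j.base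
        - θ.f j * (pd 1 (pd 1 φ.U) j.base - prX φ.toMap j * pd 1 (pd 1 φ.X) j.base) := by
  set W := Jet.base '' θ.dom with hWdef
  have hW : IsOpen W := isOpen_image_base θ.isOpen_dom
  have hbase : ∀ j ∈ θ.dom, j.base ∈ W := fun j hj => ⟨j, hj, rfl⟩
  have hA := θ.isOpen_dom
  have hT := H.smooth_comp 0
  have hX := H.smooth_comp 1
  have hU := H.smooth_comp 2
  have ha : ∀ z ∈ W, pd 0 φ.T z ≠ 0 := fun z hz => H.T_t_ne_zero hz
  have hd : ∀ z ∈ W, pd 1 φ.X z ≠ 0 := fun z hz => H.X_x_ne_zero hz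
  have hfib3 : ∀ {k : Jet} (F : Base → ℝ), HasPd 3 (fun j : Jet => F j.base) k 0 :=
    fun F => hasPd_base_fiber F _ (by simp)
  have hfib4 : ∀ {k : Jet} (F : Base → ℝ), HasPd 4 (fun j : Jet => F j.base) k 0 :=
    fun F => hasPd_base_fiber F _ (by simp)
  have hd0 : ∀ z ∈ W, pd 0 (pd 1 φ.X) z = 0 := fun z hz =>
    (pd_pd_eq_zero hW hX (fun z hz => H.X_t hz) 1 hz).2
  have hd2 : ∀ z ∈ W, pd 2 (pd 1 φ.X) z = 0 := fun z hz =>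
    (pd_pd_eq_zero hW hX (fun z hz => H.X_u hz) 1 hz).2
  have ha2 : ∀ z ∈ W, pd 2 (pd 0 φ.T) z = 0 := fun z hz =>
    (pd_pd_eq_zero hW hT (fun z hz => H.T_u hz) 0 hz).2
  -- Derivatives of coefficients along `t` and `u`.
  have lift0 : ∀ {F : Base → ℝ} {D : ℝ} {j : Jet}, ContDiffOn ℝ ∞ F W → j ∈ θ.dom →
      pd 0 F j.base = D → HasPd 0 (fun j : Jet => F j.base) j D := fun hF hj h =>
    (hF.hasPd hW (hbase _ hj) 0).base_zero.congr_deriv h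
  have lift2 : ∀ {F : Base → ℝ} {D : ℝ} {j : Jet}, ContDiffOn ℝ ∞ F W → j ∈ θ.dom →
      pd 2 F j.base = D → HasPd 2 (fun j : Jet => F j.base) j D := fun hF hj h =>
    (hF.hasPd hW (hbase _ hj) 2).base_two.congr_deriv h
  have hQ0 : ∀ j ∈ θ.dom, HasPd 0 (prX φ.toMap) j
      ((pd 0 (pd 1 φ.U) j.base + j 4 * pd 0 (pd 2 φ.U) j.base) / pd 1 φ.X j.base) := by
    intro j hj
    have hdj := hd _ (hbase j hj)
    refine HasPd.congr_of_eqOn hA hj (HasPd.congr_deriv (((lift0 (hU.pd hW 1) hj rfl).add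
      ((hasPd_coord_of_ne (by decide)).mul (lift0 (hU.pd hW 2) hj rfl))).div
      (lift0 (hX.pd hW 1) hj (hd0 _ (hbase j hj))) hdj) ?_) fun k hk => H.prX_mul hk
    field_simp
    ring
  have hQ2 : ∀ j ∈ θ.dom, HasPd 2 (prX φ.toMap) j
      ((pd 2 (pd 1 φ.U) j.base + j 4 * pd 2 (pd 2 φ.U) j.base) / pd 1 φ.X j.base) := by
    intro j hj
    have hdj := hd _ (hbase j hj)
    refine HasPd.congr_of_eqOn hA hj (HasPd.congr_deriv (((lift2 (hU.pd hW 1) hj rfl).add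
      ((hasPd_coord_of_ne (by decide)).mul (lift2 (hU.pd hW 2) hj rfl))).div
      (lift2 (hX.pd hW 1) hj (hd2 _ (hbase j hj))) hdj) ?_) fun k hk => H.prX_mul hk
    field_simp
    ring
  have hQ3 : ∀ j ∈ θ.dom, HasPd 3 (prX φ.toMap) j 0 := fun j hj =>
    (hasPd_three_prX (H.mem_prDomain hj).2 (H.T_u (hbase j hj)) (H.X_u (hbase j hj))).congr_deriv
      (by have : pd 1 (comp φ.toMap 0) j.base = 0 := H.T_x (hbase j hj)
          rw [this, mul_zero, neg_zero, zero_div])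
  have hQ4 : ∀ j ∈ θ.dom, ∃ D, HasPd 4 (prX φ.toMap) j D ∧
      D * pd 1 φ.X j.base = pd 2 φ.U j.base := fun j hj => by
    refine ⟨_, hasPd_four_prX (H.mem_prDomain hj).2 (H.T_u (hbase j hj)) (H.X_u (hbase j hj)), ?_⟩
    have haj := ha _ (hbase j hj)
    have hdj := hd _ (hbase j hj)
    rw [H.totalJac_eq hj, H.T_x (hbase j hj), mul_zero, sub_zero, div_mul_eq_mul_div, div_eq_iff]
    · ring
    · exact mul_ne_zero haj hdj
  -- In `f̃ T_t² = f X_x²` only `T_t` can depend on `t`: `x̃` does not, and `f̃` ignores `ũ_x̃`.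
  have hT11 : ∀ z ∈ W, pd 0 (pd 0 φ.T) z = 0 := by
    rintro z ⟨j, hj, rfl⟩
    have e := HasPd.eq_of_eqOn hA hj
      ((H.hasPd_f'_comp hj (lift0 hX hj (H.X_t (hbase j hj))) (hQ0 j hj)).mul
        (lift0 (hT.pd hW 0) hj rfl).sq)
      ((H.isXUx_f.hasPd_zero hj).mul (lift0 (hX.pd hW 1) hj (hd0 _ (hbase j hj))).sq)
      fun k hk => H.f_transform hk
    have hf' := H.mem'.1.2.2.1 _ (H.pr1_mem hj)
    refine mul_left_cancel₀ (mul_ne_zero (mul_ne_zero two_ne_zero hf') (ha _ (hbase j hj))) ?_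
    linear_combination e
  have heq : ∀ j ∈ θ.dom, pd 2 φ.U j.base * θ.g j
        + (pd 0 (pd 0 φ.U) j.base + 2 * (j 3 * pd 0 (pd 2 φ.U) j.base)
          + j 3 ^ 2 * pd 2 (pd 2 φ.U) j.base)
        - θ.f j * (pd 1 (pd 1 φ.U) j.base + 2 * (j 4 * pd 1 (pd 2 φ.U) j.base)
          + j 4 ^ 2 * pd 2 (pd 2 φ.U) j.base - prX φ.toMap j * pd 1 (pd 1 φ.X) j.base)
      = pd 0 φ.T j.base ^ 2 * θ'.g (pr1 φ.toMap j) := by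
    intro j hj
    have hz := hbase j hj
    refine mul_left_cancel₀ (pow_ne_zero 2 (hd _ hz)) ?_
    have := H.determining_three hj
    rw [H.T_x hz, H.X_t hz, hT11 _ hz, (pd_pd_eq_zero hW hX (fun z hz => H.X_t hz) 0 hz).1,
      (pd_pd_eq_zero hW hT (fun z hz => H.T_x hz) 1 hz).1] at this
    linear_combination this
  -- Neither `g` nor `ũ_x̃`, hence nor `g̃`, involves `u_t`, so the explicit polynomial in `u_t`
  -- must have zero derivative.
  have h3 : ∀ j ∈ θ.dom, 2 * (pd 0 (pd 2 φ.U) j.base + j 3 * pd 2 (pd 2 φ.U) j.base) = 0 := by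
    intro j hj
    obtain ⟨hf3, -, -, -⟩ := H.hasPd_f_fiber hj
    have hg' := hasPd_comp_pr1_fiber H.isXUx_g' (H.mem_prDomain hj) (H.pr1_mem hj) (by simp)
      (hQ3 j hj)
    have e := HasPd.eq_of_eqOn hA hj
      ((((hfib3 _).mul (H.isXUx_g.hasPd_three hj)).add
        (((hfib3 _).add ((hasPd_coord_self.mul (hfib3 _)).const_mul 2)).add
          (hasPd_coord_self.sq.mul (hfib3 _)))).sub
        (hf3.mul ((((hfib3 _).add (((hasPd_coord_of_ne (by decide)).mul (hfib3 _)).const_mul 2)).add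
          ((hasPd_coord_of_ne (by decide)).sq.mul (hfib3 _))).sub ((hQ3 j hj).mul (hfib3 _)))))
      ((hfib3 _).sq.mul hg') heq
    linear_combination e
  have hU22 : ∀ z ∈ W, pd 2 (pd 2 φ.U) z = 0 := by
    rintro z ⟨j, hj, rfl⟩
    have e := HasPd.eq_of_eqOn hA hj
      (((hfib3 _).add (hasPd_coord_self.mul (hfib3 _))).const_mul 2) (hasPd_const 0) h3
    linear_combination e / 2
  have hU02 : ∀ z ∈ W, pd 0 (pd 2 φ.U) z = 0 := by
    rintro z ⟨j, hj, rfl⟩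
    linear_combination h3 j hj / 2 - j 3 * hU22 _ (hbase j hj)
  have heq' : ∀ j ∈ θ.dom, pd 2 φ.U j.base * θ.g j + pd 0 (pd 0 φ.U) j.base
        - θ.f j * (pd 1 (pd 1 φ.U) j.base + 2 * (j 4 * pd 1 (pd 2 φ.U) j.base)
          - prX φ.toMap j * pd 1 (pd 1 φ.X) j.base)
      = pd 0 φ.T j.base ^ 2 * θ'.g (pr1 φ.toMap j) := by
    intro j hj
    linear_combination heq j hj - (j 3 ^ 2 - θ.f j * j 4 ^ 2) * hU22 _ (hbase j hj)
      - 2 * j 3 * hU02 _ (hbase j hj)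
  -- The `u_x`-derivative, multiplied by `X_x` to clear the denominator of the derivative of `ũ_x̃`.
  have h4 : ∀ j ∈ θ.dom, pd 1 φ.X j.base * (pd 2 φ.U j.base * pd 4 θ.g j)
        - θ.f j * (2 * (pd 1 φ.X j.base * pd 1 (pd 2 φ.U) j.base)
          - pd 2 φ.U j.base * pd 1 (pd 1 φ.X) j.base)
      = pd 0 φ.T j.base ^ 2 * (pd 2 φ.U j.base * pd 4 θ'.g (pr1 φ.toMap j)) := by
    intro j hj
    obtain ⟨D, hQ, hQe⟩ := hQ4 j hj
    obtain ⟨-, hf4, -, -⟩ := H.hasPd_f_fiber hj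
    have hg' := hasPd_comp_pr1_fiber H.isXUx_g' (H.mem_prDomain hj) (H.pr1_mem hj) (by simp) hQ
    have e := HasPd.eq_of_eqOn hA hj
      ((((hfib4 _).mul (H.isXUx_g.hasPd hj 4)).add (hfib4 _)).sub
        (hf4.mul (((hfib4 _).add ((hasPd_coord_self.mul (hfib4 _)).const_mul 2)).sub
          (hQ.mul (hfib4 _)))))
      ((hfib4 _).sq.mul hg') heq'
    linear_combination pd 1 φ.X j.base * e
      + (pd 0 φ.T j.base ^ 2 * pd 4 θ'.g (pr1 φ.toMap j) - θ.f j * pd 1 (pd 1 φ.X) j.base) * hQe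
  have hg4 : ∀ j ∈ θ.dom, ∀ {i : Fin 8} {D : ℝ}, HasPd i (fun j : Jet => φ.X j.base) j 0 →
      HasPd i (prX φ.toMap) j D → HasPd i (fun j => pd 4 θ'.g (pr1 φ.toMap j)) j
        (D * pd 4 (pd 4 θ'.g) (pr1 φ.toMap j)) := fun j hj _ _ h1 h2 =>
    ((H.isXUx_g'.pd_four θ'.isOpen_dom).hasPd_comp θ'.isOpen_dom (H.pr1_mem hj)
      (differentiableAt_pr1 φ (H.mem_prDomain hj)) h1 h2).congr_deriv (by ring)
  -- A coefficient annihilated by `g̃_{ũ_x̃ ũ_x̃}` vanishes.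
  have hdense : ∀ F : Base → ℝ, ContDiffOn ℝ ∞ F W →
      (∀ j ∈ θ.dom, F j.base * pd 4 (pd 4 θ'.g) (pr1 φ.toMap j) = 0) → ∀ z ∈ W, F z = 0 := by
    rintro F hF h z ⟨j, hj, rfl⟩
    by_contra hne
    obtain ⟨k, hk, hkW, hg⟩ := H.exists_pd_g'_ne_zero
      (hF.continuousOn.isOpen_inter_preimage hW (isOpen_ne (x := (0 : ℝ)))) hj ⟨hbase j hj, hne⟩
    exact mul_ne_zero hkW.2 hg (h k hk)
  have hcommU := fun {z : Base} (hz : z ∈ W) i k => pd_comm hU hW hz i k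
  -- In the `u`-derivative of `h4` the left side drops out, and on the right only `g̃_q` varies, at
  -- the rate `U_xu / X_x` times `g̃_qq`. The `t`-derivative gives `U_tx` in the same way.
  have hU12 : ∀ z ∈ W, pd 1 (pd 2 φ.U) z = 0 := by
    refine hdense _ ((hU.pd hW 2).pd hW 1) fun j hj => ?_
    have hz := hbase j hj
    have hdj := hd _ hz
    have e := HasPd.eq_of_eqOn hA hj
      (((lift2 (hX.pd hW 1) hj (hd2 _ hz)).mul ((lift2 (hU.pd hW 2) hj (hU22 _ hz)).mul
        ((H.isXUx_g.pd_four hA).hasPd_two hj))).sub ((H.isXUx_f.hasPd_two hj).mul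
        ((((lift2 (hX.pd hW 1) hj (hd2 _ hz)).mul (lift2 ((hU.pd hW 2).pd hW 1) hj
          (pd_pd_eq_zero hW (hU.pd hW 2) hU22 1 hz).2)).const_mul 2).sub
          ((lift2 (hU.pd hW 2) hj (hU22 _ hz)).mul (lift2 ((hX.pd hW 1).pd hW 1) hj
            (pd_pd_eq_zero hW (hX.pd hW 1) hd2 1 hz).2)))))
      ((lift2 (hT.pd hW 0) hj (ha2 _ hz)).sq.mul ((lift2 (hU.pd hW 2) hj (hU22 _ hz)).mul
        (hg4 j hj (lift2 hX hj (H.X_u hz)) (hQ2 j hj)))) h4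
    rw [hU22 _ hz, hcommU hz 2 1, mul_zero, add_zero] at e
    have hne := mul_ne_zero (pow_ne_zero 2 (ha _ hz)) (H.U_u_ne_zero hj)
    have e' : pd 1 (pd 2 φ.U) j.base / pd 1 φ.X j.base * pd 4 (pd 4 θ'.g) (pr1 φ.toMap j) = 0 :=
      mul_left_cancel₀ hne (by linear_combination -e)
    rw [div_mul_eq_mul_div, div_eq_zero_iff] at e'
    exact e'.resolve_right hdj
  have hU01 : ∀ z ∈ W, pd 0 (pd 1 φ.U) z = 0 := by
    refine hdense _ ((hU.pd hW 1).pd hW 0) fun j hj => ?_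
    have hz := hbase j hj
    have hdj := hd _ hz
    have e := HasPd.eq_of_eqOn hA hj
      (((lift0 (hX.pd hW 1) hj (hd0 _ hz)).mul ((lift0 (hU.pd hW 2) hj (hU02 _ hz)).mul
        ((H.isXUx_g.pd_four hA).hasPd_zero hj))).sub ((H.isXUx_f.hasPd_zero hj).mul
        ((((lift0 (hX.pd hW 1) hj (hd0 _ hz)).mul (lift0 ((hU.pd hW 2).pd hW 1) hj
          (pd_pd_eq_zero hW (hU.pd hW 2) hU02 1 hz).2)).const_mul 2).sub
          ((lift0 (hU.pd hW 2) hj (hU02 _ hz)).mul (lift0 ((hX.pd hW 1).pd hW 1) hj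
            (pd_pd_eq_zero hW (hX.pd hW 1) hd0 1 hz).2)))))
      ((lift0 (hT.pd hW 0) hj (hT11 _ hz)).sq.mul ((lift0 (hU.pd hW 2) hj (hU02 _ hz)).mul
        (hg4 j hj (lift0 hX hj (H.X_t hz)) (hQ0 j hj)))) h4
    rw [hU02 _ hz, mul_zero, add_zero] at e
    have hne := mul_ne_zero (pow_ne_zero 2 (ha _ hz)) (H.U_u_ne_zero hj)
    have e' : pd 0 (pd 1 φ.U) j.base / pd 1 φ.X j.base * pd 4 (pd 4 θ'.g) (pr1 φ.toMap j) = 0 :=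
      mul_left_cancel₀ hne (by linear_combination -e)
    rw [div_mul_eq_mul_div, div_eq_zero_iff] at e'
    exact e'.resolve_right hdj
  -- After the previous conditions `U_tt` is the only term that can depend on `t`.
  have hU000 : ∀ z ∈ W, pd 0 (pd 0 (pd 0 φ.U)) z = 0 := by
    rintro z ⟨j, hj, rfl⟩
    have hz := hbase j hj
    have hQ := (hQ0 j hj).congr_deriv (E := 0) (by rw [hU01 _ hz, hU02 _ hz]; simp)
    have hg' := H.isXUx_g'.hasPd_comp θ'.isOpen_dom (H.pr1_mem hj)
      (differentiableAt_pr1 φ (H.mem_prDomain hj)) (lift0 hX hj (H.X_t hz)) hQ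
    have e := HasPd.eq_of_eqOn hA hj
      ((((lift0 (hU.pd hW 2) hj (hU02 _ hz)).mul (H.isXUx_g.hasPd_zero hj)).add
        (lift0 ((hU.pd hW 0).pd hW 0) hj rfl)).sub ((H.isXUx_f.hasPd_zero hj).mul
        (((lift0 ((hU.pd hW 1).pd hW 1) hj (pd_pd_eq_zero hW (hU.pd hW 1) hU01 1 hz).2).add
          (((hasPd_coord_of_ne (by decide)).mul (lift0 ((hU.pd hW 2).pd hW 1) hj
            (pd_pd_eq_zero hW (hU.pd hW 2) hU02 1 hz).2)).const_mul 2)).sub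
          (hQ.mul (lift0 ((hX.pd hW 1).pd hW 1) hj
            (pd_pd_eq_zero hW (hX.pd hW 1) hd0 1 hz).2)))))
      ((lift0 (hT.pd hW 0) hj (hT11 _ hz)).sq.mul hg') heq'
    linear_combination e
  refine ⟨fun z hz => ⟨H.T_x hz, H.T_u hz, H.X_t hz, H.X_u hz, hT11 z hz, hU22 z hz, hU02 z hz,
    hU12 z hz, hU01 z hz, hU000 z hz⟩, fun j hj => ?_⟩
  linear_combination -heq' j hj - 2 * θ.f j * j 4 * hU12 _ (hbase j hj)

end
end SubclassMap
-- General chain rule and algebra of functions of `x` and `u_x`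
section ChainRule

variable {n m : ℕ} {i : Fin n} {K : (Fin m → ℝ) → ℝ} {Ψ : (Fin n → ℝ) → (Fin m → ℝ)}
  {z : Fin n → ℝ} {V : Fin m → ℝ}

theorem hasPd_comp (hK : DifferentiableAt ℝ K (Ψ z)) (hΨ : ∀ l, HasPd i (fun z => Ψ z l) z (V l)) :
    HasPd i (fun z => K (Ψ z)) z (∑ l, V l * pd l K (Ψ z)) := by
  have hc : HasDerivAt (fun s : ℝ => Ψ (z + s • Pi.single i 1)) V 0 := hasDerivAt_pi.2 hΨ
  have hK' : HasFDerivAt K (fderiv ℝ K (Ψ z)) (Ψ (z + (0 : ℝ) • Pi.single i 1)) := by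
    simpa using hK.hasFDerivAt
  have := hK'.comp_hasDerivAt (0 : ℝ) hc
  rwa [fderiv_eq_sum] at this

end ChainRule

section IsXUxAlgebra

variable {A : Set Jet} {F G : Jet → ℝ} {j : Jet}

theorem IsXUx.hasPd_eq_zero (hA : IsOpen A) (hF : IsXUx A F) (hj : j ∈ A) {i : Fin 8}
    (h1 : i ≠ 1) (h4 : i ≠ 4) : HasPd i F j 0 := by
  refine (hF.smooth.hasPd hA hj i).congr_deriv ?_
  have := hF.dep j hj
  fin_cases i <;> simp_all

theorem isXUx_of_hasPd (hA : IsOpen A) (hF : ContDiffOn ℝ ∞ F A)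
    (h : ∀ j ∈ A, ∀ i : Fin 8, i ≠ 1 → i ≠ 4 → HasPd i F j 0) : IsXUx A F := by
  refine ⟨hF, fun j hj => ?_⟩
  have key : ∀ i : Fin 8, i ≠ 1 → i ≠ 4 → pd i F j = 0 := fun i h1 h4 =>
    (h j hj i h1 h4).pd_eq ((hF.contDiffAt (hA.mem_nhds hj)).differentiableAt (by simp))
  refine ⟨key 0 ?_ ?_, key 2 ?_ ?_, key 3 ?_ ?_, key 5 ?_ ?_, key 6 ?_ ?_, key 7 ?_ ?_⟩ <;> decide

theorem IsXUx.mono {B : Set Jet} (hF : IsXUx A F) (h : B ⊆ A) : IsXUx B F :=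
  ⟨hF.smooth.mono h, fun j hj => hF.dep j (h hj)⟩

theorem isXUx_coord (hA : IsOpen A) : IsXUx A (fun j => j 4) :=
  isXUx_of_hasPd hA (contDiff_apply ℝ ℝ 4).contDiffOn
    fun _ _ _ _ h4 => hasPd_coord_of_ne (Ne.symm h4)

theorem IsXUx.add (hA : IsOpen A) (hF : IsXUx A F) (hG : IsXUx A G) :
    IsXUx A (fun j => F j + G j) :=
  isXUx_of_hasPd hA (hF.smooth.add hG.smooth) fun _ hj _ h1 h4 =>
    ((hF.hasPd_eq_zero hA hj h1 h4).add (hG.hasPd_eq_zero hA hj h1 h4)).congr_deriv (by ring)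

theorem IsXUx.sub (hA : IsOpen A) (hF : IsXUx A F) (hG : IsXUx A G) :
    IsXUx A (fun j => F j - G j) :=
  isXUx_of_hasPd hA (hF.smooth.sub hG.smooth) fun _ hj _ h1 h4 =>
    ((hF.hasPd_eq_zero hA hj h1 h4).sub (hG.hasPd_eq_zero hA hj h1 h4)).congr_deriv (by ring)

theorem IsXUx.mul (hA : IsOpen A) (hF : IsXUx A F) (hG : IsXUx A G) :
    IsXUx A (fun j => F j * G j) :=
  isXUx_of_hasPd hA (hF.smooth.mul hG.smooth) fun _ hj _ h1 h4 =>
    ((hF.hasPd_eq_zero hA hj h1 h4).mul (hG.hasPd_eq_zero hA hj h1 h4)).congr_deriv (by ring)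

theorem IsXUx.sq (hA : IsOpen A) (hF : IsXUx A F) : IsXUx A (fun j => F j ^ 2) := by
  simpa only [pow_two] using hF.mul hA hF

theorem IsXUx.div (hA : IsOpen A) (hF : IsXUx A F) (hG : IsXUx A G) (h : ∀ j ∈ A, G j ≠ 0) :
    IsXUx A (fun j => F j / G j) :=
  isXUx_of_hasPd hA (hF.smooth.div hG.smooth h) fun j hj _ h1 h4 =>
    ((hF.hasPd_eq_zero hA hj h1 h4).div (hG.hasPd_eq_zero hA hj h1 h4) (h j hj)).congr_deriv
      (by simp)

end IsXUxAlgebra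

/-! ### Prolongation of special transformations and its inverse -/

section SpecialProlongation

/-- The second prolongation of a transformation satisfying `IsSpecialAt`. -/
noncomputable def specialPr (φ : PointTransformation 3) (j : Jet) : Jet :=
  ![φ.T j.base, φ.X j.base, φ.U j.base,
    (pd 0 φ.U j.base + j 3 * pd 2 φ.U j.base) / pd 0 φ.T j.base,
    (pd 1 φ.U j.base + j 4 * pd 2 φ.U j.base) / pd 1 φ.X j.base,
    (pd 0 (pd 0 φ.U) j.base + j 5 * pd 2 φ.U j.base) / pd 0 φ.T j.base ^ 2,
    j 6 * pd 2 φ.U j.base / (pd 0 φ.T j.base * pd 1 φ.X j.base),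
    (pd 1 (pd 1 φ.U) j.base + j 7 * pd 2 φ.U j.base
      - (pd 1 φ.U j.base + j 4 * pd 2 φ.U j.base) / pd 1 φ.X j.base * pd 1 (pd 1 φ.X) j.base)
      / pd 1 φ.X j.base ^ 2]

/-- The preimage in the space of variables of the base point of `j`. -/
noncomputable def preBase (φ : PointTransformation 3) (j : Jet) : Base := φ.toMap.symm j.base

/-- The inverse of `specialPr φ`. -/
noncomputable def specialPrInv (φ : PointTransformation 3) (j : Jet) : Jet :=
  ![preBase φ j 0, preBase φ j 1, preBase φ j 2,
    (pd 0 φ.T (preBase φ j) * j 3 - pd 0 φ.U (preBase φ j)) / pd 2 φ.U (preBase φ j),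
    (pd 1 φ.X (preBase φ j) * j 4 - pd 1 φ.U (preBase φ j)) / pd 2 φ.U (preBase φ j),
    (pd 0 φ.T (preBase φ j) ^ 2 * j 5 - pd 0 (pd 0 φ.U) (preBase φ j)) / pd 2 φ.U (preBase φ j),
    pd 0 φ.T (preBase φ j) * pd 1 φ.X (preBase φ j) * j 6 / pd 2 φ.U (preBase φ j),
    (pd 1 φ.X (preBase φ j) ^ 2 * j 7 + j 4 * pd 1 (pd 1 φ.X) (preBase φ j)
      - pd 1 (pd 1 φ.U) (preBase φ j)) / pd 2 φ.U (preBase φ j)]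

variable {φ : PointTransformation 3} {j : Jet}

theorem base_specialPr : (specialPr φ j).base = φ.toMap j.base := by
  ext k; fin_cases k <;> rfl

theorem base_specialPrInv : (specialPrInv φ j).base = preBase φ j := by
  ext k; fin_cases k <;> rfl

theorem preBase_specialPr (hj : j.base ∈ φ.toMap.source) : preBase φ (specialPr φ j) = j.base := by
  rw [preBase, base_specialPr, φ.toMap.left_inv hj]

theorem preBase_mem (hj : j.base ∈ φ.toMap.target) : preBase φ j ∈ φ.toMap.source :=
  φ.toMap.map_target hj

variable (hφ : ∀ z ∈ φ.toMap.source, IsSpecialAt φ z)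
include hφ

theorem special_ne_zero {z : Base} (hz : z ∈ φ.toMap.source) :
    pd 0 φ.T z ≠ 0 ∧ pd 1 φ.X z ≠ 0 ∧ pd 2 φ.U z ≠ 0 := by
  have h := φ.jac_ne_zero hz
  have hs := hφ z hz
  refine ⟨?_, ?_, ?_⟩ <;> intro h0 <;> refine h ?_ <;>
    rw [hs.T_x, hs.T_u, hs.X_t, hs.X_u, h0] <;> ring

theorem specialPrInv_specialPr (hj : j.base ∈ φ.toMap.source) :
    specialPrInv φ (specialPr φ j) = j := by
  obtain ⟨hT, hX, hU⟩ := special_ne_zero hφ hj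
  ext k
  fin_cases k <;> simp only [specialPrInv, preBase_specialPr hj] <;>
    simp only [specialPr, Fin.reduceFinMk, Matrix.cons_val]
  · rfl
  · rfl
  · rfl
  all_goals field_simp
  all_goals ring

theorem specialPr_specialPrInv (hj : j.base ∈ φ.toMap.target) :
    specialPr φ (specialPrInv φ j) = j := by
  have hz := preBase_mem hj
  obtain ⟨hT, hX, hU⟩ := special_ne_zero hφ hz
  have e : φ.toMap (preBase φ j) = j.base := φ.toMap.right_inv hj
  ext k
  fin_cases k <;> simp only [specialPr, base_specialPrInv]
  · exact congrFun e 0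
  · exact congrFun e 1
  · exact congrFun e 2
  all_goals simp only [specialPrInv, Fin.reduceFinMk, Matrix.cons_val]
  all_goals field_simp
  all_goals ring

theorem prolongs_iff_specialPr (hj : j.base ∈ φ.toMap.source) {j' : Jet} :
    Prolongs φ.toMap j j' ↔ j' = specialPr φ j := by
  obtain ⟨hT, hX, hU⟩ := special_ne_zero hφ hj
  have hs := hφ _ hj
  have ho := φ.toMap.open_source
  have hTu := fun k => (pd_pd_eq_zero ho (φ.smooth_comp 0) (fun z hz => (hφ z hz).T_u) k hj).1
  have hTx := fun k => (pd_pd_eq_zero ho (φ.smooth_comp 0) (fun z hz => (hφ z hz).T_x) k hj).1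
  have hXu := fun k => (pd_pd_eq_zero ho (φ.smooth_comp 1) (fun z hz => (hφ z hz).X_u) k hj).1
  have hXt := fun k => (pd_pd_eq_zero ho (φ.smooth_comp 1) (fun z hz => (hφ z hz).X_t) k hj)
  have hJ : totalJac φ.toMap j = pd 0 φ.T j.base * pd 1 φ.X j.base := by
    rw [totalJac, Dt_of_pd_two hs.T_u, Dt_of_pd_two hs.X_u, Dx_of_pd_two hs.T_u,
      Dx_of_pd_two hs.X_u]
    linear_combination -pd 1 φ.T j.base * hs.X_t
  have hP : prT φ.toMap j = (pd 0 φ.U j.base + j 3 * pd 2 φ.U j.base) / pd 0 φ.T j.base := by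
    rw [prT, hJ, Dt_of_pd_two hs.X_u, Dx_of_pd_two hs.X_u, hs.X_t, Dt,
      div_eq_div_iff (mul_ne_zero hT hX) hT]
    ring
  have hQ : prX φ.toMap j = (pd 1 φ.U j.base + j 4 * pd 2 φ.U j.base) / pd 1 φ.X j.base := by
    rw [prX, hJ, Dt_of_pd_two hs.T_u, Dx_of_pd_two hs.T_u, hs.T_x, Dx,
      div_eq_div_iff (mul_ne_zero hT hX) hX]
    ring
  have h11 : remTT φ.toMap j = pd 0 (pd 0 φ.U) j.base + j 5 * pd 2 φ.U j.base := by
    simp only [remTT, Dtt, hs.T_u, hs.X_u, hs.T_tt, hs.U_uu, hs.U_tu, hTu, hXu, hXt]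
    ring
  have h12 : remTX φ.toMap j = j 6 * pd 2 φ.U j.base := by
    simp only [remTX, Dtx, hs.T_u, hs.X_u, hs.U_uu, hs.U_tu, hs.U_xu, hs.U_tx, hTu, hXu, hTx, hXt]
    ring
  have h22 : remXX φ.toMap j = pd 1 (pd 1 φ.U) j.base + j 7 * pd 2 φ.U j.base
      - (pd 1 φ.U j.base + j 4 * pd 2 φ.U j.base) / pd 1 φ.X j.base
        * pd 1 (pd 1 φ.X) j.base := by
    simp only [remXX, Dxx, hs.T_u, hs.X_u, hs.U_uu, hs.U_xu, hTu, hXu, hTx, hQ]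
    ring
  have e : pr2 φ.toMap j = specialPr φ j := by
    simp only [pr2, specialPr, h11, h12, h22, hJ, Dt_of_pd_two hs.T_u, Dt_of_pd_two hs.X_u,
      Dx_of_pd_two hs.T_u, Dx_of_pd_two hs.X_u, hs.T_x, hs.X_t]
    unfold setTop pr1
    rw [hP, hQ]
    clear hP hQ hJ h11 h12 h22
    ext k
    fin_cases k <;> simp only [Fin.reduceFinMk, Matrix.cons_val]
    all_goals field_simp
    all_goals ring
  rw [prolongs_iff, hJ, e]
  exact and_iff_right (mul_ne_zero hT hX)

theorem contDiffOn_specialPr :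
    ContDiffOn ℝ ∞ (specialPr φ) (Jet.base ⁻¹' φ.toMap.source) := by
  have ho := φ.toMap.open_source
  have hs := φ.smooth_comp
  have hne := fun (j : Jet) (hj : j ∈ Jet.base ⁻¹' φ.toMap.source) => special_ne_zero hφ hj
  have hc := fun i : Fin 8 => (contDiff_apply (n := ∞) ℝ ℝ i).contDiffOn
    (s := Jet.base ⁻¹' φ.toMap.source)
  have c := fun k => (hs k).comp_base
  have c1 := fun i k => ((hs k).pd ho i).comp_base
  have c2 := fun l i k => (((hs k).pd ho i).pd ho l).comp_base
  rw [contDiffOn_pi]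
  intro k
  fin_cases k
  · exact c 0
  · exact c 1
  · exact c 2
  · exact ((c1 0 2).add ((hc 3).mul (c1 2 2))).div (c1 0 0) fun j hj => (hne j hj).1
  · exact ((c1 1 2).add ((hc 4).mul (c1 2 2))).div (c1 1 1) fun j hj => (hne j hj).2.1
  · exact ((c2 0 0 2).add ((hc 5).mul (c1 2 2))).div ((c1 0 0).pow 2)
      fun j hj => pow_ne_zero 2 (hne j hj).1
  · exact ((hc 6).mul (c1 2 2)).div ((c1 0 0).mul (c1 1 1))
      fun j hj => mul_ne_zero (hne j hj).1 (hne j hj).2.1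
  · exact (((c2 1 1 2).add ((hc 7).mul (c1 2 2))).sub ((((c1 1 2).add ((hc 4).mul (c1 2 2))).div
      (c1 1 1) fun j hj => (hne j hj).2.1).mul (c2 1 1 1))).div ((c1 1 1).pow 2)
      fun j hj => pow_ne_zero 2 (hne j hj).2.1

omit hφ in
theorem contDiffOn_comp_preBase {h : Base → ℝ} (hh : ContDiffOn ℝ ∞ h φ.toMap.source) :
    ContDiffOn ℝ ∞ (fun j => h (preBase φ j)) (Jet.base ⁻¹' φ.toMap.target) :=
  (hh.comp φ.smooth_symm fun _ hz => φ.toMap.map_target hz).comp_base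

theorem contDiffOn_specialPrInv :
    ContDiffOn ℝ ∞ (specialPrInv φ) (Jet.base ⁻¹' φ.toMap.target) := by
  have ho := φ.toMap.open_source
  have hs := φ.smooth_comp
  have hne := fun (j : Jet) (hj : j ∈ Jet.base ⁻¹' φ.toMap.target) =>
    special_ne_zero hφ (preBase_mem hj)
  have hc := fun i : Fin 8 => (contDiff_apply (n := ∞) ℝ ℝ i).contDiffOn
    (s := Jet.base ⁻¹' φ.toMap.target)
  have c := fun k : Fin 3 => contDiffOn_comp_preBase (φ := φ)
    (contDiff_apply (n := ∞) ℝ ℝ k).contDiffOn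
  have c1 := fun i k => contDiffOn_comp_preBase ((hs k).pd ho i)
  have c2 := fun l i k => contDiffOn_comp_preBase (((hs k).pd ho i).pd ho l)
  have hU := fun (j : Jet) (hj : j ∈ Jet.base ⁻¹' φ.toMap.target) => (hne j hj).2.2
  rw [contDiffOn_pi]
  intro k
  fin_cases k
  · exact c 0
  · exact c 1
  · exact c 2
  · exact (((c1 0 0).mul (hc 3)).sub (c1 0 2)).div (c1 2 2) hU
  · exact (((c1 1 1).mul (hc 4)).sub (c1 1 2)).div (c1 2 2) hU
  · exact ((((c1 0 0).pow 2).mul (hc 5)).sub (c2 0 0 2)).div (c1 2 2) hU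
  · exact (((c1 0 0).mul (c1 1 1)).mul (hc 6)).div (c1 2 2) hU
  · exact (((((c1 1 1).pow 2).mul (hc 7)).add ((hc 4).mul (c2 1 1 1))).sub (c2 1 1 2)).div
      (c1 2 2) hU

/-- A function of `x` only becomes a function of `x̃` only. -/
theorem isXUx_comp_preBase {h : Base → ℝ} (hh : ContDiffOn ℝ ∞ h φ.toMap.source)
    (h0 : ∀ z ∈ φ.toMap.source, pd 0 h z = 0) (h2 : ∀ z ∈ φ.toMap.source, pd 2 h z = 0) :
    IsXUx (Jet.base ⁻¹' φ.toMap.target) (fun j => h (preBase φ j)) := by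
  have ho := φ.toMap.open_source
  have ht := φ.toMap.open_target
  have hk : ContDiffOn ℝ ∞ (fun z => h (φ.toMap.symm z)) φ.toMap.target :=
    hh.comp φ.smooth_symm fun _ hz => φ.toMap.map_target hz
  -- Differentiate `(h ∘ φ⁻¹) ∘ φ = h`. In the `u` direction only `U_u` survives, and then in the
  -- `t` direction only `T_t`, so the system is triangular.
  have key : ∀ z ∈ φ.toMap.source, pd 0 (fun z => h (φ.toMap.symm z)) (φ.toMap z) = 0 ∧
      pd 2 (fun z => h (φ.toMap.symm z)) (φ.toMap z) = 0 := by
    intro z hz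
    obtain ⟨hT, hX, hU⟩ := special_ne_zero hφ hz
    have hs := hφ z hz
    have hd := (hk.contDiffAt (ht.mem_nhds (φ.toMap.map_source hz))).differentiableAt (by simp)
    have hch := fun i => HasPd.eq_of_eqOn ho hz
      (hasPd_comp hd fun l => (φ.smooth_comp l).hasPd ho hz i) (hh.hasPd ho hz i)
      fun y hy => by rw [φ.toMap.left_inv hy]
    have e2 := hch 2
    have e0 := hch 0
    rw [Fin.sum_univ_three, hs.T_u, hs.X_u, h2 z hz] at e2
    rw [Fin.sum_univ_three, hs.X_t, h0 z hz] at e0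
    have r2 : pd 2 (fun z => h (φ.toMap.symm z)) (φ.toMap z) = 0 :=
      mul_left_cancel₀ hU (by linear_combination e2)
    rw [r2] at e0
    exact ⟨mul_left_cancel₀ hT (by linear_combination e0), r2⟩
  refine isXUx_of_hasPd (ht.preimage continuous_base) (contDiffOn_comp_preBase hh)
    fun j hj i h1 _ => ?_
  have hj' : j.base ∈ φ.toMap.target := hj
  have hkey := key _ (φ.toMap.map_target hj')
  rw [φ.toMap.right_inv hj'] at hkey
  by_cases hi : 3 ≤ (i : ℕ)
  · exact hasPd_base_fiber (fun z => h (φ.toMap.symm z)) j hi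
  · have : i = 0 ∨ i = 1 ∨ i = 2 := by
      simp only [Fin.ext_iff, Fin.val_zero, Fin.val_one, Fin.val_two]; omega
    rcases this with rfl | rfl | rfl
    · exact (hk.hasPd ht hj' 0).base_zero.congr_deriv hkey.1
    · exact absurd rfl h1
    · exact (hk.hasPd ht hj' 2).base_two.congr_deriv hkey.2

end SpecialProlongation
-- The action of a special transformation on arbitrary elements
/-- The transformed arbitrary element `f̃`. -/
noncomputable def newF (φ : PointTransformation 3) (z : Base) (f : ℝ) : ℝ :=
  f * pd 1 φ.X z ^ 2 / pd 0 φ.T z ^ 2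

/-- The transformed arbitrary element `g̃`, where `q` is the value of `ũ_x̃`. -/
noncomputable def newG (φ : PointTransformation 3) (z : Base) (q f g : ℝ) : ℝ :=
  (pd 2 φ.U z * g + pd 0 (pd 0 φ.U) z - f * (pd 1 (pd 1 φ.U) z - q * pd 1 (pd 1 φ.X) z))
    / pd 0 φ.T z ^ 2

section Image

variable {φ : PointTransformation 3} {θ : ArbitraryElements} {j : Jet}

theorem specialPrInv_agree {j k : Jet} (h : ∀ i : Fin 8, (i : ℕ) ∉ ({5, 6, 7} : Finset ℕ) → k i = j i)
    (i : Fin 8) (hi : (i : ℕ) ∉ ({5, 6, 7} : Finset ℕ)) :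
    specialPrInv φ k i = specialPrInv φ j i := by
  have hb : preBase φ k = preBase φ j := by
    unfold preBase
    congr 1
    ext l
    refine h _ ?_
    fin_cases l <;> simp
  have h3 : k 3 = j 3 := h 3 (by simp)
  have h4 : k 4 = j 4 := h 4 (by simp)
  fin_cases i <;> first
    | simp [specialPrInv, hb, h3, h4]; done
    | simp at hi

variable (hφ : ∀ z ∈ φ.toMap.source, IsSpecialAt φ z)

/-- The image of a tuple of arbitrary elements under the transformation induced by `φ`. -/
noncomputable def imageElements (θ : ArbitraryElements) : ArbitraryElements where
  dom := Jet.base ⁻¹' φ.toMap.target ∩ specialPrInv φ ⁻¹' θ.dom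
  isOpen_dom := (contDiffOn_specialPrInv hφ).continuousOn.isOpen_inter_preimage
    (φ.toMap.open_target.preimage continuous_base) θ.isOpen_dom
  free_dom := by
    rintro j ⟨hj, hj'⟩ k h
    refine ⟨?_, θ.free_dom _ hj' _ (specialPrInv_agree h)⟩
    have : Jet.base k = Jet.base j := by
      ext l
      refine h _ ?_
      fin_cases l <;> simp
    rwa [Set.mem_preimage, this]
  f := fun j => newF φ (preBase φ j) (θ.f (specialPrInv φ j))
  g := fun j => newG φ (preBase φ j) (j 4) (θ.f (specialPrInv φ j)) (θ.g (specialPrInv φ j))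
  smooth_f := by
    have ho := φ.toMap.open_source
    have hs := φ.smooth_comp
    have hI := (contDiffOn_specialPrInv hφ).mono
      (Set.inter_subset_left (t := specialPrInv φ ⁻¹' θ.dom))
    have hf := θ.smooth_f.comp hI fun j hj => hj.2
    have c1 := fun i k => (contDiffOn_comp_preBase ((hs k).pd ho i)).mono
      (Set.inter_subset_left (t := specialPrInv φ ⁻¹' θ.dom))
    exact (hf.mul ((c1 1 1).pow 2)).div ((c1 0 0).pow 2)
      fun j hj => pow_ne_zero 2 (special_ne_zero hφ (preBase_mem hj.1)).1
  smooth_g := by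
    have ho := φ.toMap.open_source
    have hs := φ.smooth_comp
    have hI := (contDiffOn_specialPrInv hφ).mono
      (Set.inter_subset_left (t := specialPrInv φ ⁻¹' θ.dom))
    have hf := θ.smooth_f.comp hI fun j hj => hj.2
    have hg := θ.smooth_g.comp hI fun j hj => hj.2
    have c1 := fun i k => (contDiffOn_comp_preBase ((hs k).pd ho i)).mono
      (Set.inter_subset_left (t := specialPrInv φ ⁻¹' θ.dom))
    have c2 := fun l i k => (contDiffOn_comp_preBase (((hs k).pd ho i).pd ho l)).mono
      (Set.inter_subset_left (t := specialPrInv φ ⁻¹' θ.dom))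
    exact ((((c1 2 2).mul hg).add (c2 0 0 2)).sub (hf.mul ((c2 1 1 2).sub
      ((contDiff_apply ℝ ℝ 4).contDiffOn.mul (c2 1 1 1))))).div ((c1 0 0).pow 2)
      fun j hj => pow_ne_zero 2 (special_ne_zero hφ (preBase_mem hj.1)).1

theorem specialPr_mem_imageElements (hj : j ∈ θ.dom) (hz : j.base ∈ φ.toMap.source) :
    specialPr φ j ∈ (imageElements hφ θ).dom := by
  refine ⟨?_, ?_⟩
  · rw [Set.mem_preimage, base_specialPr]
    exact φ.toMap.map_source hz
  · rwa [Set.mem_preimage, specialPrInv_specialPr hφ hz]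

theorem imageElements_f (hz : j.base ∈ φ.toMap.source) :
    (imageElements hφ θ).f (specialPr φ j) = newF φ j.base (θ.f j) := by
  change newF _ _ _ = _
  rw [preBase_specialPr hz, specialPrInv_specialPr hφ hz]

theorem imageElements_g (hz : j.base ∈ φ.toMap.source) :
    (imageElements hφ θ).g (specialPr φ j)
      = newG φ j.base (specialPr φ j 4) (θ.f j) (θ.g j) := by
  change newG _ _ _ _ _ = _
  rw [preBase_specialPr hz, specialPrInv_specialPr hφ hz]

/-- For special `φ` the old `x` depends on `x̃` only, and the old `u_x` is affine in `ũ_x̃` with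
coefficients depending on `x̃` only, because `U_u`, `U_x` and `X_x` do not depend on `t` or `u`. -/
theorem isXUx_comp_specialPrInv {F : Jet → ℝ} (hF : IsXUx θ.dom F) :
    IsXUx (imageElements hφ θ).dom (fun j => F (specialPrInv φ j)) := by
  have ho := φ.toMap.open_source
  have hA : IsOpen (Jet.base ⁻¹' φ.toMap.target) := φ.toMap.open_target.preimage continuous_base
  have hI := contDiffOn_specialPrInv hφ
  have hx : IsXUx (Jet.base ⁻¹' φ.toMap.target) (fun j => specialPrInv φ j 1) :=
    isXUx_comp_preBase hφ (h := fun z => z 1) (contDiff_apply ℝ ℝ 1).contDiffOn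
      (fun z _ => (hasPd_coord_of_ne (by decide)).pd_eq (differentiableAt_apply _ _))
      (fun z _ => (hasPd_coord_of_ne (by decide)).pd_eq (differentiableAt_apply _ _))
  have hq : IsXUx (Jet.base ⁻¹' φ.toMap.target) (fun j => specialPrInv φ j 4) := by
    refine IsXUx.div hA (((isXUx_comp_preBase hφ ((φ.smooth_comp 1).pd ho 1) ?_ ?_).mul hA
      (isXUx_coord hA)).sub hA (isXUx_comp_preBase hφ ((φ.smooth_comp 2).pd ho 1) ?_ ?_))
      (isXUx_comp_preBase hφ ((φ.smooth_comp 2).pd ho 2) ?_ ?_)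
      fun j hj => (special_ne_zero hφ (preBase_mem hj)).2.2
    · exact fun z hz => (pd_pd_eq_zero ho (φ.smooth_comp 1) (fun z hz => (hφ z hz).X_t) 1 hz).2
    · exact fun z hz => (pd_pd_eq_zero ho (φ.smooth_comp 1) (fun z hz => (hφ z hz).X_u) 1 hz).2
    · exact fun z hz => (hφ z hz).U_tx
    · exact fun z hz => (pd_comm (φ.smooth_comp 2) ho hz 2 1).trans (hφ z hz).U_xu
    · exact fun z hz => (hφ z hz).U_tu
    · exact fun z hz => (hφ z hz).U_uu
  refine isXUx_of_hasPd (imageElements hφ θ).isOpen_dom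
    (hF.smooth.comp (hI.mono Set.inter_subset_left) fun j hj => hj.2) fun j hj i h1 h4 => ?_
  have hd : DifferentiableAt ℝ (specialPrInv φ) j :=
    (hI.contDiffAt (hA.mem_nhds hj.1)).differentiableAt (by simp)
  exact (hF.hasPd_comp θ.isOpen_dom hj.2 hd (hx.hasPd_eq_zero hA hj.1 h1 h4)
    (hq.hasPd_eq_zero hA hj.1 h1 h4)).congr_deriv (by ring)

/-- Every coefficient in `newF` and `newG` has zero `t`- and `u`-derivative by `IsSpecialAt`. The
condition `U_ttt = 0` is needed for the term `U_tt`. -/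
theorem isXUx_imageElements (hf : IsXUx θ.dom θ.f) (hg : IsXUx θ.dom θ.g) :
    IsXUx (imageElements hφ θ).dom (imageElements hφ θ).f ∧
    IsXUx (imageElements hφ θ).dom (imageElements hφ θ).g := by
  have ho := φ.toMap.open_source
  have hA := (imageElements hφ θ).isOpen_dom
  have hsub : (imageElements hφ θ).dom ⊆ Jet.base ⁻¹' φ.toMap.target := Set.inter_subset_left
  have hf' := isXUx_comp_specialPrInv hφ hf
  have hg' := isXUx_comp_specialPrInv hφ hg
  have hT := (isXUx_comp_preBase hφ ((φ.smooth_comp 0).pd ho 0) (fun z hz => (hφ z hz).T_tt)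
    fun z hz => (pd_pd_eq_zero ho (φ.smooth_comp 0) (fun z hz => (hφ z hz).T_u) 0 hz).2).mono hsub
  have hXt := fun z hz => (pd_pd_eq_zero ho (φ.smooth_comp 1) (fun z hz => (hφ z hz).X_t) 1
    (z := z) hz).2
  have hXu := fun z hz => (pd_pd_eq_zero ho (φ.smooth_comp 1) (fun z hz => (hφ z hz).X_u) 1
    (z := z) hz).2
  have hUxu := fun z hz => (pd_comm (φ.smooth_comp 2) ho (z := z) hz 2 1).trans (hφ z hz).U_xu
  have hUtu := fun z hz => (pd_comm (φ.smooth_comp 2) ho (z := z) hz 2 0).trans (hφ z hz).U_tu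
  have hX := (isXUx_comp_preBase hφ ((φ.smooth_comp 1).pd ho 1) hXt hXu).mono hsub
  have hU := (isXUx_comp_preBase hφ ((φ.smooth_comp 2).pd ho 2) (fun z hz => (hφ z hz).U_tu)
    fun z hz => (hφ z hz).U_uu).mono hsub
  have hXX := (isXUx_comp_preBase hφ (((φ.smooth_comp 1).pd ho 1).pd ho 1)
    (fun z hz => (pd_pd_eq_zero ho ((φ.smooth_comp 1).pd ho 1) hXt 1 hz).2)
    fun z hz => (pd_pd_eq_zero ho ((φ.smooth_comp 1).pd ho 1) hXu 1 hz).2).mono hsub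
  have hUXX := (isXUx_comp_preBase hφ (((φ.smooth_comp 2).pd ho 1).pd ho 1)
    (fun z hz => (pd_pd_eq_zero ho ((φ.smooth_comp 2).pd ho 1)
      (fun z hz => (hφ z hz).U_tx) 1 hz).2)
    fun z hz => (pd_pd_eq_zero ho ((φ.smooth_comp 2).pd ho 1) hUxu 1 hz).2).mono hsub
  have hUTT := (isXUx_comp_preBase hφ (((φ.smooth_comp 2).pd ho 0).pd ho 0)
    (fun z hz => (hφ z hz).U_ttt)
    fun z hz => (pd_pd_eq_zero ho ((φ.smooth_comp 2).pd ho 0) hUtu 0 hz).2).mono hsub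
  have hne : ∀ j ∈ (imageElements hφ θ).dom, pd 0 φ.T (preBase φ j) ^ 2 ≠ 0 := fun j hj =>
    pow_ne_zero 2 (special_ne_zero hφ (preBase_mem hj.1)).1
  exact ⟨(hf'.mul hA (hX.sq hA)).div hA (hT.sq hA) hne,
    (((hU.mul hA hg').add hA hUTT).sub hA (hf'.mul hA (hUXX.sub hA
      ((isXUx_coord hA).mul hA hXX)))).div hA (hT.sq hA) hne⟩

/-- Nondegeneracy is pulled back: if `f̃_q` and `g̃_qq` vanished on an open set, then `f_q` would
vanish on its preimage, so the `f`-term of `newG` would be affine in `q`, and `g_qq` would vanish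
there too. -/
theorem imageElements_mem_waveClass (hθ : θ ∈ waveClass) : imageElements hφ θ ∈ waveClass := by
  obtain ⟨hf', hg'⟩ := isXUx_imageElements hφ (isXUx_f hθ) (isXUx_g hθ)
  have hf := isXUx_f hθ
  have hg := isXUx_g hθ
  refine ⟨hf'.dep, hg'.dep, fun j hj => ?_, fun V hV hVd hVn => ?_⟩
  · obtain ⟨hT, hX, -⟩ := special_ne_zero hφ (preBase_mem hj.1)
    exact div_ne_zero (mul_ne_zero (hθ.2.2.1 _ hj.2) (pow_ne_zero 2 hX)) (pow_ne_zero 2 hT)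
  by_contra! hzero
  have hB : IsOpen (Jet.base ⁻¹' φ.toMap.source) := φ.toMap.open_source.preimage continuous_base
  set A := θ.dom ∩ (Jet.base ⁻¹' φ.toMap.source ∩ specialPr φ ⁻¹' V) with hAdef
  have hA : IsOpen A := θ.isOpen_dom.inter
    ((contDiffOn_specialPr hφ).continuousOn.isOpen_inter_preimage hB hV)
  have hAn : A.Nonempty := by
    obtain ⟨j', hj'⟩ := hVn
    have := hVd hj'
    refine ⟨specialPrInv φ j', this.2, ?_, ?_⟩
    · rw [Set.mem_preimage, base_specialPrInv]
      exact preBase_mem this.1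
    · rwa [Set.mem_preimage, specialPr_specialPrInv hφ this.1]
  obtain ⟨j, hj, hne⟩ := hθ.2.2.2 A hA Set.inter_subset_left hAn
  have hfib : ∀ {k : Jet} (F : Base → ℝ), HasPd 4 (fun j : Jet => F j.base) k 0 :=
    fun F => hasPd_base_fiber F _ (by simp)
  have hcomp : ∀ k ∈ A, ∀ {F : Jet → ℝ}, IsXUx (imageElements hφ θ).dom F →
      HasPd 4 (fun j => F (specialPr φ j)) k
        (pd 2 φ.U k.base / pd 1 φ.X k.base * pd 4 F (specialPr φ k)) := by
    intro k hk F hF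
    have hd := ((contDiffOn_specialPr hφ).contDiffAt (hB.mem_nhds hk.2.1)).differentiableAt
      (by simp)
    obtain ⟨-, hX, -⟩ := special_ne_zero hφ hk.2.1
    refine (hF.hasPd_comp (imageElements hφ θ).isOpen_dom (hVd hk.2.2) hd (hfib φ.X)
      (((hfib (pd 1 φ.U)).add (hasPd_coord_self.mul (hfib (pd 2 φ.U)))).div
        (hfib (pd 1 φ.X)) hX)).congr_deriv ?_
    field_simp
    ring
  have hfz : ∀ k ∈ A, pd 4 (imageElements hφ θ).f (specialPr φ k) = 0 := fun k hk =>
    (Prod.mk.inj (hzero _ hk.2.2)).1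
  have hgz : ∀ k ∈ A, pd 4 (pd 4 (imageElements hφ θ).g) (specialPr φ k) = 0 := fun k hk =>
    (Prod.mk.inj (hzero _ hk.2.2)).2
  have hf4 : ∀ k ∈ A, pd 4 θ.f k = 0 := by
    intro k hk
    obtain ⟨hT, hX, hU⟩ := special_ne_zero hφ hk.2.1
    have e := HasPd.eq_of_eqOn hA hk ((hcomp k hk hf').mul (hfib (pd 0 φ.T)).sq)
      ((hf.hasPd hk.1 4).mul (hfib (pd 1 φ.X)).sq) fun y hy => by
        rw [imageElements_f hφ hy.2.1, newF,
          div_mul_cancel₀ _ (pow_ne_zero 2 (special_ne_zero hφ hy.2.1).1)]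
    rw [hfz k hk] at e
    exact mul_left_cancel₀ (pow_ne_zero 2 hX) (by linear_combination -e)
  have hg4 : ∀ k ∈ A, pd 2 φ.U k.base * pd 4 (imageElements hφ θ).g (specialPr φ k)
      * pd 0 φ.T k.base ^ 2
      = pd 2 φ.U k.base * (pd 1 φ.X k.base * pd 4 θ.g k + θ.f k * pd 1 (pd 1 φ.X) k.base) := by
    intro k hk
    obtain ⟨hT, hX, hU⟩ := special_ne_zero hφ hk.2.1
    have hQ : HasPd 4 (fun j => specialPr φ j 4) k (pd 2 φ.U k.base / pd 1 φ.X k.base) :=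
      (((hfib (pd 1 φ.U)).add (hasPd_coord_self.mul (hfib (pd 2 φ.U)))).div
        (hfib (pd 1 φ.X)) hX).congr_deriv (by field_simp; ring)
    have e := HasPd.eq_of_eqOn hA hk ((hcomp k hk hg').mul (hfib (pd 0 φ.T)).sq)
      ((((hfib (pd 2 φ.U)).mul (hg.hasPd hk.1 4)).add (hfib (pd 0 (pd 0 φ.U)))).sub
        (((hf.hasPd hk.1 4).congr_deriv (hf4 k hk)).mul
          ((hfib (pd 1 (pd 1 φ.U))).sub (hQ.mul (hfib (pd 1 (pd 1 φ.X))))))) fun y hy => by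
        rw [imageElements_g hφ hy.2.1, newG,
          div_mul_cancel₀ _ (pow_ne_zero 2 (special_ne_zero hφ hy.2.1).1)]
    field_simp at e
    linear_combination e
  obtain ⟨hT, hX, hU⟩ := special_ne_zero hφ hj.2.1
  have e := HasPd.eq_of_eqOn hA hj
    (((hfib (pd 2 φ.U)).mul (hcomp j hj (hg'.pd_four (imageElements hφ θ).isOpen_dom))).mul
      (hfib (pd 0 φ.T)).sq)
    ((hfib (pd 2 φ.U)).mul (((hfib (pd 1 φ.X)).mul ((hg.pd_four θ.isOpen_dom).hasPd hj.1 4)).add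
      (((hf.hasPd hj.1 4).congr_deriv (hf4 j hj)).mul (hfib (pd 1 (pd 1 φ.X)))))) hg4
  rw [hgz j hj] at e
  refine hne ?_
  rw [hf4 j hj]
  have : pd 4 (pd 4 θ.g) j = 0 :=
    mul_left_cancel₀ (mul_ne_zero hU hX) (by linear_combination -e)
  rw [this]

theorem mapsEquation_imageElements (hdom : ∀ j ∈ θ.dom, j.base ∈ φ.toMap.source) :
    MapsEquation φ θ (imageElements hφ θ) := by
  have key : ∀ j ∈ θ.dom, (specialPr φ j 5 = (imageElements hφ θ).f (specialPr φ j)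
      * specialPr φ j 7 + (imageElements hφ θ).g (specialPr φ j) ↔
      j 5 = θ.f j * j 7 + θ.g j) := by
    intro j hj
    obtain ⟨hT, hX, hU⟩ := special_ne_zero hφ (hdom j hj)
    rw [imageElements_f hφ (hdom j hj), imageElements_g hφ (hdom j hj), newF, newG]
    have e5 : specialPr φ j 5 = (pd 0 (pd 0 φ.U) j.base + j 5 * pd 2 φ.U j.base)
      / pd 0 φ.T j.base ^ 2 := rfl
    have e7 : specialPr φ j 7 = (pd 1 (pd 1 φ.U) j.base + j 7 * pd 2 φ.U j.base
      - specialPr φ j 4 * pd 1 (pd 1 φ.X) j.base) / pd 1 φ.X j.base ^ 2 := rfl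
    rw [e5, e7]
    -- The two terms containing `ũ_x̃ X_xx`, from `ũ_xx` and from `g̃`, cancel, so its formula is
    -- not needed.
    generalize specialPr φ j 4 = q
    field_simp
    constructor
    · intro h
      exact mul_left_cancel₀ hU (by linear_combination h)
    · intro h
      linear_combination pd 2 φ.U j.base * h
  refine ⟨hdom, Set.ext fun j' => ⟨?_, fun hj' => ?_⟩⟩
  · rintro ⟨j, hj, hp⟩
    rw [prolongs_iff_specialPr hφ (hdom j hj.1)] at hp
    subst hp
    exact ⟨specialPr_mem_imageElements hφ hj.1 (hdom j hj.1), (key j hj.1).2 hj.2⟩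
  · obtain ⟨⟨hb, hd⟩, he⟩ := hj'
    refine ⟨specialPrInv φ j', ⟨hd, ?_⟩, ?_⟩
    · rwa [← key _ hd, specialPr_specialPrInv hφ hb]
    · rw [prolongs_iff_specialPr hφ (hdom _ hd), specialPr_specialPrInv hφ hb]

end Image

/-! ### Lifting special transformations to the space with coordinates `f` and `g` -/

section Extension

/-- The point with jet `j` and values `a`, `b` of the arbitrary elements. -/
def toExt (j : Jet) (a b : ℝ) : Ext := ![j 0, j 1, j 2, j 3, j 4, j 5, j 6, j 7, a, b]

theorem jet_toExt (j : Jet) (a b : ℝ) : (toExt j a b).jet = j := by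
  ext k; fin_cases k <;> rfl

theorem toExt_jet {w : Ext} {a b : ℝ} (ha : w 8 = a) (hb : w 9 = b) : toExt w.jet a b = w := by
  subst ha hb
  ext k; fin_cases k <;> rfl

theorem contDiff_jet : ContDiff ℝ ∞ Ext.jet := by
  rw [contDiff_pi]; intro k; unfold Ext.jet; fun_prop

theorem _root_.ContDiffOn.toExt {A : Set Ext} {J : Ext → Jet} {a b : Ext → ℝ}
    (hJ : ContDiffOn ℝ ∞ J A) (ha : ContDiffOn ℝ ∞ a A) (hb : ContDiffOn ℝ ∞ b A) :
    ContDiffOn ℝ ∞ (fun w => WaveClass.toExt (J w) (a w) (b w)) A := by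
  have h := contDiffOn_pi.1 hJ
  rw [contDiffOn_pi]
  intro k
  fin_cases k
  · exact h 0
  · exact h 1
  · exact h 2
  · exact h 3
  · exact h 4
  · exact h 5
  · exact h 6
  · exact h 7
  · exact ha
  · exact hb

/-- The transformation of jets and arbitrary elements induced by `φ`. -/
noncomputable def extMap (φ : PointTransformation 3) (w : Ext) : Ext :=
  toExt (specialPr φ w.jet) (newF φ w.jet.base (w 8))
    (newG φ w.jet.base (specialPr φ w.jet 4) (w 8) (w 9))

/-- The inverse of `extMap φ`. -/
noncomputable def extMapInv (φ : PointTransformation 3) (w : Ext) : Ext :=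
  toExt (specialPrInv φ w.jet)
    (w 8 * pd 0 φ.T (preBase φ w.jet) ^ 2 / pd 1 φ.X (preBase φ w.jet) ^ 2)
    ((w 9 * pd 0 φ.T (preBase φ w.jet) ^ 2 - pd 0 (pd 0 φ.U) (preBase φ w.jet)
      + w 8 * pd 0 φ.T (preBase φ w.jet) ^ 2 / pd 1 φ.X (preBase φ w.jet) ^ 2
        * (pd 1 (pd 1 φ.U) (preBase φ w.jet) - w.jet 4 * pd 1 (pd 1 φ.X) (preBase φ w.jet)))
      / pd 2 φ.U (preBase φ w.jet))

variable {φ : PointTransformation 3} {θ : ArbitraryElements}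
  (hφ : ∀ z ∈ φ.toMap.source, IsSpecialAt φ z)

include hφ

theorem extMapInv_extMap {w : Ext} (hw : w.jet.base ∈ φ.toMap.source) :
    extMapInv φ (extMap φ w) = w := by
  obtain ⟨hT, hX, hU⟩ := special_ne_zero hφ hw
  have e8 : extMap φ w 8 = newF φ w.jet.base (w 8) := rfl
  have e9 : extMap φ w 9 = newG φ w.jet.base (specialPr φ w.jet 4) (w 8) (w 9) := rfl
  have ej : (extMap φ w).jet = specialPr φ w.jet := jet_toExt _ _ _
  rw [extMapInv, ej, preBase_specialPr hw, specialPrInv_specialPr hφ hw, e8, e9, newF, newG]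
  refine toExt_jet ?_ ?_
  · field_simp
  · generalize specialPr φ w.jet 4 = q
    field_simp
    ring

theorem extMap_extMapInv {w : Ext} (hw : w.jet.base ∈ φ.toMap.target) :
    extMap φ (extMapInv φ w) = w := by
  obtain ⟨hT, hX, hU⟩ := special_ne_zero hφ (preBase_mem hw)
  have ej : (extMapInv φ w).jet = specialPrInv φ w.jet := jet_toExt _ _ _
  rw [extMap, ej, base_specialPrInv, specialPr_specialPrInv hφ hw]
  refine toExt_jet ?_ ?_
  · change w 8 = _ * _ / _
    simp only [extMapInv, toExt, Matrix.cons_val]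
    field_simp
  · simp only [extMapInv, toExt, newG, Matrix.cons_val]
    field_simp
    ring

theorem image_extMap_graph (hdom : ∀ j ∈ θ.dom, j.base ∈ φ.toMap.source) :
    extMap φ '' θ.graph = (imageElements hφ θ).graph := by
  have hsub : ∀ w ∈ θ.graph, extMap φ w ∈ (imageElements hφ θ).graph := by
    rintro w ⟨hw, h8, h9⟩
    have ej : (extMap φ w).jet = specialPr φ w.jet := jet_toExt _ _ _
    refine ⟨?_, ?_, ?_⟩
    · rw [ej]; exact specialPr_mem_imageElements hφ hw (hdom _ hw)
    · rw [ej, imageElements_f hφ (hdom _ hw), ← h8]; rfl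
    · rw [ej, imageElements_g hφ (hdom _ hw), ← h8, ← h9]; rfl
  refine Set.Subset.antisymm (Set.image_subset_iff.2 hsub) ?_
  rintro w ⟨hw, h8, h9⟩
  have ej := jet_toExt (specialPrInv φ w.jet) (θ.f (specialPrInv φ w.jet))
    (θ.g (specialPrInv φ w.jet))
  refine ⟨toExt (specialPrInv φ w.jet) (θ.f (specialPrInv φ w.jet))
    (θ.g (specialPrInv φ w.jet)), ⟨?_, ?_, ?_⟩, ?_⟩
  · rw [ej]; exact hw.2
  · rw [ej]; rfl
  · rw [ej]; rfl
  · rw [extMap, ej, base_specialPrInv, specialPr_specialPrInv hφ hw.1]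
    exact toExt_jet h8 h9

theorem contDiffOn_extMap :
    ContDiffOn ℝ ∞ (extMap φ) ((fun w : Ext => w.jet.base) ⁻¹' φ.toMap.source) := by
  have ho := φ.toMap.open_source
  have hs := φ.smooth_comp
  have lift : ∀ {h : Base → ℝ}, ContDiffOn ℝ ∞ h φ.toMap.source →
      ContDiffOn ℝ ∞ (fun w : Ext => h w.jet.base)
        ((fun w : Ext => w.jet.base) ⁻¹' φ.toMap.source) := fun hh =>
    hh.comp_base.comp contDiff_jet.contDiffOn fun w hw => hw
  have hP : ContDiffOn ℝ ∞ (fun w : Ext => specialPr φ w.jet)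
      ((fun w : Ext => w.jet.base) ⁻¹' φ.toMap.source) :=
    (contDiffOn_specialPr hφ).comp contDiff_jet.contDiffOn fun w hw => hw
  have h8 := (contDiff_apply (n := ∞) ℝ ℝ (8 : Fin 10)).contDiffOn
    (s := (fun w : Ext => w.jet.base) ⁻¹' φ.toMap.source)
  have h9 := (contDiff_apply (n := ∞) ℝ ℝ (9 : Fin 10)).contDiffOn
    (s := (fun w : Ext => w.jet.base) ⁻¹' φ.toMap.source)
  have c1 := fun i k => lift ((hs k).pd ho i)
  have c2 := fun l i k => lift (((hs k).pd ho i).pd ho l)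
  have hT : ∀ w ∈ (fun w : Ext => w.jet.base) ⁻¹' φ.toMap.source,
      pd 0 φ.T w.jet.base ^ 2 ≠ 0 := fun w hw => pow_ne_zero 2 (special_ne_zero hφ hw).1
  exact hP.toExt ((h8.mul ((c1 1 1).pow 2)).div ((c1 0 0).pow 2) hT)
    (((((c1 2 2).mul h9).add (c2 0 0 2)).sub (h8.mul ((c2 1 1 2).sub
      ((contDiffOn_pi.1 hP 4).mul (c2 1 1 1))))).div ((c1 0 0).pow 2) hT)

theorem contDiffOn_extMapInv :
    ContDiffOn ℝ ∞ (extMapInv φ) ((fun w : Ext => w.jet.base) ⁻¹' φ.toMap.target) := by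
  have ho := φ.toMap.open_source
  have hs := φ.smooth_comp
  have lift : ∀ {h : Base → ℝ}, ContDiffOn ℝ ∞ h φ.toMap.source →
      ContDiffOn ℝ ∞ (fun w : Ext => h (preBase φ w.jet))
        ((fun w : Ext => w.jet.base) ⁻¹' φ.toMap.target) := fun hh =>
    (contDiffOn_comp_preBase hh).comp contDiff_jet.contDiffOn fun w hw => hw
  have hP : ContDiffOn ℝ ∞ (fun w : Ext => specialPrInv φ w.jet)
      ((fun w : Ext => w.jet.base) ⁻¹' φ.toMap.target) :=
    (contDiffOn_specialPrInv hφ).comp contDiff_jet.contDiffOn fun w hw => hw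
  have hj4 : ContDiffOn ℝ ∞ (fun w : Ext => w.jet 4)
      ((fun w : Ext => w.jet.base) ⁻¹' φ.toMap.target) :=
    (contDiff_pi.1 contDiff_jet 4).contDiffOn
  have h8 := (contDiff_apply (n := ∞) ℝ ℝ (8 : Fin 10)).contDiffOn
    (s := (fun w : Ext => w.jet.base) ⁻¹' φ.toMap.target)
  have h9 := (contDiff_apply (n := ∞) ℝ ℝ (9 : Fin 10)).contDiffOn
    (s := (fun w : Ext => w.jet.base) ⁻¹' φ.toMap.target)
  have c1 := fun i k => lift ((hs k).pd ho i)
  have c2 := fun l i k => lift (((hs k).pd ho i).pd ho l)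
  have hne : ∀ w ∈ (fun w : Ext => w.jet.base) ⁻¹' φ.toMap.target, _ := fun w hw =>
    special_ne_zero hφ (preBase_mem (φ := φ) (j := w.jet) hw)
  have hf := (h8.mul ((c1 0 0).pow 2)).div ((c1 1 1).pow 2)
    fun w hw => pow_ne_zero 2 (hne w hw).2.1
  exact hP.toExt hf ((((h9.mul ((c1 0 0).pow 2)).sub (c2 0 0 2)).add
    (hf.mul ((c2 1 1 2).sub (hj4.mul (c2 1 1 1))))).div (c1 2 2) fun w hw => (hne w hw).2.2)

omit hφ in
/-- The point transformation of jets and arbitrary elements induced by `φ`. -/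
noncomputable def extTransformation (hφ : ∀ z ∈ φ.toMap.source, IsSpecialAt φ z) :
    PointTransformation 10 where
  toMap :=
    { toFun := extMap φ
      invFun := extMapInv φ
      source := (fun w : Ext => w.jet.base) ⁻¹' φ.toMap.source
      target := (fun w : Ext => w.jet.base) ⁻¹' φ.toMap.target
      map_source' := fun w hw => by
        have ej : Ext.jet (extMap φ w) = specialPr φ (Ext.jet w) := jet_toExt _ _ _
        rw [Set.mem_preimage, ej, base_specialPr]
        exact φ.toMap.map_source hw
      map_target' := fun w hw => by
        have ej : Ext.jet (extMapInv φ w) = specialPrInv φ (Ext.jet w) := jet_toExt _ _ _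
        rw [Set.mem_preimage, ej, base_specialPrInv]
        exact preBase_mem hw
      left_inv' := fun w hw => extMapInv_extMap hφ hw
      right_inv' := fun w hw => extMap_extMapInv hφ hw
      open_source := φ.toMap.open_source.preimage (continuous_base.comp contDiff_jet.continuous)
      open_target := φ.toMap.open_target.preimage (continuous_base.comp contDiff_jet.continuous)
      continuousOn_toFun := (contDiffOn_extMap hφ).continuousOn
      continuousOn_invFun := (contDiffOn_extMapInv hφ).continuousOn }
  smooth := contDiffOn_extMap hφ
  smooth_symm := contDiffOn_extMapInv hφ

end Extension
-- Normalization of the subclass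
section Normalization

variable {φ : PointTransformation 3} {θ θ' : ArbitraryElements}

theorem isContactLiftOf_extTransformation (hφ : ∀ z ∈ φ.toMap.source, IsSpecialAt φ z) :
    IsContactLiftOf (extTransformation hφ) φ := by
  refine ⟨Set.ext fun z => ⟨fun hz => ?_, ?_⟩, fun w hw => ?_⟩
  · have e : (toExt ![z 0, z 1, z 2, 0, 0, 0, 0, 0] 0 0).jet.base = z := by
      rw [jet_toExt]
      ext k; fin_cases k <;> rfl
    refine ⟨_, ?_, e⟩
    change (toExt _ 0 0).jet.base ∈ φ.toMap.source
    rwa [e]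
  · rintro ⟨w, hw, rfl⟩
    exact hw
  · rw [prolongs_iff_specialPr hφ hw]
    exact jet_toExt _ _ _

/-- If `φ` is special and the components of `Φ` are those of `extMap φ` wherever `f ≠ 0`, then
`Φ` maps any element of the class over its domain to an element of the class. -/
theorem exists_image_of_special (hφ : ∀ z ∈ φ.toMap.source, IsSpecialAt φ z)
    {Φ : PointTransformation 10}
    (hΦ : ∀ w ∈ Φ.toMap.source, w 8 ≠ 0 → Φ.toMap w = extMap φ w)
    (hsrc : ∀ w ∈ Φ.toMap.source, Jet.base (Ext.jet w) ∈ φ.toMap.source)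
    (hθ : θ ∈ waveClass) (hgr : θ.graph ⊆ Φ.toMap.source) :
    ∃ θ' ∈ waveClass, ActsTo Φ θ θ' ∧ MapsEquation φ θ θ' := by
  have hdom : ∀ j ∈ θ.dom, j.base ∈ φ.toMap.source := by
    intro j hj
    have e := jet_toExt j (θ.f j) (θ.g j)
    have hw : toExt j (θ.f j) (θ.g j) ∈ θ.graph := ⟨by rwa [e], by rw [e]; rfl, by rw [e]; rfl⟩
    simpa [e] using hsrc _ (hgr hw)
  refine ⟨imageElements hφ θ, imageElements_mem_waveClass hφ hθ, ⟨hgr, ?_⟩,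
    mapsEquation_imageElements hφ hdom⟩
  rw [← image_extMap_graph hφ hdom]
  refine Set.image_congr fun w hw => hΦ w (hgr hw) ?_
  rw [hw.2.1]
  exact hθ.2.2.1 _ hw.1

theorem SubclassMap.isSpecialAt (H : SubclassMap φ θ θ') {z : Base} (hz : z ∈ Jet.base '' θ.dom) :
    IsSpecialAt φ z :=
  H.isSpecialAt_and_g_transform.1 z hz

/-- The transformation of arbitrary elements is determined by that of the variables. -/
theorem SubclassMap.eq_newF_newG (H : SubclassMap φ θ θ') {j j' : Jet} (hj : j ∈ θ.dom)
    (hp : Prolongs φ.toMap j j') :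
    j' ∈ θ'.dom ∧ θ'.f j' = newF φ j.base (θ.f j) ∧
      θ'.g j' = newG φ j.base (j' 4) (θ.f j) (θ.g j) := by
  obtain ⟨-, rfl⟩ := prolongs_iff.1 hp
  have hT := pow_ne_zero 2 (H.T_t_ne_zero ⟨j, hj, rfl⟩)
  have hmem := H.pr1_mem hj
  have hag := fun i hi => pr2_agree (φ := φ.toMap) (j := j) i hi
  refine ⟨θ'.free_dom _ hmem _ hag, ?_, ?_⟩
  · rw [H.isXUx_f'.eq_of_fiber θ'.isOpen_dom θ'.free_dom hmem hag, newF, eq_div_iff hT,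
      H.f_transform hj]
  · rw [H.isXUx_g'.eq_of_fiber θ'.isOpen_dom θ'.free_dom hmem hag, newG, eq_div_iff hT,
      H.isSpecialAt_and_g_transform.2 j hj]
    rfl

/-- The lift of `φ` induces the admissible transformation because `f̃` and `g̃` are already forced
to be `newF` and `newG`. -/
theorem normalized_waveSubclass : Normalized waveSubclass := by
  intro θ θ' φ h
  have H : SubclassMap φ θ θ' := ⟨h.1, h.2.1, h.2.2⟩
  have hΩ := isOpen_image_base θ.isOpen_dom
  have hΩs : Jet.base '' θ.dom ⊆ φ.toMap.source := by
    rintro _ ⟨j, hj, rfl⟩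
    exact H.maps.1 j hj
  -- Over the rest of its source `φ` is arbitrary, so it is restricted to the points lying under the
  -- domain of the equation, where it is known to be special.
  let ψ : PointTransformation 3 :=
    { toMap := φ.toMap.restrOpen _ hΩ
      smooth := φ.smooth.mono fun z hz => hz.1
      smooth_symm := φ.smooth_symm.mono fun z hz => hz.1 }
  have hsrc : ψ.toMap.source = Jet.base '' θ.dom := Set.inter_eq_right.2 hΩs
  have Hψ : SubclassMap ψ θ θ' :=
    ⟨H.mem, H.mem', fun j hj => hsrc ▸ ⟨j, hj, rfl⟩, H.maps.2⟩
  have hψ : ∀ z ∈ ψ.toMap.source, IsSpecialAt ψ z := fun z hz =>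
    Hψ.isSpecialAt (hsrc ▸ hz)
  have hlift := isContactLiftOf_extTransformation hψ
  have hmapExt : ∀ w ∈ θ.graph, (extMap ψ w) ∈ θ'.graph := by
    rintro w ⟨hw, h8, h9⟩
    have ej : (extMap ψ w).jet = specialPr ψ w.jet := jet_toExt _ _ _
    obtain ⟨h1, h2, h3⟩ := Hψ.eq_newF_newG hw
      ((prolongs_iff_specialPr hψ (Hψ.maps.1 _ hw)).2 rfl)
    refine ⟨by rwa [ej], ?_, ?_⟩
    · rw [ej, h2, ← h8]; rfl
    · rw [ej, h3, ← h8, ← h9]; rfl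
  refine ⟨extTransformation hψ, ⟨ψ, ?_, hlift, ?_⟩, ψ, hlift, ⟨?_, ?_⟩, fun z _ => rfl⟩
  · intro w hw w' hag
    have : Jet.base (Ext.jet w') = Jet.base (Ext.jet w) := by
      ext k
      refine hag _ ?_
      fin_cases k <;> simp
    change Jet.base (Ext.jet w') ∈ ψ.toMap.source
    rw [this]
    exact hw
  · intro η hη hgr
    obtain ⟨η', hη', ha, hm⟩ := exists_image_of_special hψ (Φ := extTransformation hψ)
      (fun w _ _ => rfl) (fun w hw => hw) hη.1 hgr
    exact ⟨η', mem_waveSubclass_of_admissible ⟨hη.1, hη', hm⟩ hη, ha, hm⟩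
  · exact fun w hw => Hψ.maps.1 _ hw.1
  · refine Set.Subset.antisymm (Set.image_subset_iff.2 hmapExt) ?_
    rintro w ⟨hw, h8, h9⟩
    -- The preimage `k` need match `w` only up to first order; since the domain of `θ` is free in
    -- the second-order derivatives, the exact preimage `specialPrInv ψ w.jet` also lies in it.
    obtain ⟨k, hk, hΔ, hag⟩ := Hψ.maps.exists_preimage Hψ.mem'.1 hw
    have hpr := (prolongs_iff_specialPr hψ (Hψ.maps.1 k hk)).1 (prolongs_iff.2 ⟨hΔ, rfl⟩)
    have hag' : ∀ i : Fin 8, (i : ℕ) ∉ ({5, 6, 7} : Finset ℕ) →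
        (Ext.jet w) i = specialPr ψ k i := fun i hi => by rw [hag i hi, ← pr2_agree i hi, hpr]
    have hbt : Jet.base (Ext.jet w) ∈ ψ.toMap.target := by
      have : Jet.base (Ext.jet w) = (specialPr ψ k).base := by
        ext l
        refine hag' _ ?_
        fin_cases l <;> simp
      rw [this, base_specialPr]
      exact ψ.toMap.map_source (Hψ.maps.1 k hk)
    have hd : specialPrInv ψ (Ext.jet w) ∈ θ.dom := by
      refine θ.free_dom k hk _ fun i hi => ?_
      rw [specialPrInv_agree hag' i hi, specialPrInv_specialPr hψ (Hψ.maps.1 k hk)]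
    have ej := jet_toExt (specialPrInv ψ (Ext.jet w)) (θ.f (specialPrInv ψ (Ext.jet w)))
      (θ.g (specialPrInv ψ (Ext.jet w)))
    obtain ⟨-, h2, h3⟩ := Hψ.eq_newF_newG hd
      ((prolongs_iff_specialPr hψ (Hψ.maps.1 _ hd)).2 rfl)
    rw [specialPr_specialPrInv hψ hbt] at h2 h3
    refine ⟨toExt (specialPrInv ψ (Ext.jet w)) (θ.f (specialPrInv ψ (Ext.jet w)))
      (θ.g (specialPrInv ψ (Ext.jet w))), ⟨by rwa [ej], by rw [ej]; rfl, by rw [ej]; rfl⟩, ?_⟩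
    change extMap ψ _ = w
    rw [extMap, ej, specialPr_specialPrInv hψ hbt]
    exact toExt_jet (h8.trans h2) (h9.trans h3)

end Normalization

/-! ### Coincidence of the equivalence groups -/

section EquivalenceGroup

theorem continuous_toExt {a b : Jet → ℝ} (ha : Continuous a) (hb : Continuous b) :
    Continuous (fun j => toExt j (a j) (b j)) := by
  refine continuous_pi fun k => ?_
  fin_cases k
  · exact continuous_apply 0
  · exact continuous_apply 1
  · exact continuous_apply 2
  · exact continuous_apply 3
  · exact continuous_apply 4
  · exact continuous_apply 5
  · exact continuous_apply 6
  · exact continuous_apply 7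
  · exact ha
  · exact hb

theorem toExt_agree {j k : Jet} {a a' b b' : ℝ}
    (h : ∀ i : Fin 8, (i : ℕ) ∉ ({5, 6, 7} : Finset ℕ) → k i = j i) (ha : a' = a) (hb : b' = b)
    (i : Fin 10) (hi : (i : ℕ) ∉ ({5, 6, 7} : Finset ℕ)) : toExt k a' b' i = toExt j a b i := by
  subst ha hb
  by_cases hi' : (i : ℕ) < 8
  · exact (congrFun (jet_toExt k a' b') ⟨i, hi'⟩).trans
      ((h ⟨i, hi'⟩ hi).trans (congrFun (jet_toExt j a' b') ⟨i, hi'⟩).symm)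
  · have : i = 8 ∨ i = 9 := by
      simp only [Fin.ext_iff]
      change (i : ℕ) = 8 ∨ (i : ℕ) = 9
      omega
    have e8 : ∀ l : Jet, toExt l a' b' 8 = a' := fun _ => rfl
    have e9 : ∀ l : Jet, toExt l a' b' 9 = b' := fun _ => rfl
    rcases this with rfl | rfl
    · rw [e8, e8]
    · rw [e9, e9]

/-- The equation with constant `f` and quadratic `g` whose graph passes through `w`, restricted
so that its graph is contained in `A`. -/
noncomputable def quadraticElements {A : Set Ext} (hA : IsOpen A) (hfree : FreeInSecondDerivatives A)
    (w : Ext) : ArbitraryElements where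
  dom := (fun j : Jet => toExt j (w 8) (w 9 + (j 4 - w 4) ^ 2)) ⁻¹' A
  isOpen_dom := hA.preimage (continuous_toExt (by fun_prop) (by fun_prop))
  free_dom := fun j hj j' h => hfree _ hj _
    (toExt_agree h rfl (by rw [h 4 (by simp)]))
  f := fun _ => w 8
  g := fun j => w 9 + (j 4 - w 4) ^ 2
  smooth_f := contDiffOn_const
  smooth_g := by fun_prop

variable {A : Set Ext} (hA : IsOpen A) (hfree : FreeInSecondDerivatives A) {w : Ext}

theorem graph_quadraticElements_subset : (quadraticElements hA hfree w).graph ⊆ A := by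
  rintro v ⟨hv, h8, h9⟩
  have h : toExt v.jet (w 8) (w 9 + (v.jet 4 - w 4) ^ 2) ∈ A := hv
  have e : toExt v.jet (w 8) (w 9 + (v.jet 4 - w 4) ^ 2) = v := toExt_jet h8 h9
  rwa [e] at h

theorem mem_graph_quadraticElements (hw : w ∈ A) : w ∈ (quadraticElements hA hfree w).graph := by
  have e4 : w.jet 4 = w 4 := rfl
  have e9 : w 9 = w 9 + (w.jet 4 - w 4) ^ 2 := by rw [e4]; ring
  refine ⟨?_, rfl, e9⟩
  change toExt w.jet (w 8) (w 9 + (w.jet 4 - w 4) ^ 2) ∈ A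
  rwa [toExt_jet rfl e9]

theorem quadraticElements_mem (h8 : w 8 ≠ 0) :
    quadraticElements hA hfree w ∈ waveSubclass := by
  have hB := (quadraticElements hA hfree w).isOpen_dom
  have hf : ∀ i (j : Jet), pd i (quadraticElements hA hfree w).f j = 0 := fun i j =>
    (hasPd_const (w 8)).pd_eq (differentiableAt_const _)
  have hq : ∀ j : Jet, HasPd 4 (fun j => w 9 + (j 4 - w 4) ^ 2) j (2 * (j 4 - w 4)) := fun j =>
    ((hasPd_const _).add ((hasPd_coord_self.sub (hasPd_const _)).sq)).congr_deriv (by ring)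
  have hg : IsXUx (quadraticElements hA hfree w).dom (quadraticElements hA hfree w).g :=
    isXUx_of_hasPd hB (quadraticElements hA hfree w).smooth_g fun j hj i h1 h4 =>
      ((hasPd_const _).add (((hasPd_coord_of_ne (Ne.symm h4)).sub (hasPd_const _)).sq)).congr_deriv
        (by ring)
  have hg1 : pd 4 (quadraticElements hA hfree w).g = fun j => 2 * (j 4 - w 4) := funext fun j =>
    (hq j).pd_eq (by change DifferentiableAt ℝ (fun j : Jet => w 9 + (j 4 - w 4) ^ 2) j; fun_prop)
  have hg2 : ∀ j, pd 4 (pd 4 (quadraticElements hA hfree w).g) j = 2 := fun j => by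
    rw [hg1]
    exact (((hasPd_coord_self.sub (hasPd_const _)).const_mul 2).congr_deriv (by ring)).pd_eq
      (by fun_prop)
  refine ⟨⟨fun j _ => ⟨hf _ j, hf _ j, hf _ j, hf _ j, hf _ j, hf _ j⟩, hg.dep, fun _ _ => h8,
    fun V _ _ ⟨j, hj⟩ => ⟨j, hj, ?_⟩⟩, fun j _ => hf _ j, fun V _ _ ⟨j, hj⟩ => ⟨j, hj, ?_⟩⟩
  · rw [hg2]; simp
  · rw [hg2]; exact two_ne_zero

/-- The subclass has enough elements to determine an equivalence transformation wherever `f ≠ 0`,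
and graphs of elements of the class contain no points with `f = 0`. -/
theorem equivalenceGroup_waveSubclass :
    equivalenceGroup waveSubclass = equivalenceGroup waveClass := by
  ext Φ
  refine exists_congr fun φ => ⟨?_, ?_⟩
  · rintro ⟨hfree, hlift, hall⟩
    have hA := Φ.toMap.open_source
    have hbase : ∀ w ∈ Φ.toMap.source, Jet.base (Ext.jet w) ∈ φ.toMap.source := fun w hw =>
      hlift.1 ▸ ⟨w, hw, rfl⟩
    have key : ∀ w ∈ Φ.toMap.source, w 8 ≠ 0 → ∃ θ', w ∈ (quadraticElements hA hfree w).graph ∧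
        SubclassMap φ (quadraticElements hA hfree w) θ' ∧
        ActsTo Φ (quadraticElements hA hfree w) θ' := by
      intro w hw h8
      have hmem := quadraticElements_mem hA hfree h8
      obtain ⟨θ', hθ', ha, hm⟩ := hall _ hmem (graph_quadraticElements_subset hA hfree)
      exact ⟨θ', mem_graph_quadraticElements hA hfree hw, ⟨hmem, hθ', hm⟩, ha⟩
    have hφ : ∀ z ∈ φ.toMap.source, IsSpecialAt φ z := by
      intro z hz
      rw [hlift.1] at hz
      obtain ⟨w, hw, rfl⟩ := hz
      -- No graph passes through a point with `f = 0`, but specialness concerns only the base point,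
      -- so the coordinate `f` may be shifted within the open domain.
      obtain ⟨v, hv, h8, hj⟩ : ∃ v ∈ Φ.toMap.source, v 8 ≠ 0 ∧ Ext.jet v = Ext.jet w := by
        by_cases h8 : w 8 = 0
        · obtain ⟨s, hs, hs'⟩ := exists_line_mem hA hw 8
          refine ⟨_, hs', by simpa [h8] using hs, ?_⟩
          ext k
          fin_cases k <;> simp [Ext.jet, Fin.ext_iff]
        · exact ⟨w, hw, h8, rfl⟩
      obtain ⟨θ', hgr, H, -⟩ := key v hv h8
      have := H.isSpecialAt ⟨Ext.jet v, hgr.1, rfl⟩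
      rwa [hj] at this
    -- The test element through `w` fixes the values of `f̃` and `g̃` at the image, and the contact
    -- condition fixes the jet.
    have hΦ : ∀ w ∈ Φ.toMap.source, w 8 ≠ 0 → Φ.toMap w = extMap φ w := by
      intro w hw h8
      obtain ⟨θ', hgr, H, ha⟩ := key w hw h8
      have hp := hlift.2 w hw
      obtain ⟨-, h2, h3⟩ := H.eq_newF_newG hgr.1 hp
      have him : Φ.toMap w ∈ θ'.graph := ha.2 ▸ Set.mem_image_of_mem _ hgr
      rw [prolongs_iff_specialPr hφ (hbase w hw)] at hp
      rw [← him.2.1, ← hgr.2.1] at h2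
      rw [← him.2.2, ← hgr.2.1, ← hgr.2.2] at h3
      rw [extMap, ← hp]
      exact (toExt_jet h2 h3).symm
    exact ⟨hfree, hlift, fun θ hθ hgr => exists_image_of_special hφ hΦ hbase hθ hgr⟩
  · rintro ⟨hfree, hlift, hall⟩
    refine ⟨hfree, hlift, fun θ hθ hgr => ?_⟩
    obtain ⟨θ', hθ', ha, hm⟩ := hall θ hθ.1 hgr
    exact ⟨θ', mem_waveSubclass_of_admissible ⟨hθ.1, hθ', hm⟩ hθ, ha, hm⟩

end EquivalenceGroup

end WaveClass

theorem mainTheorem5 :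
    (∀ θ θ' : WaveClass.ArbitraryElements, ∀ φ : WaveClass.PointTransformation 3,
      (θ, θ', φ) ∈ WaveClass.admissibleTransformations WaveClass.waveClass →
      θ ∈ WaveClass.waveSubclass → θ' ∈ WaveClass.waveSubclass) ∧
    WaveClass.Normalized WaveClass.waveSubclass ∧
    WaveClass.equivalenceGroup WaveClass.waveSubclass =
      WaveClass.equivalenceGroup WaveClass.waveClass :=
  ⟨fun _ _ _ h hθ => WaveClass.mem_waveSubclass_of_admissible h hθ,
    WaveClass.normalized_waveSubclass, WaveClass.equivalenceGroup_waveSubclass⟩
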